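/- **Conventions.** A grid diagram $D$ of size $n$ is an $n\times n$ grid with one $X$ and one $O$ in each row and in each column, no square containing both; the link runs from $X$ to $O$ in columns and from $O$ to $X$ in rows, with vertical segments over horizontal ones, and $wr(D)$ is the writhe of this planar diagram. Legendrian link types in the standard contact $\mathbb R^3$ are represented by grid diagrams up to translation on the torus, commutation of adjacent rows or columns, and (de)stabilization of types $X{:}NW$ and $X{:}SE$; the underlying topological type is the mirror image of the link of $D$. $GC^-(D)$ is the free $\mathbb F_2[V_1,\dots,V_n]$-module on the grid states with $\partial x=\sum_y\sum_{r\in \mathrm{Rect}^\circ(x,y),\,r\cap\mathbb X=\emptyset}V_1^{O_1(r)}\cdots V_n^{O_n(r)}\,y$, $GH^-(D)$ is its homology, and $\lambda^+(D)=[x^+]$, $\lambda^-(D)=[x^-]$, where $x^+$ (resp. $x^-$) consists of the north-east (resp. south-west) corners of the squares marked $X$. For a Legendrian link $L$ represented by $D$, the equation $\lambda^+(L)=\lambda^-(L)$ means $\lambda^+(D)=\lambda^-(D)$; put $\eta=\lambda^++\lambda^-$. **Cables.** Let $p\ge 2$, and let $G$ be any grid diagram of the Legendrian knot $K$; if $p>2$,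 assume that no $X$ of $G$ is a north-west or south-east corner (which can be arranged by stabilizations that preserve $K$). Replace every empty square by an empty $p\times p$ block, every $X$ by $p$ $X$'s on the south-west to north-east diagonal, and every $O$ by $p$ $O$'s as follows. At a north-east or south-west corner they lie on the south-west to north-east diagonal (type A), or on the block obtained from it by shifting the $p$ strands cyclically by one place, which creates $p-1$ positive crossings (type B); at a north-west or south-east corner they lie on the other diagonal (type C), or on its cyclic shift with $p-1$ negative crossings (type D). The shifts are in one direction along the knot for all blocks B and in the opposite direction for all blocks D. Let $b$ and $d$ be the numbers of blocks of types B and D, and $x$ the number of $X$'s at north-west or south-east corners of $G$. The Legendrian link represented by the new grid is a Legendrian cable $K_{p,q}$ of $K$, with $q=-(p\,wr(G)+b-d-x)$. **Theorem.** Let $K$ be a Legendrian knot, $p\ge2$ and $r\in\mathbb Z$, and let $K_{p,-pr\pm1}$ be any Legendrian cable of $K$ with coefficient $-pr+1$ or $-pr-1$ obtained by this construction from some grid diagram of $K$. Then $$\lambda^+(K_{p,-pr\pm1})=\lambda^-(K_{p,-pr\pm1})\iff\lambda^+(K)=\lambda^-(K),$$ where both sides may be tested on any grid diagrams of $K_{p,-pr\pm1}$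 and $K$. Equivalently, $\eta(K_{p,-pr\pm1})=0$ if and only if $\eta(K)=0$. -/

import Mathlib

open scoped BigOperators

/-- An `n × n` grid diagram. Columns and rows are numbered from left to right and from bottom to
top; the square in column `c` and row `r` is `[c, c + 1] × [r, r + 1]`. The `X` of column `c` is in
row `X c` and the `O` of column `c` is in row `O c`. The link runs in columns from `X` to `O`, in
rows from `O` to `X`, and vertical segments pass over horizontal ones. -/
structure Grid (n : ℕ) where
  X : Equiv.Perm (Fin n)
  O : Equiv.Perm (Fin n)
  disjoint : ∀ c, X c ≠ O c

namespace Grid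

variable {n : ℕ}

/-- The diagram represents a knot: going from a column along its vertical segment and the next
horizontal one, one meets every column. -/
def IsKnot (G : Grid n) : Prop :=
  0 < n ∧ ∀ a b : Fin n, (G.X⁻¹ * G.O).SameCycle a b

/-! ### Legendrian moves -/

/-- Shift all markings one column to the right on the torus. -/
def shiftColumns (G : Grid n) : Grid n where
  X := G.X * (finRotate n)⁻¹
  O := G.O * (finRotate n)⁻¹
  disjoint _ := G.disjoint _

/-- Shift all markings one row up on the torus. -/
def shiftRows (G : Grid n) : Grid n where
  X := finRotate n * G.X
  O := finRotate n * G.O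
  disjoint c h := G.disjoint c ((finRotate n).injective h)

/-- Interchange the columns `a` and `b`. -/
def swapColumns (G : Grid n) (a b : Fin n) : Grid n where
  X := G.X * Equiv.swap a b
  O := G.O * Equiv.swap a b
  disjoint _ := G.disjoint _

/-- Interchange the rows `a` and `b`. -/
def swapRows (G : Grid n) (a b : Fin n) : Grid n where
  X := Equiv.swap a b * G.X
  O := Equiv.swap a b * G.O
  disjoint c h := G.disjoint c ((Equiv.swap a b).injective h)

/-- The four points `x, o, x', o'` of the cyclically ordered set `Fin n` are distinct, and `x'`, `o'`
lie on the same one of the two arcs into which `x` and `o` separate the circle. -/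
def Unlinked (x o x' o' : Fin n) : Prop :=
  x ≠ o ∧ x ≠ x' ∧ x ≠ o' ∧ o ≠ x' ∧ o ≠ o' ∧ x' ≠ o' ∧ (x' - x < o - x ↔ o' - x < o - x)

/-- Insert a new column at position `a` and a new row at position `b` with a point in the new square;
the other columns and rows keep their order and the points they contain. -/
def insertPoint (σ : Equiv.Perm (Fin n)) (a b : Fin (n + 1)) : Equiv.Perm (Fin (n + 1)) :=
  (finSuccEquiv' a).trans ((Equiv.optionCongr σ).trans (finSuccEquiv' b).symm)

theorem insertPoint_self (σ : Equiv.Perm (Fin n)) (a b : Fin (n + 1)) :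
    insertPoint σ a b a = b := by
  simp [insertPoint]

theorem insertPoint_succAbove (σ : Equiv.Perm (Fin n)) (a b : Fin (n + 1)) (c : Fin n) :
    insertPoint σ a b (a.succAbove c) = b.succAbove (σ c) := by
  simp [insertPoint]

theorem eq_of_succAbove_eq (r a b : Fin n)
    (h : r.succ.succAbove a = r.castSucc.succAbove b) : a = b := by
  rcases lt_trichotomy a r with hl | rfl | hl
  · have : r.succ.succAbove a = r.castSucc.succAbove a := by
      rw [Fin.succAbove_of_castSucc_lt _ _ (by rw [Fin.lt_def] at hl ⊢; simp; omega),
        Fin.succAbove_of_castSucc_lt _ _ (by simpa using hl)]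
    exact Fin.succAbove_right_injective (this ▸ h)
  · rw [Fin.succAbove_succ_self] at h
    exact absurd h.symm (Fin.succAbove_ne _ _)
  · have : r.succ.succAbove a = r.castSucc.succAbove a := by
      rw [Fin.succAbove_of_le_castSucc _ _ (by rw [Fin.lt_def] at hl; rw [Fin.le_def]; simp; omega),
        Fin.succAbove_of_le_castSucc _ _ (by rw [Fin.lt_def] at hl; rw [Fin.le_def]; simp; omega)]
    exact Fin.succAbove_right_injective (this ▸ h)

theorem castSucc_ne_succ (r : Fin n) : r.castSucc ≠ r.succ :=
  (Fin.castSucc_lt_succ (i := r)).ne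

/-- Stabilization at the `X` of column `c`, in row `r = X c`: column `c` and row `r` are split in two,
and the marked square becomes a `2 × 2` block with an `X` in its south-west and its north-east square,
an `O` in its south-east square, and an empty north-west square. The `O` that shared the row of the
old `X` goes to the upper new row, and the `O` that shared its column to the left new column. -/
def stabilizeSE (G : Grid n) (c : Fin n) : Grid (n + 1) where
  X := insertPoint G.X c.succ (G.X c).succ
  O := insertPoint G.O c.succ (G.X c).castSucc
  disjoint x h := by
    by_cases hx : x = c.succ
    · subst hx
      rw [insertPoint_self, insertPoint_self] at h
      exact castSucc_ne_succ _ h.symm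
    · obtain ⟨d, rfl⟩ := Fin.exists_succAbove_eq hx
      rw [insertPoint_succAbove, insertPoint_succAbove] at h
      exact G.disjoint d (eq_of_succAbove_eq _ _ _ h)

/-- The same with the new `O` in the north-west square of the block, and an empty south-east square.
The `O` that shared the row of the old `X` goes to the lower new row, and the `O` that shared its
column to the right new column. -/
def stabilizeNW (G : Grid n) (c : Fin n) : Grid (n + 1) where
  X := insertPoint G.X c.castSucc (G.X c).castSucc
  O := insertPoint G.O c.castSucc (G.X c).succ
  disjoint x h := by
    by_cases hx : x = c.castSucc
    · subst hx
      rw [insertPoint_self, insertPoint_self] at h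
      exact castSucc_ne_succ _ h
    · obtain ⟨d, rfl⟩ := Fin.exists_succAbove_eq hx
      rw [insertPoint_succAbove, insertPoint_succAbove] at h
      exact G.disjoint d (eq_of_succAbove_eq _ _ _ h.symm).symm

end Grid

/-- The moves between grid diagrams that generate Legendrian isotopy: translations of the torus,
commutations of adjacent columns or rows, and the stabilizations `X:NW` and `X:SE` (the two for which
the two `X`'s of the new block lie in its south-west and its north-east square). -/
inductive LegendrianMove : (Σ n, Grid n) → (Σ n, Grid n) → Prop
  | shiftColumns {n : ℕ} (G : Grid n) : LegendrianMove ⟨n, G⟩ ⟨n, G.shiftColumns⟩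
  | shiftRows {n : ℕ} (G : Grid n) : LegendrianMove ⟨n, G⟩ ⟨n, G.shiftRows⟩
  | swapColumns {n : ℕ} (G : Grid n) (a b : Fin n) (hab : (a : ℕ) + 1 = b)
      (h : Grid.Unlinked (G.X a) (G.O a) (G.X b) (G.O b)) :
      LegendrianMove ⟨n, G⟩ ⟨n, G.swapColumns a b⟩
  | swapRows {n : ℕ} (G : Grid n) (a b : Fin n) (hab : (a : ℕ) + 1 = b)
      (h : Grid.Unlinked (G.X⁻¹ a) (G.O⁻¹ a) (G.X⁻¹ b) (G.O⁻¹ b)) :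
      LegendrianMove ⟨n, G⟩ ⟨n, G.swapRows a b⟩
  | stabilizeSE {n : ℕ} (G : Grid n) (c : Fin n) :
      LegendrianMove ⟨n, G⟩ ⟨n + 1, G.stabilizeSE c⟩
  | stabilizeNW {n : ℕ} (G : Grid n) (c : Fin n) :
      LegendrianMove ⟨n, G⟩ ⟨n + 1, G.stabilizeNW c⟩

/-- Legendrian link types in the standard contact `ℝ³`: grid diagrams up to the equivalence relation
generated by the Legendrian moves. The Legendrian link of a grid diagram has the mirror image of its
planar diagram as a front (turned by `45` degrees). -/
def LegendrianLink : Type :=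
  Quot LegendrianMove

/-- The Legendrian link type that a grid diagram represents. -/
def Grid.toLegendrian {n : ℕ} (G : Grid n) : LegendrianLink :=
  Quot.mk LegendrianMove ⟨n, G⟩

/-- A Legendrian link type is a knot if a grid diagram for it represents a knot. -/
def LegendrianLink.IsKnot (K : LegendrianLink) : Prop :=
  ∃ (n : ℕ) (G : Grid n), G.toLegendrian = K ∧ G.IsKnot

namespace Grid

variable {n : ℕ}

/-! ### Cables -/

/-- The crossing sign of column `c` and row `r`, or `0` if the vertical segment of column `c` does not
cross the horizontal segment of row `r`. The crossing is negative if the two segments run up and to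
the right, or down and to the left. -/
def crossing (G : Grid n) (c r : Fin n) : ℤ :=
  if (min (G.X c) (G.O c) < r ∧ r < max (G.X c) (G.O c)) ∧
      (min (G.X⁻¹ r) (G.O⁻¹ r) < c ∧ c < max (G.X⁻¹ r) (G.O⁻¹ r)) then
    if G.X c < G.O c ↔ G.O⁻¹ r < G.X⁻¹ r then -1 else 1
  else 0

/-- The writhe of the planar diagram, with vertical segments over horizontal ones. -/
def writhe (G : Grid n) : ℤ :=
  ∑ c, ∑ r, G.crossing c r

/-- The `O` of column `c` is a north-east or a south-west corner of the planar diagram: its vertical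
segment goes down and its horizontal segment goes left, or up and right. -/
def IsCuspO (G : Grid n) (c : Fin n) : Prop :=
  G.X c < G.O c ↔ G.X⁻¹ (G.O c) < c

/-- The `X` of column `c` is a north-east or a south-west corner of the planar diagram. -/
def IsCuspX (G : Grid n) (c : Fin n) : Prop :=
  G.O c < G.X c ↔ G.O⁻¹ (G.X c) < c

instance (G : Grid n) (c : Fin n) : Decidable (G.IsCuspO c) :=
  inferInstanceAs (Decidable (_ ↔ _))

instance (G : Grid n) (c : Fin n) : Decidable (G.IsCuspX c) :=
  inferInstanceAs (Decidable (_ ↔ _))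

/-- Reversal of `Fin p` if `b` holds, and the identity otherwise. -/
def flip (p : ℕ) (b : Prop) [Decidable b] : Equiv.Perm (Fin p) :=
  if b then Fin.revPerm else 1

/-- The `p × p` block, as a map from its columns to its rows, that replaces the `O` of column `c`.
Number the `p` parallel strands from right to left, as seen along the knot. The strands come in on
vertical lines and leave on horizontal ones, and `flip` turns the numbering of columns or rows into
that of the strands where they disagree.

If `c ∉ B` the strands keep their order: this is the diagonal block from south-west to north-east
(type A) at a north-east or south-west corner, and the other diagonal (type C) at a north-west or
south-east corner.

If `c ∈ B` the strands are shifted cyclically by one place, so that one strand crosses all others: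
this is a diagonal of `p - 1` markings next to the main one and a last marking in a corner (type B at
a north-east or south-west corner, type D at the others). The direction of the shift is `s` for B,
where the `p - 1` crossings are positive, and `-s` for D, where they are negative. -/
def blockO (G : Grid n) (p : ℕ) (B : Finset (Fin n)) (s : ℤˣ) (c : Fin n) : Equiv.Perm (Fin p) :=
  flip p (G.X⁻¹ (G.O c) < c) *
    finRotate p ^ (if c ∈ B then (if G.IsCuspO c then (s : ℤ) else -(s : ℤ)) else 0) *
      flip p (G.X c < G.O c)

/-- The grid obtained from `G` by replacing every square by a `p × p` block: empty squares by empty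
blocks, an `X` by `p` `X`'s on the diagonal from south-west to north-east (type A), and an `O` by its
block `blockO`. Column `u` of block column `c` is column `p * c + u`, and likewise for rows. -/
def cable (G : Grid n) (p : ℕ) (B : Finset (Fin n)) (s : ℤˣ) : Grid (n * p) where
  X := finProdFinEquiv.permCongr (Equiv.prodShear G.X fun _ => Equiv.refl (Fin p))
  O := finProdFinEquiv.permCongr (Equiv.prodShear G.O fun c => G.blockO p B s c)
  disjoint x h := by
    have h' := congrArg (fun y => (finProdFinEquiv.symm y).1) h
    simp [Equiv.permCongr_apply] at h'
    exact G.disjoint _ h'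

/-- The cabling coefficient, with respect to the Seifert framing, of the Legendrian cable that
`G.cable p B s` represents. The planar diagram of `G.cable p B s` has coefficient `p` times the writhe
of `G`, plus `1` for each block of type B and minus `1` for each block of type D, minus `1` for each
`X` at a north-west or south-east corner (a half twist; such corners only occur for `p = 2`). The
Legendrian link is the mirror image, which changes the sign. -/
def cableCoeff (G : Grid n) (p : ℕ) (B : Finset (Fin n)) : ℤ :=
  -(p * G.writhe + ∑ c ∈ B, (if G.IsCuspO c then 1 else -1) -
    ∑ c, (if G.IsCuspX c then 0 else 1))

end Grid

/-- `K'` is one of the Legendrian cables `K_{p,q}` constructed from the grid diagrams of `K`. If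
`p ≠ 2` no `X` may be at a north-west or south-east corner, which is achieved by stabilizations of
the grid diagram that do not change the Legendrian link type. -/
def LegendrianLink.IsCable (K : LegendrianLink) (p : ℕ) (q : ℤ) (K' : LegendrianLink) : Prop :=
  ∃ (n : ℕ) (G : Grid n) (B : Finset (Fin n)) (s : ℤˣ),
    G.toLegendrian = K ∧ (p = 2 ∨ ∀ c, G.IsCuspX c) ∧ G.cableCoeff p B = q ∧
      (G.cable p B s).toLegendrian = K'

namespace Grid

variable {n : ℕ}

/-! ### Grid homology -/

/-- A grid state: the point of the state on the vertical circle `a` is on the horizontal circle `x a`,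
where circle `a` is the left (or lower) side of column (or row) `a`. -/
abbrev State (n : ℕ) : Type := Equiv.Perm (Fin n)

/-- The ring `𝔽₂[V₁, …, Vₙ]`; the variable `V_c` belongs to the `O` of column `c`. -/
abbrev Coeff (n : ℕ) : Type := MvPolynomial (Fin n) (ZMod 2)

/-- The chain module: free over `𝔽₂[V₁, …, Vₙ]` on the grid states. -/
abbrev Chain (n : ℕ) : Type := State n →₀ Coeff n

/-- `c` lies in the half-open interval that goes in the positive direction from `a` to `b` on the
circle `Fin n`. -/
def InArc (a b c : Fin n) : Prop :=
  c - a < b - a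

instance (a b c : Fin n) : Decidable (InArc a b c) :=
  inferInstanceAs (Decidable (_ < _))

/-- The square in column `c` and row `r` lies in the rectangle on the torus whose south-west corner is
the point of `x` on the vertical circle `a` and whose north-east corner is the point of `x` on the
vertical circle `b`. For `a ≠ b` these are the rectangles from `x` to `x * swap a b`. -/
def InRect (x : State n) (a b c r : Fin n) : Prop :=
  InArc a b c ∧ InArc (x a) (x b) r

instance (x : State n) (a b c r : Fin n) : Decidable (InRect x a b c r) :=
  inferInstanceAs (Decidable (_ ∧ _))

/-- The rectangle contains no point of `x` in its interior. -/
def IsEmptyRect (x : State n) (a b : Fin n) : Prop :=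
  ∀ c, c ≠ a → ¬ (InArc a b c ∧ InArc (x a) (x b) (x c))

instance (x : State n) (a b : Fin n) : Decidable (IsEmptyRect x a b) :=
  inferInstanceAs (Decidable (∀ _, _))

/-- The pairs `(a, b)` that give the empty rectangles out of `x` without `X` markings. -/
def rectangles (G : Grid n) (x : State n) : Finset (Fin n × Fin n) :=
  Finset.univ.filter fun ab =>
    ab.1 ≠ ab.2 ∧ IsEmptyRect x ab.1 ab.2 ∧ ∀ c, ¬ InRect x ab.1 ab.2 c (G.X c)

/-- The monomial `∏ V_c ^ O_c(r)` of a rectangle `r`. -/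
noncomputable def weight (G : Grid n) (x : State n) (a b : Fin n) : Coeff n :=
  ∏ c ∈ Finset.univ.filter (fun c => InRect x a b c (G.O c)), MvPolynomial.X c

/-- The differential of the unblocked grid complex `GC⁻`. -/
noncomputable def boundary (G : Grid n) : Chain n →ₗ[Coeff n] Chain n :=
  Finsupp.linearCombination (Coeff n) fun x =>
    ∑ ab ∈ G.rectangles x,
      Finsupp.single (x * Equiv.swap ab.1 ab.2) (G.weight x ab.1 ab.2)

/-- The homology `ker d / im d` of a differential `d`. -/
abbrev Homology {R M : Type} [CommRing R] [AddCommGroup M] [Module R M] (d : M →ₗ[R] M) : Type :=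
  LinearMap.ker d ⧸ (LinearMap.range d).submoduleOf (LinearMap.ker d)

/-- Grid homology `GH⁻`: cycles modulo boundaries. -/
abbrev GH (G : Grid n) : Type :=
  Homology G.boundary

/-- The state `x⁺` of the north-east corners of the squares marked `X`. -/
def statePlus (G : Grid n) : State n :=
  finRotate n * G.X * (finRotate n)⁻¹

/-- The state `x⁻` of the south-west corners of the squares marked `X`. -/
def stateMinus (G : Grid n) : State n :=
  G.X

theorem boundary_single_eq_zero (G : Grid n) (x : State n)
    (h : ∀ a b, a ≠ b → ∃ c, InRect x a b c (G.X c)) :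
    Finsupp.single x 1 ∈ LinearMap.ker G.boundary := by
  have h0 : G.rectangles x = ∅ := by
    refine Finset.filter_eq_empty_iff.2 ?_
    rintro ⟨a, b⟩ - ⟨hab, -, hX⟩
    obtain ⟨c, hc⟩ := h a b hab
    exact hX c hc
  simp [boundary, h0]

theorem inArc_left {a b : Fin n} (h : a ≠ b) : InArc a b a := by
  have hn : NeZero n := ⟨by rintro rfl; exact a.elim0⟩
  rw [InArc, sub_self]
  exact Fin.pos_iff_ne_zero.2 (sub_ne_zero.2 h.symm)

theorem inArc_right {a b : Fin n} (h : a ≠ finRotate n b) : InArc a (finRotate n b) b := by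
  obtain _ | n := n
  · exact a.elim0
  · have h1 : finRotate (n + 1) b - a = (b - a) + 1 := by
      rw [finRotate_apply]; abel
    have h2 : b - a ≠ Fin.last n := by
      intro h3
      rw [h3, Fin.last_add_one, sub_eq_zero] at h1
      exact h h1.symm
    rw [InArc, h1]
    exact Fin.lt_add_one_iff.2 (lt_of_le_of_ne (Fin.le_last _) h2)

theorem statePlus_mem_ker (G : Grid n) :
    Finsupp.single G.statePlus 1 ∈ LinearMap.ker G.boundary := by
  refine G.boundary_single_eq_zero _ fun a b hab => ⟨(finRotate n)⁻¹ b, ?_⟩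
  obtain ⟨b, rfl⟩ := (finRotate n).surjective b
  have h := G.statePlus.injective.ne hab
  have hb : G.statePlus (finRotate n b) = finRotate n (G.X b) := by
    show finRotate n (G.X ((finRotate n).symm (finRotate n b))) = _
    rw [Equiv.symm_apply_apply]
  have hr : (finRotate n)⁻¹ (finRotate n b) = b := (finRotate n).symm_apply_apply b
  rw [hb] at h
  rw [InRect, hr, hb]
  exact ⟨inArc_right hab, inArc_right h⟩

theorem stateMinus_mem_ker (G : Grid n) :
    Finsupp.single G.stateMinus 1 ∈ LinearMap.ker G.boundary :=
  G.boundary_single_eq_zero _ fun a _ hab =>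
    ⟨a, inArc_left hab, inArc_left (G.X.injective.ne hab)⟩

/-- The Legendrian grid invariant `λ⁺`. -/
noncomputable def lambdaPlus (G : Grid n) : G.GH :=
  Submodule.Quotient.mk ⟨Finsupp.single G.statePlus 1, G.statePlus_mem_ker⟩

/-- The Legendrian grid invariant `λ⁻`. -/
noncomputable def lambdaMinus (G : Grid n) : G.GH :=
  Submodule.Quotient.mk ⟨Finsupp.single G.stateMinus 1, G.stateMinus_mem_ker⟩

/-- The class `η = λ⁺ + λ⁻`. -/
noncomputable def eta (G : Grid n) : G.GH :=
  G.lambdaPlus + G.lambdaMinus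

end Grid

namespace Grid

variable {M : ℕ}

/-! ### Arcs -/

/-! Since the coefficients have characteristic two, both equations of the theorem say that the cycle
`x⁺ + x⁻` is a boundary; this is `Null` (`lambda_eq_iff`, `eta_eq_zero_iff`). Two facts suffice:
`Null` is invariant under Legendrian moves (`LegendrianMove.null_iff`), and a grid of cable form is
null exactly when the grid it was built from is (`IsCableGrid.null_iff`).

All complexes are variants of one. A set `T` of vertical lines is allowed to move, the points of the
states on the other lines are frozen, and each square carries a weight in a ring, which is `0` at an
`X`. Everything rests on `sum_freeRects_freeRects`: for any weight depending only on the total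
domain and the final state, ordered pairs of composable empty rectangles cancel in pairs, up to
annuli. Suitable weights turn this into commutation relations between operators.

The main tool is `exists_merge`. Let a point of the grid have squares of weight `0` to its
south-west and north-east. The states through it form a subcomplex, which is the complex with that
point frozen. From a chain bounding `w` in the large complex one obtains chains in the subcomplex
with `D d + σ₁ e + σ₂ f = w`, where `D g` and `D h` are combinations of `e` and `f` with the weights
of the four strips adjoining the point. If these strip weights can be balanced, some multiple of `w`
bounds in the subcomplex. A stabilization is one such merge without loss, after the new variable has
been set equal to a neighbouring one. Commutations of columns are treated by counting pentagons
(`diff_pentagonOp`), and rows by transposition.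

In a cable the `X`s of a block lie on a diagonal, so the points between consecutive ones can be
frozen one at a time. When all are frozen, the complex is that of `G`, with each variable replaced
by the product of the variables of its strands (`stageNull_iff`). From `G` to the cable one only
includes a subcomplex. For the converse, choose one base block in each component and give its
strands a common variable `U`. While the rest of the component is unmerged, all its variables act as
`U` on homology, and each merge in the base block costs one factor `U` (`stageNull_base`). The other
blocks are then merged backwards along the link. Once the next block is complete, only the product
of the merged variables matters, so over a quadratic extension this product can be factored with
prescribed sum of the factors; this balances the strips. A coordinate functional of the extension
removes the resulting multiple, so these merges cost nothing (`stageNull_step`). At the end a power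
`U ^ (p - 1)` has been lost in each base block while its variable has become `U ^ p`, and extracting
a coefficient recovers `G` (`exists_semilinear`). -/

/-- Unfolding subtraction modulo `M` into order relations brings statements about arcs within reach
of `omega`. The arc from a point to itself is empty, not the whole circle. -/
theorem inArc_iff {a b c : Fin M} :
    InArc a b c ↔ (a ≤ c ∧ c < b) ∨ (b < a ∧ (a ≤ c ∨ c < b)) := by
  have key : ∀ y : Fin M, (y - a).val = if a ≤ y then y.val - a.val else M + y.val - a.val := by
    intro y
    have ha := a.2
    have hy := y.2
    rw [Fin.sub_def]
    simp only [Fin.le_def]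
    split_ifs with h
    · rw [show M - a.val + y.val = (y.val - a.val) + M by omega, Nat.add_mod_right,
        Nat.mod_eq_of_lt (by omega)]
    · rw [Nat.mod_eq_of_lt (by omega)]
      omega
  have ha := a.2
  have hb := b.2
  have hc := c.2
  rw [InArc, Fin.lt_def, key, key]
  simp only [Fin.le_def, Fin.lt_def]
  split_ifs <;> omega

theorem not_inArc_right (a b : Fin M) : ¬ InArc a b b := by
  rw [inArc_iff]; omega

theorem not_inArc_self (a c : Fin M) : ¬ InArc a a c := by
  rw [inArc_iff]; omega

/-- The indicator function of an arc. -/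
def arcInd (a b c : Fin M) : ℕ := if InArc a b c then 1 else 0

theorem arcInd_add {a b c : Fin M} (h : InArc a c b) (k : Fin M) :
    arcInd a c k = arcInd a b k + arcInd b c k := by
  simp only [arcInd, inArc_iff] at h ⊢
  split_ifs <;> omega

theorem inArc_rotate {a b c : Fin M} (h : InArc a c b) (hab : a ≠ b) : InArc b a c := by
  rw [inArc_iff] at h ⊢; omega

theorem inArc_of_not {a b c : Fin M} (h : ¬ InArc a c b) (hac : a ≠ c) (hbc : b ≠ c) :
    InArc c a b := by
  rw [inArc_iff] at h ⊢; omega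

/-- The multiplicity function of the rectangle whose columns form the arc from `a` to `b` and
whose rows form the arc from `i` to `k`. -/
def box (a b i k : Fin M) : Fin M → Fin M → ℕ := fun c r => arcInd a b c * arcInd i k r

theorem box_eq_zero {a b i k c r : Fin M} : box a b i k c r = 0 ↔ ¬ (InArc a b c ∧ InArc i k r) :=
    by
  simp only [box, arcInd]
  split_ifs <;> simp_all

/-- The empty rectangles out of `x` with corners on the vertical lines of `T`, where only the points
of `x` on these lines count. -/
def freeRects (T : Finset (Fin M)) (x : State M) : Finset (Fin M × Fin M) :=
  Finset.univ.filter fun ab => ab.1 ∈ T ∧ ab.2 ∈ T ∧ ab.1 ≠ ab.2 ∧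
    ∀ c ∈ T, c ≠ ab.1 → box ab.1 ab.2 (x ab.1) (x ab.2) c (x c) = 0

theorem mem_freeRects {T : Finset (Fin M)} {x : State M} {a b : Fin M} :
    (a, b) ∈ freeRects T x ↔ a ∈ T ∧ b ∈ T ∧ a ≠ b ∧
      ∀ c ∈ T, c ≠ a → box a b (x a) (x b) c (x c) = 0 := by
  simp [freeRects]

/-! ### Pairs of rectangles -/

section Pairs

variable {V : Type*} [AddCommGroup V] (T : Finset (Fin M)) (x : State M)
  (Θ : (Fin M → Fin M → ℕ) → State M → V)

/-- The contribution of a rectangle out of `x` followed by a second one. -/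
def pairTerm (a b a' b' : Fin M) : V :=
  if (a, b) ∈ freeRects T x ∧ (a', b') ∈ freeRects T (x * Equiv.swap a b) then
    Θ (box a b (x a) (x b) +
      box a' b' ((x * Equiv.swap a b) a') ((x * Equiv.swap a b) b'))
      (x * Equiv.swap a b * Equiv.swap a' b')
  else 0

variable {T x Θ}

theorem pairTerm_of_eq_left {a a' b' : Fin M} : pairTerm T x Θ a a a' b' = 0 := by
  simp [pairTerm, mem_freeRects]

theorem pairTerm_of_eq_right {a b a' : Fin M} : pairTerm T x Θ a b a' a' = 0 := by
  simp [pairTerm, mem_freeRects]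

/-- A pair of rectangles on three lines moves points on these lines only, so the condition at the
third line is kept apart from the conditions at the bystanders. -/
theorem mem_freeRects_third {a b e : Fin M} (ha : a ∈ T) (hb : b ∈ T) (he : e ∈ T) (hab : a ≠ b)
    (hae : a ≠ e) : (a, b) ∈ freeRects T x ↔ ¬ (InArc a b e ∧ InArc (x a) (x b) (x e)) ∧
      ∀ d ∈ T, d ≠ a → d ≠ b → d ≠ e → box a b (x a) (x b) d (x d) = 0 := by
  rw [mem_freeRects, ← box_eq_zero]
  constructor
  · rintro ⟨-, -, -, h⟩
    exact ⟨h e he hae.symm, fun d hd h1 _ _ => h d hd h1⟩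
  · rintro ⟨h1, h2⟩
    refine ⟨ha, hb, hab, fun d hd hda => ?_⟩
    by_cases hdb : d = b
    · subst hdb
      simp [box, arcInd, not_inArc_right]
    · by_cases hde : d = e
      · subst hde; exact h1
      · exact h2 d hd hda hdb hde

/-- Multiplicities are nonnegative, so both rectangles avoid a bystander exactly when their sum
vanishes there. Hence bystanders see only the total domain, and two decompositions of one domain can
be compared by their corners alone. -/
theorem pairTerm_third {a b e a' b' e' : Fin M} (ha : a ∈ T) (hb : b ∈ T) (he : e ∈ T)
    (hab : a ≠ b) (hae : a ≠ e) (ha' : a' ∈ T) (hb' : b' ∈ T) (he' : e' ∈ T)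
    (hab' : a' ≠ b') (hae' : a' ≠ e')
    (hset : ∀ d, (d ≠ a ∧ d ≠ b ∧ d ≠ e) ↔ (d ≠ a' ∧ d ≠ b' ∧ d ≠ e')) :
    pairTerm T x Θ a b a' b' =
      if ¬ (InArc a b e ∧ InArc (x a) (x b) (x e)) ∧
          ¬ (InArc a' b' e' ∧ InArc ((x * Equiv.swap a b) a') ((x * Equiv.swap a b) b')
            ((x * Equiv.swap a b) e')) ∧
          ∀ d ∈ T, d ≠ a → d ≠ b → d ≠ e → (box a b (x a) (x b) +
            box a' b' ((x * Equiv.swap a b) a') ((x * Equiv.swap a b) b')) d (x d) = 0 then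
        Θ (box a b (x a) (x b) +
          box a' b' ((x * Equiv.swap a b) a') ((x * Equiv.swap a b) b'))
          (x * Equiv.swap a b * Equiv.swap a' b')
      else 0 := by
  unfold pairTerm
  refine if_congr ?_ rfl rfl
  rw [mem_freeRects_third ha hb he hab hae, mem_freeRects_third ha' hb' he' hab' hae']
  have hd' : ∀ d, d ≠ a → d ≠ b → (x * Equiv.swap a b) d = x d := fun d h1 h2 => by
    rw [Equiv.Perm.mul_apply, Equiv.swap_apply_of_ne_of_ne h1 h2]
  constructor
  · rintro ⟨⟨h1, h2⟩, h3, h4⟩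
    refine ⟨h1, h3, fun d hd k1 k2 k3 => ?_⟩
    obtain ⟨l1, l2, l3⟩ := (hset d).1 ⟨k1, k2, k3⟩
    have := h4 d hd l1 l2 l3
    rw [hd' d k1 k2] at this
    simp only [Pi.add_apply]
    rw [h2 d hd k1 k2 k3, this]
  · rintro ⟨h1, h3, h⟩
    refine ⟨⟨h1, fun d hd k1 k2 k3 => ?_⟩, h3, fun d hd k1 k2 k3 => ?_⟩
    · have := h d hd k1 k2 k3
      simp only [Pi.add_apply] at this
      omega
    · obtain ⟨l1, l2, l3⟩ := (hset d).2 ⟨k1, k2, k3⟩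
      have := h d hd l1 l2 l3
      rw [hd' d l1 l2]
      simp only [Pi.add_apply] at this
      omega

end Pairs

end Grid

namespace Grid

variable {M : ℕ}

/-- Arcs with four distinct ends interleave symmetrically: if one separates the ends of the other,
the converse holds, and the end that lies inside is determined. -/
theorem arc_four {a b c d : Fin M} (hac : a ≠ c) (had : a ≠ d)
    (hbc : b ≠ c) (hbd : b ≠ d) :
    ((InArc a b c ∧ ¬ InArc a b d) ↔ (¬ InArc c d a ∧ InArc c d b)) ∧
      ((¬ InArc a b c ∧ InArc a b d) ↔ (InArc c d a ∧ ¬ InArc c d b)) := by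
  simp only [inArc_iff]
  constructor <;> omega

section Pairs

variable {V : Type*} [AddCommGroup V] {T : Finset (Fin M)} {x : State M}
  {Θ : (Fin M → Fin M → ℕ) → State M → V}

/-- Bystanders meet the same two rectangles in either order. Only the corners of one rectangle could
obstruct the other, and `arc_four`, applied to columns and to rows, shows that they do not obstruct
the reversed order either. -/
theorem freeRects_pair_comm {a b a' b' : Fin M} (haa : a ≠ a') (hab : a ≠ b') (hba : b ≠ a')
    (hbb : b ≠ b')
    (h : (a, b) ∈ freeRects T x ∧ (a', b') ∈ freeRects T (x * Equiv.swap a b)) :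
    (a', b') ∈ freeRects T x ∧ (a, b) ∈ freeRects T (x * Equiv.swap a' b') := by
  simp only [mem_freeRects, box_eq_zero] at h ⊢
  obtain ⟨⟨ha, hb, hne, h1⟩, ha', hb', hne', h2⟩ := h
  have e1 : (x * Equiv.swap a b) a' = x a' := by
    rw [Equiv.Perm.mul_apply, Equiv.swap_apply_of_ne_of_ne haa.symm hba.symm]
  have e2 : (x * Equiv.swap a b) b' = x b' := by
    rw [Equiv.Perm.mul_apply, Equiv.swap_apply_of_ne_of_ne hab.symm hbb.symm]
  have e3 : (x * Equiv.swap a' b') a = x a := by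
    rw [Equiv.Perm.mul_apply, Equiv.swap_apply_of_ne_of_ne haa hab]
  have e4 : (x * Equiv.swap a' b') b = x b := by
    rw [Equiv.Perm.mul_apply, Equiv.swap_apply_of_ne_of_ne hba hbb]
  have f1 : (x * Equiv.swap a b) a = x b := by simp
  have f2 : (x * Equiv.swap a b) b = x a := by simp
  have f3 : (x * Equiv.swap a' b') a' = x b' := by simp
  have f4 : (x * Equiv.swap a' b') b' = x a' := by simp
  have k1 := h1 a' ha' haa.symm
  have k2 := h1 b' hb' hab.symm
  have k3 := h2 a ha haa
  have k4 := h2 b hb hba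
  rw [e1, e2] at h2 k3 k4
  rw [f1] at k3
  rw [f2] at k4
  rw [e3, e4]
  have c1 := arc_four haa hab hba hbb
  have c2 := arc_four (x.injective.ne haa) (x.injective.ne hab) (x.injective.ne hba)
    (x.injective.ne hbb)
  have key : ¬ (InArc a' b' a ∧ InArc (x a') (x b') (x a)) ∧
      ¬ (InArc a' b' b ∧ InArc (x a') (x b') (x b)) ∧
      ¬ (InArc a b a' ∧ InArc (x a) (x b) (x b')) ∧
      ¬ (InArc a b b' ∧ InArc (x a) (x b) (x a')) := by
    -- What remains is propositional in eight incidences of corners with arcs.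
    revert c1 c2 k1 k2 k3 k4
    generalize InArc a' b' a = p1
    generalize InArc a' b' b = p2
    generalize InArc a b a' = p3
    generalize InArc a b b' = p4
    generalize InArc (x a') (x b') (x a) = q1
    generalize InArc (x a') (x b') (x b) = q2
    generalize InArc (x a) (x b) (x a') = q3
    generalize InArc (x a) (x b) (x b') = q4
    clear * -
    by_cases p1 <;> by_cases p2 <;> by_cases p3 <;> by_cases p4 <;> simp_all
  refine ⟨⟨ha', hb', hne', fun d hd hda => ?_⟩, ha, hb, hne, fun d hd hda => ?_⟩
  · by_cases d1 : d = a
    · subst d1; exact key.1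
    by_cases d2 : d = b
    · subst d2; exact key.2.1
    have := h2 d hd hda
    rwa [Equiv.Perm.mul_apply, Equiv.swap_apply_of_ne_of_ne d1 d2] at this
  · by_cases d1 : d = a'
    · subst d1; rw [f3]; exact key.2.2.1
    by_cases d2 : d = b'
    · subst d2; rw [f4]; exact key.2.2.2
    have := h1 d hd hda
    rwa [Equiv.Perm.mul_apply, Equiv.swap_apply_of_ne_of_ne d1 d2]

theorem pairTerm_comm {a b a' b' : Fin M} (haa : a ≠ a') (hab : a ≠ b') (hba : b ≠ a')
    (hbb : b ≠ b') : pairTerm T x Θ a b a' b' = pairTerm T x Θ a' b' a b := by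
  unfold pairTerm
  have e1 : (x * Equiv.swap a b) a' = x a' := by
    rw [Equiv.Perm.mul_apply, Equiv.swap_apply_of_ne_of_ne haa.symm hba.symm]
  have e2 : (x * Equiv.swap a b) b' = x b' := by
    rw [Equiv.Perm.mul_apply, Equiv.swap_apply_of_ne_of_ne hab.symm hbb.symm]
  have e3 : (x * Equiv.swap a' b') a = x a := by
    rw [Equiv.Perm.mul_apply, Equiv.swap_apply_of_ne_of_ne haa hab]
  have e4 : (x * Equiv.swap a' b') b = x b := by
    rw [Equiv.Perm.mul_apply, Equiv.swap_apply_of_ne_of_ne hba hbb]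
  rw [e1, e2, e3, e4, add_comm (box a b _ _)]
  have hs : x * Equiv.swap a b * Equiv.swap a' b' = x * Equiv.swap a' b' * Equiv.swap a b := by
    ext d
    simp only [Equiv.Perm.mul_apply, Equiv.swap_apply_def]
    split_ifs <;> simp_all
  rw [hs]
  exact if_congr ⟨freeRects_pair_comm haa hab hba hbb,
    freeRects_pair_comm haa.symm hba.symm hab.symm hbb.symm⟩ rfl rfl

theorem cyclic_arcs {u c v : Fin M} (h : InArc u v c) (huc : u ≠ c) :
    InArc v c u ∧ InArc c u v ∧ ¬ InArc u c v ∧ ¬ InArc c v u ∧ ¬ InArc v u c := by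
  simp only [inArc_iff] at h ⊢; omega

theorem swap_third {u c v : Fin M} (h1 : u ≠ v) (h2 : c ≠ v) (x : State M) :
    (x * Equiv.swap u c) v = x v := by
  rw [Equiv.Perm.mul_apply, Equiv.swap_apply_of_ne_of_ne h1.symm h2.symm]

/-- Two pairs of rectangles with three corners `u`, `c`, `v` contribute equally. -/
theorem pairTerm_eq_of_domain {a b e a' b' e' a₁ b₁ e₁ a₁' b₁' e₁' : Fin M}
    (ha : a ∈ T) (hb : b ∈ T) (he : e ∈ T) (hab : a ≠ b) (hae : a ≠ e) (ha' : a' ∈ T)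
    (hb' : b' ∈ T) (he' : e' ∈ T) (hab' : a' ≠ b') (hae' : a' ≠ e')
    (hset : ∀ d, (d ≠ a ∧ d ≠ b ∧ d ≠ e) ↔ (d ≠ a' ∧ d ≠ b' ∧ d ≠ e'))
    (ha₁ : a₁ ∈ T) (hb₁ : b₁ ∈ T) (he₁ : e₁ ∈ T) (hab₁ : a₁ ≠ b₁) (hae₁ : a₁ ≠ e₁)
    (ha₁' : a₁' ∈ T) (hb₁' : b₁' ∈ T) (he₁' : e₁' ∈ T) (hab₁' : a₁' ≠ b₁') (hae₁' : a₁' ≠ e₁')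
    (hset₁ : ∀ d, (d ≠ a₁ ∧ d ≠ b₁ ∧ d ≠ e₁) ↔ (d ≠ a₁' ∧ d ≠ b₁' ∧ d ≠ e₁'))
    (hset' : ∀ d, (d ≠ a ∧ d ≠ b ∧ d ≠ e) ↔ (d ≠ a₁ ∧ d ≠ b₁ ∧ d ≠ e₁))
    (hd : box a b (x a) (x b) +
      box a' b' ((x * Equiv.swap a b) a') ((x * Equiv.swap a b) b') =
      box a₁ b₁ (x a₁) (x b₁) +
      box a₁' b₁' ((x * Equiv.swap a₁ b₁) a₁') ((x * Equiv.swap a₁ b₁) b₁'))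
    (hs : Equiv.swap a b * Equiv.swap a' b' = Equiv.swap a₁ b₁ * Equiv.swap a₁' b₁')
    (hc : ¬ (InArc a b e ∧ InArc (x a) (x b) (x e)) ∧
          ¬ (InArc a' b' e' ∧ InArc ((x * Equiv.swap a b) a') ((x * Equiv.swap a b) b')
            ((x * Equiv.swap a b) e')) ↔
        ¬ (InArc a₁ b₁ e₁ ∧ InArc (x a₁) (x b₁) (x e₁)) ∧
          ¬ (InArc a₁' b₁' e₁' ∧ InArc ((x * Equiv.swap a₁ b₁) a₁')
            ((x * Equiv.swap a₁ b₁) b₁') ((x * Equiv.swap a₁ b₁) e₁'))) :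
    pairTerm T x Θ a b a' b' = pairTerm T x Θ a₁ b₁ a₁' b₁' := by
  rw [pairTerm_third ha hb he hab hae ha' hb' he' hab' hae' hset,
    pairTerm_third ha₁ hb₁ he₁ hab₁ hae₁ ha₁' hb₁' he₁' hab₁' hae₁' hset₁, hd,
    mul_assoc x, mul_assoc x, hs]
  refine if_congr ?_ rfl rfl
  rw [← and_assoc, ← and_assoc, hc]
  refine and_congr Iff.rfl (forall_congr' fun d => forall_congr' fun _ => ?_)
  constructor
  · intro h h1 h2 h3
    obtain ⟨k1, k2, k3⟩ := (hset' d).2 ⟨h1, h2, h3⟩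
    exact h k1 k2 k3
  · intro h h1 h2 h3
    obtain ⟨k1, k2, k3⟩ := (hset' d).1 ⟨h1, h2, h3⟩
    exact h k1 k2 k3

/-- The domain of two rectangles with one common line has a reentrant corner, and cutting it along
the other edge there gives the second pair. The cyclic orders of the three lines and of the three
rows decide which pair that is; the two vanishing pairs are blocked by the point on the third line.
The next three lemmas are the other combinations of orders. -/
theorem pairTerm_cyclic_cyclic {u c v : Fin M} (hu : u ∈ T) (hc : c ∈ T) (hv : v ∈ T) (huc : u ≠ c)
    (huv : u ≠ v) (hcv : c ≠ v) (h1 : InArc u v c) (h2 : InArc (x u) (x v) (x c)) :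
    pairTerm T x Θ u c c v = pairTerm T x Θ c v u v ∧ pairTerm T x Θ c u c v = 0 ∧
      pairTerm T x Θ c u v c = 0 := by
  obtain ⟨a1, a2, a3, a4, a5⟩ := cyclic_arcs h1 huc
  obtain ⟨b1, b2, b3, b4, b5⟩ := cyclic_arcs h2 (x.injective.ne huc)
  refine ⟨?_, ?_, ?_⟩
  · refine pairTerm_eq_of_domain hu hc hv huc huv hc hv hu hcv huc.symm (by tauto)
      hc hv hu hcv huc.symm hu hv hc huv huc (by tauto) (by tauto) ?_ ?_ ?_
    · rw [swap_third huv hcv, swap_third huc.symm huv.symm]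
      simp only [Equiv.Perm.mul_apply, Equiv.swap_apply_left, Equiv.swap_apply_right]
      funext d r
      simp only [Pi.add_apply, box, arcInd_add h1, arcInd_add h2]
      ring
    · ext d
      simp only [Equiv.Perm.mul_apply, Equiv.swap_apply_def]
      split_ifs <;> simp_all
    · rw [swap_third huv hcv, swap_third huc.symm huv.symm]
      simp [*]
  · rw [pairTerm_third hc hu hv huc.symm hcv hc hv hu hcv huc.symm (by tauto),
      swap_third hcv huv]
    simp [*]
  · rw [pairTerm_third hc hu hv huc.symm hcv hv hc hu hcv.symm huv.symm (by tauto),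
      swap_third hcv huv]
    simp [*]

theorem pairTerm_anti_anti {u c v : Fin M} (hu : u ∈ T) (hc : c ∈ T) (hv : v ∈ T) (huc : u ≠ c)
    (huv : u ≠ v) (hcv : c ≠ v) (h1 : InArc u c v) (h2 : InArc (x u) (x c) (x v)) :
    pairTerm T x Θ c u c v = pairTerm T x Θ u v c u ∧ pairTerm T x Θ u c c v = 0 ∧
      pairTerm T x Θ u c v c = 0 := by
  obtain ⟨a1, a2, a3, a4, a5⟩ := cyclic_arcs h1 huv
  obtain ⟨b1, b2, b3, b4, b5⟩ := cyclic_arcs h2 (x.injective.ne huv)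
  refine ⟨?_, ?_, ?_⟩
  · refine pairTerm_eq_of_domain hc hu hv huc.symm hcv hc hv hu hcv huc.symm (by tauto)
      hu hv hc huv huc hc hu hv huc.symm hcv (by tauto) (by tauto) ?_ ?_ ?_
    · rw [swap_third hcv huv, swap_third huc hcv.symm]
      simp only [Equiv.Perm.mul_apply, Equiv.swap_apply_left, Equiv.swap_apply_right]
      funext d r
      simp only [Pi.add_apply, box, arcInd_add a1, arcInd_add b1]
      ring
    · ext d
      simp only [Equiv.Perm.mul_apply, Equiv.swap_apply_def]
      split_ifs <;> simp_all
    · rw [swap_third hcv huv, swap_third huc hcv.symm]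
      simp [*]
  · rw [pairTerm_third hu hc hv huc huv hc hv hu hcv huc.symm (by tauto),
      swap_third huv hcv]
    simp [*]
  · rw [pairTerm_third hu hc hv huc huv hv hc hu hcv.symm huv.symm (by tauto),
      swap_third huv hcv]
    simp [*]

theorem pairTerm_cyclic_anti {u c v : Fin M} (hu : u ∈ T) (hc : c ∈ T) (hv : v ∈ T) (huc : u ≠ c)
    (huv : u ≠ v) (hcv : c ≠ v) (h1 : InArc u v c) (h2 : InArc (x u) (x c) (x v)) :
    pairTerm T x Θ u c c v = pairTerm T x Θ u v u c ∧ pairTerm T x Θ u c v c = 0 ∧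
      pairTerm T x Θ c u v c = 0 := by
  obtain ⟨a1, a2, a3, a4, a5⟩ := cyclic_arcs h1 huc
  obtain ⟨b1, b2, b3, b4, b5⟩ := cyclic_arcs h2 (x.injective.ne huv)
  refine ⟨?_, ?_, ?_⟩
  · refine pairTerm_eq_of_domain hu hc hv huc huv hc hv hu hcv huc.symm (by tauto)
      hu hv hc huv huc hu hc hv huc huv (by tauto) (by tauto) ?_ ?_ ?_
    · rw [swap_third huv hcv, swap_third huc hcv.symm]
      simp only [Equiv.Perm.mul_apply, Equiv.swap_apply_left, Equiv.swap_apply_right]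
      funext d r
      simp only [Pi.add_apply, box, arcInd_add h1, arcInd_add h2]
      ring
    · ext d
      simp only [Equiv.Perm.mul_apply, Equiv.swap_apply_def]
      split_ifs <;> simp_all
    · rw [swap_third huv hcv, swap_third huc hcv.symm]
      simp [*]
  · rw [pairTerm_third hu hc hv huc huv hv hc hu hcv.symm huv.symm (by tauto),
      swap_third huv hcv]
    simp [*]
  · rw [pairTerm_third hc hu hv huc.symm hcv hv hc hu hcv.symm huv.symm (by tauto),
      swap_third hcv huv]
    simp [*]

theorem pairTerm_anti_cyclic {u c v : Fin M} (hu : u ∈ T) (hc : c ∈ T) (hv : v ∈ T) (huc : u ≠ c)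
    (huv : u ≠ v) (hcv : c ≠ v) (h1 : InArc u c v) (h2 : InArc (x u) (x v) (x c)) :
    pairTerm T x Θ u c v c = pairTerm T x Θ v c u v ∧ pairTerm T x Θ u c c v = 0 ∧
      pairTerm T x Θ c u c v = 0 := by
  obtain ⟨a1, a2, a3, a4, a5⟩ := cyclic_arcs h1 huv
  obtain ⟨b1, b2, b3, b4, b5⟩ := cyclic_arcs h2 (x.injective.ne huc)
  refine ⟨?_, ?_, ?_⟩
  · refine pairTerm_eq_of_domain hu hc hv huc huv hv hc hu hcv.symm huv.symm (by tauto)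
      hv hc hu hcv.symm huv.symm hu hv hc huv huc (by tauto) (by tauto) ?_ ?_ ?_
    · rw [swap_third huv hcv, swap_third huv.symm huc.symm]
      simp only [Equiv.Perm.mul_apply, Equiv.swap_apply_left, Equiv.swap_apply_right]
      funext d r
      simp only [Pi.add_apply, box, arcInd_add h1, arcInd_add b1]
      ring
    · ext d
      simp only [Equiv.Perm.mul_apply, Equiv.swap_apply_def]
      split_ifs <;> simp_all
    · rw [swap_third huv hcv, swap_third huv.symm huc.symm]
      simp [*]
  · rw [pairTerm_third hu hc hv huc huv hc hv hu hcv huc.symm (by tauto),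
      swap_third huv hcv]
    simp [*]
  · rw [pairTerm_third hc hu hv huc.symm hcv hc hv hu hcv huc.symm (by tauto),
      swap_third hcv huv]
    simp [*]

end Pairs

end Grid

namespace Grid

variable {M : ℕ}

section Pairs

variable {V : Type*} [AddCommGroup V] {T : Finset (Fin M)} {x : State M}
  {Θ : (Fin M → Fin M → ℕ) → State M → V}

theorem pairTerm_eq_zero_of_notMem {a b a' b' : Fin M}
    (h : a ∉ T ∨ b ∉ T ∨ a' ∉ T ∨ b' ∉ T) : pairTerm T x Θ a b a' b' = 0 := by
  rw [pairTerm, if_neg]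
  rw [mem_freeRects, mem_freeRects]
  tauto

/-- All pairs of rectangles whose three corners are `u`, `c`, `v` with the common corner `c`. -/
def pairTermThree (T : Finset (Fin M)) (x : State M) (Θ : (Fin M → Fin M → ℕ) → State M → V)
    (u c v : Fin M) : V :=
  pairTerm T x Θ u c c v + pairTerm T x Θ u c v c + pairTerm T x Θ c u c v + pairTerm T x Θ c u v c

/-- In each of the four combinations of cyclic orders, a surviving pair with one common line equals
a surviving pair with another of the three as common line. Rotating the roles of the lines therefore
matches all terms in twos. -/
theorem pairTermThree_cyclic (hV : ∀ v : V, v + v = 0) {u c v : Fin M} (huc : u ≠ c)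
    (huv : u ≠ v) (hcv : c ≠ v) :
    pairTermThree T x Θ u c v + pairTermThree T x Θ c v u + pairTermThree T x Θ v u c = 0 := by
  have hneg : ∀ v : V, -v = v := fun v => neg_eq_of_add_eq_zero_left (hV v)
  by_cases hu : u ∈ T; swap
  · simp [pairTermThree, pairTerm_eq_zero_of_notMem, hu]
  by_cases hc : c ∈ T; swap
  · simp [pairTermThree, pairTerm_eq_zero_of_notMem, hc]
  by_cases hv : v ∈ T; swap
  · simp [pairTermThree, pairTerm_eq_zero_of_notMem, hv]
  have xuc := x.injective.ne huc
  have xuv := x.injective.ne huv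
  have xcv := x.injective.ne hcv
  have four : ∀ {A B C : V}, A + B + C + (B + C + A) = 0 := by
    intro A B C
    rw [show A + B + C + (B + C + A) = (A + B + C) + (A + B + C) by abel, hV]
  simp only [pairTermThree]
  by_cases h1 : InArc u v c <;> by_cases h2 : InArc (x u) (x v) (x c)
  · obtain ⟨a1, a2, -⟩ := cyclic_arcs h1 huc
    obtain ⟨b1, b2, -⟩ := cyclic_arcs h2 xuc
    obtain ⟨e1, e2, e3⟩ := pairTerm_cyclic_cyclic (Θ := Θ) hu hc hv huc huv hcv h1 h2
    obtain ⟨f1, f2, f3⟩ := pairTerm_cyclic_cyclic (Θ := Θ) hc hv hu hcv huc.symm huv.symm a2 b2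
    obtain ⟨g1, g2, g3⟩ := pairTerm_cyclic_cyclic (Θ := Θ) hv hu hc huv.symm hcv.symm huc a1 b1
    rw [e1, f1, g1, e2, e3, f2, f3, g2, g3]
    refine Eq.trans ?_ (four (A := pairTerm T x Θ c v u v) (B := pairTerm T x Θ v u c u)
      (C := pairTerm T x Θ u c v c))
    abel
  · have h2' := inArc_of_not h2 xuv xcv
    have h2 := inArc_rotate h2' xcv.symm
    have h2' := inArc_rotate h2 xuc.symm
    obtain ⟨a1, a2, -⟩ := cyclic_arcs h1 huc
    obtain ⟨b1, b2, -⟩ := cyclic_arcs h2' xuv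
    obtain ⟨e1, e2, e3⟩ := pairTerm_cyclic_anti (Θ := Θ) hu hc hv huc huv hcv h1 h2'
    obtain ⟨f1, f2, f3⟩ := pairTerm_cyclic_anti (Θ := Θ) hc hv hu hcv huc.symm huv.symm a2 b1
    obtain ⟨g1, g2, g3⟩ := pairTerm_cyclic_anti (Θ := Θ) hv hu hc huv.symm hcv.symm huc a1 b2
    rw [e1, f1, g1, e2, e3, f2, f3, g2, g3]
    refine Eq.trans ?_ (four (A := pairTerm T x Θ u v u c) (B := pairTerm T x Θ c u c v)
      (C := pairTerm T x Θ v c v u))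
    abel
  · have h1' := inArc_of_not h1 huv hcv
    have h1 := inArc_rotate h1' hcv.symm
    have h1' := inArc_rotate h1 huc.symm
    obtain ⟨a1, a2, -⟩ := cyclic_arcs h1' huv
    obtain ⟨b1, b2, -⟩ := cyclic_arcs h2 xuc
    obtain ⟨e1, e2, e3⟩ := pairTerm_anti_cyclic (Θ := Θ) hu hc hv huc huv hcv h1' h2
    obtain ⟨f1, f2, f3⟩ := pairTerm_anti_cyclic (Θ := Θ) hc hv hu hcv huc.symm huv.symm a1 b2
    obtain ⟨g1, g2, g3⟩ := pairTerm_anti_cyclic (Θ := Θ) hv hu hc huv.symm hcv.symm huc a2 b1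
    rw [e1, f1, g1, e2, e3, f2, f3, g2, g3]
    refine Eq.trans ?_ (four (A := pairTerm T x Θ v c u v) (B := pairTerm T x Θ u v c u)
      (C := pairTerm T x Θ c u v c))
    abel
  · have h1' := inArc_of_not h1 huv hcv
    have h1 := inArc_rotate h1' hcv.symm
    have h1' := inArc_rotate h1 huc.symm
    have h2' := inArc_of_not h2 xuv xcv
    have h2 := inArc_rotate h2' xcv.symm
    have h2' := inArc_rotate h2 xuc.symm
    obtain ⟨a1, a2, -⟩ := cyclic_arcs h1' huv
    obtain ⟨b1, b2, -⟩ := cyclic_arcs h2' xuv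
    obtain ⟨e1, e2, e3⟩ := pairTerm_anti_anti (Θ := Θ) hu hc hv huc huv hcv h1' h2'
    obtain ⟨f1, f2, f3⟩ := pairTerm_anti_anti (Θ := Θ) hc hv hu hcv huc.symm huv.symm a1 b1
    obtain ⟨g1, g2, g3⟩ := pairTerm_anti_anti (Θ := Θ) hv hu hc huv.symm hcv.symm huc a2 b2
    rw [e1, f1, g1, e2, e3, f2, f3, g2, g3]
    refine Eq.trans ?_ (four (A := pairTerm T x Θ u v c u) (B := pairTerm T x Θ c u v c)
      (C := pairTerm T x Θ v c u v))
    abel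

/-- Rotating the summation indices does not change the sum `S`, and `2S = 0`; so `S = 3S`, which is
a sum of rotated triples. -/
theorem sum_three_eq_zero {α : Type*} [Fintype α] [DecidableEq α] (hV : ∀ v : V, v + v = 0)
    (G : α → α → α → V)
    (hG : ∀ u c v, u ≠ c → u ≠ v → c ≠ v → G u c v + G c v u + G v u c = 0) :
    ∑ u, ∑ c, ∑ v, (if u ≠ c ∧ u ≠ v ∧ c ≠ v then G u c v else 0) = 0 := by
  set F : α → α → α → V := fun u c v => if u ≠ c ∧ u ≠ v ∧ c ≠ v then G u c v else 0 with hF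
  have r1 : ∑ u, ∑ c, ∑ v, F u c v = ∑ u, ∑ c, ∑ v, F c v u := by
    rw [Finset.sum_congr rfl fun u _ => Finset.sum_comm (f := fun c v => F c v u) (s := Finset.univ)
      (t := Finset.univ)]
    rw [Finset.sum_comm]
    refine Eq.trans ?_ (Finset.sum_congr rfl fun v _ => Finset.sum_comm)
    rw [Finset.sum_comm]
    refine Eq.trans (Finset.sum_congr rfl fun v _ => Finset.sum_comm) ?_
    rw [Finset.sum_comm]
  have r2 : ∑ u, ∑ c, ∑ v, F u c v = ∑ u, ∑ c, ∑ v, F v u c := by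
    rw [Finset.sum_comm]
    exact Finset.sum_congr rfl fun v _ => Finset.sum_comm
  have : ∑ u, ∑ c, ∑ v, F u c v =
      ∑ u, ∑ c, ∑ v, F u c v + ∑ u, ∑ c, ∑ v, F u c v + ∑ u, ∑ c, ∑ v, F u c v := by
    rw [hV, zero_add]
  rw [this]
  refine Eq.trans (congrArg₂ _ (congrArg₂ _ rfl r1) r2) ?_
  simp only [← Finset.sum_add_distrib]
  refine Finset.sum_eq_zero fun u _ => Finset.sum_eq_zero fun c _ =>
    Finset.sum_eq_zero fun v _ => ?_
  simp only [hF]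
  by_cases h : u ≠ c ∧ u ≠ v ∧ c ≠ v
  · rw [if_pos h, if_pos (by tauto), if_pos (by tauto)]
    exact hG u c v h.1 h.2.1 h.2.2
  · rw [if_neg h, if_neg (by tauto), if_neg (by tauto)]
    simp

theorem sum_symm_eq_zero {α : Type*} [Fintype α] [DecidableEq α] (hV : ∀ v : V, v + v = 0)
    (f : α → α → V) (hf : ∀ a b, f a b = f b a) (hd : ∀ a, f a a = 0) :
    ∑ a, ∑ b, f a b = 0 := by
  rw [← Finset.sum_product']
  refine Finset.sum_involution (fun q _ => (q.2, q.1)) ?_ ?_ ?_ ?_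
  · rintro ⟨a, b⟩ _
    simp only
    rw [hf a b, hV]
  · rintro ⟨a, b⟩ _ h h'
    simp only [Prod.mk.injEq] at h'
    rw [h'.2] at h
    exact h (hd b)
  · simp
  · simp

theorem sum_split_two {α : Type*} [Fintype α] [DecidableEq α] {a b : α} (hab : a ≠ b) (F : α → V) :
    ∑ v, F v = F a + F b + ∑ v, if a ≠ v ∧ b ≠ v then F v else 0 := by
  rw [← Finset.sum_filter]
  have : Finset.univ.filter (fun v => a ≠ v ∧ b ≠ v) = (Finset.univ.erase a).erase b := by
    ext v; simp [and_comm, eq_comm]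
  rw [this, add_assoc, Finset.add_sum_erase _ _ (by simp [hab.symm]),
    Finset.add_sum_erase _ _ (by simp)]

/-- The pairs of lines of `T` that are neighbours. -/
def colStrips (T : Finset (Fin M)) : Finset (Fin M × Fin M) :=
  Finset.univ.filter fun ab => ab.1 ∈ T ∧ ab.2 ∈ T ∧ ab.1 ≠ ab.2 ∧
    ∀ c ∈ T, c ≠ ab.1 → ¬ InArc ab.1 ab.2 c

/-- The pairs of lines of `T` on which the points of `x` are in neighbouring rows. -/
def rowStrips (T : Finset (Fin M)) (x : State M) : Finset (Fin M × Fin M) :=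
  Finset.univ.filter fun ab => ab.1 ∈ T ∧ ab.2 ∈ T ∧ ab.1 ≠ ab.2 ∧
    ∀ c ∈ T, c ≠ ab.1 → ¬ InArc (x ab.1) (x ab.2) (x c)

theorem arcInd_add_symm {a b : Fin M} (hab : a ≠ b) (c : Fin M) :
    arcInd a b c + arcInd b a c = 1 := by
  simp only [arcInd, inArc_iff]
  split_ifs <;> omega

/-- Using the same two lines twice fills both complementary arcs of rows. The domain is a vertical
annulus, the state returns, and emptiness of both halves says that no line of `T` lies strictly
between. -/
theorem pairTerm_col {a b : Fin M} : pairTerm T x Θ a b a b =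
    if (a, b) ∈ colStrips T then Θ (fun c _ => arcInd a b c) x else 0 := by
  by_cases hab : a = b
  · subst hab
    simp [pairTerm_of_eq_left, colStrips]
  have hx := x.injective.ne hab
  have h1 : (x * Equiv.swap a b) a = x b := by simp
  have h2 : (x * Equiv.swap a b) b = x a := by simp
  unfold pairTerm
  rw [h1, h2, mul_assoc, Equiv.swap_mul_self, mul_one]
  have hd : box a b (x a) (x b) + box a b (x b) (x a) = fun c _ => arcInd a b c := by
    funext c r
    simp only [box, Pi.add_apply]
    rw [← mul_add, arcInd_add_symm hx, mul_one]
  rw [hd]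
  refine if_congr ?_ rfl rfl
  simp only [mem_freeRects, box_eq_zero, colStrips, Finset.mem_filter, Finset.mem_univ, true_and,
    h1, h2]
  constructor
  · rintro ⟨⟨ha, hb, hn, h3⟩, -, -, -, h4⟩
    refine ⟨ha, hb, hn, fun c hc hca hi => ?_⟩
    have hcb : c ≠ b := by rintro rfl; exact not_inArc_right _ _ hi
    have h3 := h3 c hc hca
    have h4 := h4 c hc hca
    rw [Equiv.Perm.mul_apply, Equiv.swap_apply_of_ne_of_ne hca hcb] at h4
    have := arcInd_add_symm hx (x c)
    simp only [hi, true_and] at h3 h4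
    simp [arcInd, h3, h4] at this
  · rintro ⟨ha, hb, hn, h⟩
    exact ⟨⟨ha, hb, hn, fun c hc hca hi => h c hc hca hi.1⟩, ha, hb, hn,
      fun c hc hca hi => h c hc hca hi.1⟩

/-- Here the arcs of columns are complementary, and the domain is a horizontal annulus. -/
theorem pairTerm_row {a b : Fin M} : pairTerm T x Θ a b b a =
    if (a, b) ∈ rowStrips T x then Θ (fun _ r => arcInd (x a) (x b) r) x else 0 := by
  by_cases hab : a = b
  · subst hab
    simp [pairTerm_of_eq_left, rowStrips]
  have hx := x.injective.ne hab
  have h1 : (x * Equiv.swap a b) a = x b := by simp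
  have h2 : (x * Equiv.swap a b) b = x a := by simp
  unfold pairTerm
  rw [h1, h2, mul_assoc, Equiv.swap_comm b a, Equiv.swap_mul_self, mul_one]
  have hd : box a b (x a) (x b) + box b a (x a) (x b) = fun _ r => arcInd (x a) (x b) r := by
    funext c r
    simp only [box, Pi.add_apply]
    rw [← add_mul, arcInd_add_symm hab, one_mul]
  rw [hd]
  refine if_congr ?_ rfl rfl
  simp only [mem_freeRects, box_eq_zero, rowStrips, Finset.mem_filter, Finset.mem_univ, true_and,
    h1, h2]
  constructor
  · rintro ⟨⟨ha, hb, hn, h3⟩, -, -, -, h4⟩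
    refine ⟨ha, hb, hn, fun c hc hca hi => ?_⟩
    have hcb : c ≠ b := by rintro rfl; exact not_inArc_right _ _ hi
    have h3 := h3 c hc hca
    have h4 := h4 c hc hcb
    rw [Equiv.Perm.mul_apply, Equiv.swap_apply_of_ne_of_ne hca hcb] at h4
    have := arcInd_add_symm hab c
    simp only [hi, and_true] at h3 h4
    simp [arcInd, h3, h4] at this
  · rintro ⟨ha, hb, hn, h⟩
    refine ⟨⟨ha, hb, hn, fun c hc hca hi => h c hc hca hi.2⟩, hb, ha, hn.symm,
      fun c hc hcb hi => ?_⟩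
    by_cases hca : c = a
    · subst hca
      exact not_inArc_right _ _ hi.1
    · rw [Equiv.Perm.mul_apply, Equiv.swap_apply_of_ne_of_ne hca hcb] at hi
      exact h c hc hca hi.2

/-- Pairs of composable empty rectangles out of `x` cancel in characteristic two, except for those
that form an annulus. -/
theorem sum_freeRects_freeRects (hV : ∀ v : V, v + v = 0) (T : Finset (Fin M)) (x : State M)
    (Θ : (Fin M → Fin M → ℕ) → State M → V) :
    ∑ r ∈ freeRects T x, ∑ s ∈ freeRects T (x * Equiv.swap r.1 r.2),
      Θ (box r.1 r.2 (x r.1) (x r.2) + box s.1 s.2 ((x * Equiv.swap r.1 r.2) s.1)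
        ((x * Equiv.swap r.1 r.2) s.2)) (x * Equiv.swap r.1 r.2 * Equiv.swap s.1 s.2) =
    ∑ r ∈ colStrips T, Θ (fun c _ => arcInd r.1 r.2 c) x +
      ∑ r ∈ rowStrips T x, Θ (fun _ r' => arcInd (x r.1) (x r.2) r') x := by
  have h0 : ∑ r ∈ freeRects T x, ∑ s ∈ freeRects T (x * Equiv.swap r.1 r.2),
      Θ (box r.1 r.2 (x r.1) (x r.2) + box s.1 s.2 ((x * Equiv.swap r.1 r.2) s.1)
        ((x * Equiv.swap r.1 r.2) s.2)) (x * Equiv.swap r.1 r.2 * Equiv.swap s.1 s.2) =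
      ∑ a, ∑ b, ∑ a', ∑ b', pairTerm T x Θ a b a' b' := by
    rw [← Finset.sum_product', Finset.univ_product_univ, ← Finset.sum_filter_add_sum_filter_not
      (Finset.univ : Finset (Fin M × Fin M)) (· ∈ freeRects T x)]
    rw [Finset.sum_eq_zero (s := Finset.univ.filter (· ∉ freeRects T x)), add_zero]
    · rw [Finset.filter_mem_eq_inter, Finset.univ_inter]
      refine Finset.sum_congr rfl fun r hr => ?_
      rw [← Finset.sum_product', Finset.univ_product_univ]
      simp only [pairTerm, hr, true_and]
      rw [← Finset.sum_filter]
      refine Finset.sum_congr (by ext; simp) fun s hs => rfl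
    · intro r hr
      rw [Finset.mem_filter] at hr
      simp [pairTerm, hr.2]
  rw [h0]
  -- The second rectangle shares with the first both lines, exactly one, or none.
  have h1 : ∀ a b, ∑ a', ∑ b', pairTerm T x Θ a b a' b' =
      pairTerm T x Θ a b a b + pairTerm T x Θ a b b a +
      (∑ v, if a ≠ b ∧ a ≠ v ∧ b ≠ v then pairTerm T x Θ a b a v + pairTerm T x Θ a b v a +
        pairTerm T x Θ a b b v + pairTerm T x Θ a b v b else 0) +
      ∑ a', ∑ b', if a ≠ a' ∧ b ≠ a' ∧ a ≠ b' ∧ b ≠ b' then pairTerm T x Θ a b a' b' else 0 := by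
    intro a b
    by_cases hab : a = b
    · subst hab
      simp [pairTerm_of_eq_left]
    rw [sum_split_two hab]
    have h2 : ∀ a', ∑ b', pairTerm T x Θ a b a' b' = pairTerm T x Θ a b a' a +
        pairTerm T x Θ a b a' b + ∑ v, if a ≠ v ∧ b ≠ v then pairTerm T x Θ a b a' v else 0 :=
      fun a' => sum_split_two hab _
    simp only [h2, pairTerm_of_eq_right]
    have h3 : ∀ a', (if a ≠ a' ∧ b ≠ a' then pairTerm T x Θ a b a' a +
        pairTerm T x Θ a b a' b + ∑ v, (if a ≠ v ∧ b ≠ v then pairTerm T x Θ a b a' v else 0)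
        else 0) =
        (if a ≠ a' ∧ b ≠ a' then pairTerm T x Θ a b a' a else 0) +
        (if a ≠ a' ∧ b ≠ a' then pairTerm T x Θ a b a' b else 0) +
        ∑ v, (if a ≠ a' ∧ b ≠ a' ∧ a ≠ v ∧ b ≠ v then pairTerm T x Θ a b a' v else 0) := by
      intro a'
      by_cases h : a ≠ a' ∧ b ≠ a'
      · simp [h]
      · have : ∀ v, ¬ (a ≠ a' ∧ b ≠ a' ∧ a ≠ v ∧ b ≠ v) := fun v => by tauto
        simp [h, this]
    have h4 : ∀ v, (if a ≠ b ∧ a ≠ v ∧ b ≠ v then pairTerm T x Θ a b a v + pairTerm T x Θ a b v a +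
        pairTerm T x Θ a b b v + pairTerm T x Θ a b v b else 0) =
        (if a ≠ v ∧ b ≠ v then pairTerm T x Θ a b a v else 0) +
        (if a ≠ v ∧ b ≠ v then pairTerm T x Θ a b v a else 0) +
        (if a ≠ v ∧ b ≠ v then pairTerm T x Θ a b b v else 0) +
        (if a ≠ v ∧ b ≠ v then pairTerm T x Θ a b v b else 0) := by
      intro v
      by_cases h : a ≠ v ∧ b ≠ v
      · simp [h, hab]
      · simp only [h, if_false]
        simp
    simp only [h3, h4, Finset.sum_add_distrib]
    abel
  simp only [h1, Finset.sum_add_distrib]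
  -- One common line: renaming the indices puts it in the middle, as in `pairTermThree`.
  have h5 : (∑ a, ∑ b, ∑ v, if a ≠ b ∧ a ≠ v ∧ b ≠ v then pairTerm T x Θ a b a v +
      pairTerm T x Θ a b v a + pairTerm T x Θ a b b v + pairTerm T x Θ a b v b else 0) = 0 := by
    refine Eq.trans ?_ (sum_three_eq_zero hV _ fun u c v huc huv hcv =>
      pairTermThree_cyclic (T := T) (x := x) (Θ := Θ) hV huc huv hcv)
    have e1 : ∀ a b v : Fin M, (if a ≠ b ∧ a ≠ v ∧ b ≠ v then pairTerm T x Θ a b a v +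
      pairTerm T x Θ a b v a + pairTerm T x Θ a b b v + pairTerm T x Θ a b v b else 0) =
      (if a ≠ b ∧ a ≠ v ∧ b ≠ v then pairTerm T x Θ a b a v + pairTerm T x Θ a b v a else 0) +
      (if a ≠ b ∧ a ≠ v ∧ b ≠ v then pairTerm T x Θ a b b v + pairTerm T x Θ a b v b else 0) := by
      intro a b v; split_ifs <;> abel
    have e2 : ∀ u c v : Fin M, (if u ≠ c ∧ u ≠ v ∧ c ≠ v then pairTermThree T x Θ u c v else 0) =
      (if u ≠ c ∧ u ≠ v ∧ c ≠ v then pairTerm T x Θ c u c v + pairTerm T x Θ c u v c else 0) +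
      (if u ≠ c ∧ u ≠ v ∧ c ≠ v then pairTerm T x Θ u c c v + pairTerm T x Θ u c v c else 0) := by
      intro u c v; unfold pairTermThree; split_ifs <;> abel
    simp only [e1, e2, Finset.sum_add_distrib]
    congr 1
    rw [Finset.sum_comm]
    refine Finset.sum_congr rfl fun u _ => Finset.sum_congr rfl fun c _ =>
      Finset.sum_congr rfl fun v _ => ?_
    exact if_congr (by tauto) rfl rfl
  -- No common line: the terms cancel by exchanging the order of the two rectangles.
  have h6 : (∑ a, ∑ b, ∑ a', ∑ b',
      if a ≠ a' ∧ b ≠ a' ∧ a ≠ b' ∧ b ≠ b' then pairTerm T x Θ a b a' b' else 0) = 0 := by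
    have := sum_symm_eq_zero (α := Fin M × Fin M) hV (fun q q' =>
      if q.1 ≠ q'.1 ∧ q.2 ≠ q'.1 ∧ q.1 ≠ q'.2 ∧ q.2 ≠ q'.2
      then pairTerm T x Θ q.1 q.2 q'.1 q'.2 else 0) ?_ ?_
    · simpa only [Fintype.sum_prod_type] using this
    · rintro ⟨a, b⟩ ⟨a', b'⟩
      simp only
      by_cases h : a ≠ a' ∧ b ≠ a' ∧ a ≠ b' ∧ b ≠ b'
      · rw [if_pos h, if_pos (by tauto)]
        exact pairTerm_comm h.1 h.2.2.1 h.2.1 h.2.2.2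
      · rw [if_neg h, if_neg (by tauto)]
    · simp
  rw [h5, h6, add_zero, add_zero]
  simp only [pairTerm_col, pairTerm_row]
  congr 1
  · rw [← Finset.sum_product', Finset.univ_product_univ]
    simp only [Prod.mk.eta]
    rw [Finset.sum_ite_mem, Finset.univ_inter]
  · rw [← Finset.sum_product', Finset.univ_product_univ]
    simp only [Prod.mk.eta]
    rw [Finset.sum_ite_mem, Finset.univ_inter]

end Pairs

end Grid

namespace Grid

variable {M : ℕ}

/-! ### Operators counting weighted rectangles, and their commutation relations -/

section Operators

variable {R : Type*} [CommRing R]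

/-- The operator that counts the empty rectangles with corners on the lines of `T` with weights
`w`. -/
noncomputable def rectOp (T : Finset (Fin M)) (w : State M → Fin M → Fin M → R) :
    (State M →₀ R) →ₗ[R] (State M →₀ R) :=
  Finsupp.linearCombination R fun x =>
    ∑ r ∈ freeRects T x, Finsupp.single (x * Equiv.swap r.1 r.2) (w x r.1 r.2)

theorem rectOp_single (T : Finset (Fin M)) (w : State M → Fin M → Fin M → R) (x : State M) :
    rectOp T w (Finsupp.single x 1) =
      ∑ r ∈ freeRects T x, Finsupp.single (x * Equiv.swap r.1 r.2) (w x r.1 r.2) := by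
  simp [rectOp]

theorem rectOp_rectOp_single (T : Finset (Fin M)) (w w' : State M → Fin M → Fin M → R)
    (x : State M) : rectOp T w' (rectOp T w (Finsupp.single x 1)) =
      ∑ r ∈ freeRects T x, ∑ s ∈ freeRects T (x * Equiv.swap r.1 r.2),
        Finsupp.single (x * Equiv.swap r.1 r.2 * Equiv.swap s.1 s.2)
          (w x r.1 r.2 * w' (x * Equiv.swap r.1 r.2) s.1 s.2) := by
  rw [rectOp_single, map_sum]
  refine Finset.sum_congr rfl fun r _ => ?_
  rw [rectOp, Finsupp.linearCombination_single, Finset.smul_sum]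
  simp

theorem linearMap_eq_of_supported {α W : Type*} [AddCommGroup W] [Module R W] {S : Set α}
    {f g : (α →₀ R) →ₗ[R] W}
    (h : ∀ x ∈ S, f (Finsupp.single x 1) = g (Finsupp.single x 1)) {v : α →₀ R}
    (hv : v ∈ Finsupp.supported R R S) : f v = g v := by
  rw [← v.sum_single, Finsupp.sum, map_sum, map_sum]
  refine Finset.sum_congr rfl fun x hx => ?_
  rw [← mul_one (v x), ← smul_eq_mul, ← Finsupp.smul_single, map_smul, map_smul, h x (hv hx)]

theorem linearMap_mem_of_supported {α W : Type*} [AddCommGroup W] [Module R W] {S : Set α}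
    {f : (α →₀ R) →ₗ[R] W} {P : Submodule R W}
    (h : ∀ x ∈ S, f (Finsupp.single x 1) ∈ P) {v : α →₀ R}
    (hv : v ∈ Finsupp.supported R R S) : f v ∈ P := by
  rw [← v.sum_single, Finsupp.sum, map_sum]
  refine Submodule.sum_mem _ fun x hx => ?_
  rw [← mul_one (v x), ← smul_eq_mul, ← Finsupp.smul_single, map_smul]
  exact P.smul_mem _ (h x (hv hx))

theorem rectOp_mem_supported {T : Finset (Fin M)} {w : State M → Fin M → Fin M → R}
    {S S' : Set (State M)}
    (h : ∀ x ∈ S, ∀ a b, (a, b) ∈ freeRects T x → w x a b = 0 ∨ x * Equiv.swap a b ∈ S')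
    {v : State M →₀ R} (hv : v ∈ Finsupp.supported R R S) :
    rectOp T w v ∈ Finsupp.supported R R S' := by
  refine linearMap_mem_of_supported (fun x hx => ?_) hv
  rw [rectOp_single]
  refine Submodule.sum_mem _ fun r hr => ?_
  rcases h x hx r.1 r.2 hr with h | h
  · simp [h]
  · exact Finsupp.single_mem_supported _ _ h

/-- Rectangles of weight zero may be counted or not. This is how operators with different sets of
lines are compared. -/
theorem rectOp_eq_of_supported {T T' : Finset (Fin M)} {w w' : State M → Fin M → Fin M → R}
    {S : Set (State M)}
    (h : ∀ x ∈ S, ∀ a b, (if (a, b) ∈ freeRects T x then w x a b else 0) =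
      if (a, b) ∈ freeRects T' x then w' x a b else 0)
    {v : State M →₀ R} (hv : v ∈ Finsupp.supported R R S) :
    rectOp T w v = rectOp T' w' v := by
  refine linearMap_eq_of_supported (fun x hx => ?_) hv
  rw [rectOp_single, rectOp_single]
  have key : ∀ (T : Finset (Fin M)) (w : State M → Fin M → Fin M → R),
      ∑ r ∈ freeRects T x, Finsupp.single (x * Equiv.swap r.1 r.2) (w x r.1 r.2) =
      ∑ r : Fin M × Fin M, Finsupp.single (x * Equiv.swap r.1 r.2)
        (if (r.1, r.2) ∈ freeRects T x then w x r.1 r.2 else 0) := by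
    intro T w
    rw [← Finset.sum_filter_add_sum_filter_not Finset.univ (· ∈ freeRects T x)]
    rw [Finset.sum_eq_zero (s := Finset.univ.filter (· ∉ freeRects T x)), add_zero]
    · refine Finset.sum_congr (by ext; simp) fun r hr => ?_
      rw [if_pos (Finset.mem_filter.1 hr).2]
    · intro r hr
      rw [Finset.mem_filter] at hr
      simp [hr.2]
  rw [key, key]
  exact Finset.sum_congr rfl fun r _ => by rw [h x hx]

theorem rectOp_eq_zero_of_supported {T : Finset (Fin M)} {w : State M → Fin M → Fin M → R}
    {S : Set (State M)}
    (h : ∀ x ∈ S, ∀ a b, (a, b) ∈ freeRects T x → w x a b = 0)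
    {v : State M →₀ R} (hv : v ∈ Finsupp.supported R R S) : rectOp T w v = 0 := by
  refine (rectOp_eq_of_supported (T' := T) (w' := 0) (fun x hx a b => ?_) hv).trans ?_
  · by_cases hab : (a, b) ∈ freeRects T x
    · simp [hab, h x hx a b hab]
    · simp [hab]
  · simp [rectOp, Finsupp.linearCombination_apply]

/-- The operator of weights that only depend on the multiplicities of the rectangle. -/
noncomputable def domOp (T : Finset (Fin M)) (θ : (Fin M → Fin M → ℕ) → R) :
    (State M →₀ R) →ₗ[R] (State M →₀ R) :=
  rectOp T fun x a b => θ (box a b (x a) (x b))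

theorem domOp_eq_of_supported {T T' : Finset (Fin M)} {θ θ' : (Fin M → Fin M → ℕ) → R}
    {S : Set (State M)}
    (h : ∀ x ∈ S, ∀ a b, (if (a, b) ∈ freeRects T x then θ (box a b (x a) (x b)) else 0) =
      if (a, b) ∈ freeRects T' x then θ' (box a b (x a) (x b)) else 0)
    {v : State M →₀ R} (hv : v ∈ Finsupp.supported R R S) :
    domOp T θ v = domOp T' θ' v :=
  rectOp_eq_of_supported h hv

theorem domOp_eq_zero_of_supported {T : Finset (Fin M)} {θ : (Fin M → Fin M → ℕ) → R}
    {S : Set (State M)}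
    (h : ∀ x ∈ S, ∀ a b, (a, b) ∈ freeRects T x → θ (box a b (x a) (x b)) = 0)
    {v : State M →₀ R} (hv : v ∈ Finsupp.supported R R S) : domOp T θ v = 0 :=
  rectOp_eq_zero_of_supported h hv

theorem domOp_mem_supported {T : Finset (Fin M)} {θ : (Fin M → Fin M → ℕ) → R}
    {S S' : Set (State M)}
    (h : ∀ x ∈ S, ∀ a b, (a, b) ∈ freeRects T x →
      θ (box a b (x a) (x b)) = 0 ∨ x * Equiv.swap a b ∈ S')
    {v : State M →₀ R} (hv : v ∈ Finsupp.supported R R S) :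
    domOp T θ v ∈ Finsupp.supported R R S' :=
  rectOp_mem_supported h hv

/-- The monomial in the weights `ω` of the squares. -/
def mono (ω : Fin M → Fin M → R) (m : Fin M → Fin M → ℕ) : R :=
  ∏ c, ∏ r, ω c r ^ m c r

theorem mono_add (ω : Fin M → Fin M → R) (m m' : Fin M → Fin M → ℕ) :
    mono ω (m + m') = mono ω m * mono ω m' := by
  simp only [mono, Pi.add_apply, pow_add, Finset.prod_mul_distrib]

theorem mono_eq_zero {ω : Fin M → Fin M → R} {m : Fin M → Fin M → ℕ} {c r : Fin M}
    (h : ω c r = 0) (hm : m c r ≠ 0) : mono ω m = 0 :=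
  Finset.prod_eq_zero (Finset.mem_univ c)
    (Finset.prod_eq_zero (Finset.mem_univ r) (by rw [h, zero_pow hm]))

/-- The differential of the complex with lines `T` and weights `ω`. -/
noncomputable def diff (T : Finset (Fin M)) (ω : Fin M → Fin M → R) :
    (State M →₀ R) →ₗ[R] (State M →₀ R) :=
  domOp T (mono ω)

/-! ### Strips -/

theorem mem_colStrips {T : Finset (Fin M)} {a b : Fin M} : (a, b) ∈ colStrips T ↔
    a ∈ T ∧ b ∈ T ∧ a ≠ b ∧ ∀ c ∈ T, c ≠ a → ¬ InArc a b c := by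
  simp [colStrips]

theorem colStrips_left_unique {T : Finset (Fin M)} {a a' b : Fin M} (h : (a, b) ∈ colStrips T)
    (h' : (a', b) ∈ colStrips T) : a = a' := by
  rw [mem_colStrips] at h h'
  by_contra hne
  have h1 := h.2.2.2 a' h'.1 (Ne.symm hne)
  have h2 := h'.2.2.2 a h.1 hne
  have h3 := h.2.2.1
  have h4 := h'.2.2.1
  rw [inArc_iff] at h1 h2
  omega

theorem colStrips_right_unique {T : Finset (Fin M)} {a b b' : Fin M} (h : (a, b) ∈ colStrips T)
    (h' : (a, b') ∈ colStrips T) : b = b' := by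
  rw [mem_colStrips] at h h'
  by_contra hne
  have h1 := h.2.2.2 b' h'.2.1 h'.2.2.1.symm
  have h2 := h'.2.2.2 b h.2.1 h.2.2.1.symm
  have h3 := h.2.2.1
  have h4 := h'.2.2.1
  rw [inArc_iff] at h1 h2
  omega

/-- The right-hand side depends on the state only through the rows it occupies over `T`, so it
becomes a common scalar for all states that are frozen alike off `T`. -/
theorem sum_rowStrips {W : Type*} [AddCommMonoid W] (T : Finset (Fin M)) (x : State M)
    (g : Fin M → Fin M → W) :
    ∑ r ∈ rowStrips T x, g (x r.1) (x r.2) = ∑ r ∈ colStrips (T.image x), g r.1 r.2 := by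
  refine Finset.sum_bij (fun r _ => (x r.1, x r.2)) ?_ ?_ ?_ ?_
  · rintro ⟨a, b⟩ h
    simp only [rowStrips, Finset.mem_filter, Finset.mem_univ, true_and] at h
    rw [mem_colStrips]
    refine ⟨Finset.mem_image_of_mem _ h.1, Finset.mem_image_of_mem _ h.2.1,
      x.injective.ne h.2.2.1, ?_⟩
    intro c hc hca
    obtain ⟨d, hd, rfl⟩ := Finset.mem_image.1 hc
    exact h.2.2.2 d hd fun hda => hca (by rw [hda])
  · rintro ⟨a, b⟩ _ ⟨a', b'⟩ _ h
    simpa using h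
  · rintro ⟨i, k⟩ h
    rw [mem_colStrips] at h
    obtain ⟨a, ha, rfl⟩ := Finset.mem_image.1 h.1
    obtain ⟨b, hb, rfl⟩ := Finset.mem_image.1 h.2.1
    refine ⟨(a, b), ?_, rfl⟩
    simp only [rowStrips, Finset.mem_filter, Finset.mem_univ, true_and]
    exact ⟨ha, hb, fun hab => h.2.2.1 (by rw [hab]), fun c hc hca =>
      h.2.2.2 _ (Finset.mem_image_of_mem _ hc) (x.injective.ne hca)⟩
  · intros; rfl

/-- The weight of a strip of columns. -/
def colMono (ω : Fin M → Fin M → R) (a b : Fin M) : R := mono ω fun c _ => arcInd a b c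

/-- The weight of a strip of rows. -/
def rowMono (ω : Fin M → Fin M → R) (i k : Fin M) : R := mono ω fun _ r => arcInd i k r

variable [CharP R 2]

theorem chain_add_self (v : State M →₀ R) : v + v = 0 := by
  ext x; simp [CharTwo.add_self_eq_zero]

theorem chain_eq_of_add {u v : State M →₀ R} (h : u + v = 0) : u = v := by
  rw [← add_zero u, ← chain_add_self v, ← add_assoc, h, zero_add]

/-- This is the source of the relations used for merging: if a symmetrized product of weights is a
function of the total domain, the composites add up to the scalar contributed by the annuli. -/
theorem domOp_domOp_add (T : Finset (Fin M)) {θ₁ θ₂ θ₃ θ₄ Θ : (Fin M → Fin M → ℕ) → R}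
    (h : ∀ m m', θ₁ m * θ₂ m' + θ₂ m * θ₁ m' + (θ₃ m * θ₄ m' + θ₄ m * θ₃ m') = Θ (m + m'))
    (x : State M) :
    domOp T θ₂ (domOp T θ₁ (Finsupp.single x 1)) + domOp T θ₁ (domOp T θ₂ (Finsupp.single x 1)) +
      (domOp T θ₄ (domOp T θ₃ (Finsupp.single x 1)) +
        domOp T θ₃ (domOp T θ₄ (Finsupp.single x 1))) =
    (∑ r ∈ colStrips T, Θ (fun c _ => arcInd r.1 r.2 c) +
      ∑ r ∈ colStrips (T.image x), Θ (fun _ r' => arcInd r.1 r.2 r')) • Finsupp.single x 1 := by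
  simp only [domOp, rectOp_rectOp_single, ← Finset.sum_add_distrib, ← Finsupp.single_add, h]
  rw [sum_freeRects_freeRects chain_add_self T x fun m y => Finsupp.single y (Θ m),
    sum_rowStrips T x fun i k => Finsupp.single x (Θ fun _ r' => arcInd i k r')]
  simp only [Finsupp.smul_single, smul_eq_mul, mul_one, Finsupp.single_add,
    Finsupp.single_finsetSum]

theorem domOp_domOp_add_two (T : Finset (Fin M)) {θ₁ θ₂ Θ : (Fin M → Fin M → ℕ) → R}
    (h : ∀ m m', θ₁ m * θ₂ m' + θ₂ m * θ₁ m' = Θ (m + m')) (x : State M) :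
    domOp T θ₂ (domOp T θ₁ (Finsupp.single x 1)) + domOp T θ₁ (domOp T θ₂ (Finsupp.single x 1)) =
    (∑ r ∈ colStrips T, Θ (fun c _ => arcInd r.1 r.2 c) +
      ∑ r ∈ colStrips (T.image x), Θ (fun _ r' => arcInd r.1 r.2 r')) • Finsupp.single x 1 := by
  rw [← domOp_domOp_add T (θ₃ := fun _ => 0) (θ₄ := fun _ => 0) (Θ := Θ) (θ₁ := θ₁) (θ₂ := θ₂)
    (by simpa using h)]
  simp [domOp, rectOp, Finsupp.linearCombination_apply]

end Operators

end Grid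

namespace Grid

variable {M : ℕ}

/-! ### States that agree with a given one off some lines -/

/-- The states that agree with `Z` off the lines of `T`. -/
def compat (T : Finset (Fin M)) (Z : State M) : Set (State M) :=
  {x | ∀ m, m ∉ T → x m = Z m}

theorem mem_compat_erase {T : Finset (Fin M)} {Z x : State M} {a : Fin M} (ha : a ∈ T) :
    x ∈ compat (T.erase a) Z ↔ x ∈ compat T Z ∧ x a = Z a := by
  simp only [compat, Set.mem_ofPred_eq, Finset.mem_erase, not_and_or, not_not]
  constructor
  · exact fun h => ⟨fun m hm => h m (Or.inr hm), h a (Or.inl rfl)⟩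
  · rintro ⟨h, h'⟩ m (rfl | hm)
    · exact h'
    · exact h m hm

theorem compat_swap {T : Finset (Fin M)} {Z x : State M} {a b : Fin M} (hx : x ∈ compat T Z)
    (ha : a ∈ T) (hb : b ∈ T) : x * Equiv.swap a b ∈ compat T Z := by
  intro m hm
  rw [Equiv.Perm.mul_apply, Equiv.swap_apply_of_ne_of_ne]
  · exact hx m hm
  · rintro rfl; exact hm ha
  · rintro rfl; exact hm hb

theorem mem_of_compat {T : Finset (Fin M)} {Z x : State M} {a m : Fin M} (hx : x ∈ compat T Z)
    (ha : a ∈ T) (h : x m = Z a) : m ∈ T := by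
  by_contra hm
  rw [hx m hm] at h
  exact hm (Z.injective h ▸ ha)

theorem image_compat {T : Finset (Fin M)} {Z x : State M} (hx : x ∈ compat T Z) :
    T.image x = T.image Z := by
  refine (Finset.eq_of_subset_of_card_le ?_ ?_).symm
  · intro s hs
    obtain ⟨a, ha, rfl⟩ := Finset.mem_image.1 hs
    refine Finset.mem_image.2 ⟨x.symm (Z a), mem_of_compat hx ha (by simp), by simp⟩
  · rw [Finset.card_image_of_injective _ x.injective, Finset.card_image_of_injective _ Z.injective]

/-! ### Freezing one point: the four squares around it -/

section Merge

variable {R : Type*} [CommRing R]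

theorem mono_mul (ω ω' : Fin M → Fin M → R) (m : Fin M → Fin M → ℕ) :
    mono (fun c r => ω c r * ω' c r) m = mono ω m * mono ω' m := by
  simp only [mono, mul_pow, Finset.prod_mul_distrib]

/-- The weight `t` in one square. -/
def spot (c₀ r₀ : Fin M) (t : R) (c r : Fin M) : R := if c = c₀ ∧ r = r₀ then t else 1

theorem mono_spot (c₀ r₀ : Fin M) (t : R) (m : Fin M → Fin M → ℕ) :
    mono (spot c₀ r₀ t) m = t ^ m c₀ r₀ := by
  rw [mono, Finset.prod_eq_single c₀, Finset.prod_eq_single r₀]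
  · simp [spot]
  · intro r _ hr; simp [spot, hr]
  · simp
  · intro c _ hc
    exact Finset.prod_eq_one fun r _ => by simp [spot, hc]
  · simp

/-- The multiplicities in the four squares south-west, north-east, north-west and south-east of a
point. -/
def corner (a₁ a₀ s₁ s₀ : Fin M) (m : Fin M → Fin M → ℕ) : ℕ × ℕ × ℕ × ℕ :=
  (m a₁ s₁, m a₀ s₀, m a₁ s₀, m a₀ s₁)

/-- The columns on the two sides of a line are told apart only by arcs with an end on that line. -/
theorem arcInd_pair {a₁ a₀ a b : Fin M} (ha : (a₁ : ℕ) + 1 = a₀) (hab : a ≠ b) :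
    (a = a₀ ∧ b ≠ a₀ ∧ arcInd a b a₁ = 0 ∧ arcInd a b a₀ = 1) ∨
    (b = a₀ ∧ a ≠ a₀ ∧ arcInd a b a₁ = 1 ∧ arcInd a b a₀ = 0) ∨
    (a ≠ a₀ ∧ b ≠ a₀ ∧ arcInd a b a₁ = 1 ∧ arcInd a b a₀ = 1) ∨
    (a ≠ a₀ ∧ b ≠ a₀ ∧ arcInd a b a₁ = 0 ∧ arcInd a b a₀ = 0) := by
  simp only [arcInd, inArc_iff]
  split_ifs <;> omega

variable {T : Finset (Fin M)} {Z : State M} {a₁ a₀ s₁ s₀ : Fin M}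

/-- An empty rectangle out of a state through the point starts there, ends there, or misses all four
squares. Covering all four would put the point in the interior, and an edge through the point would
make it a corner. -/
theorem corner_of_eq (ha : (a₁ : ℕ) + 1 = a₀) (hs : (s₁ : ℕ) + 1 = s₀) (ha₀ : a₀ ∈ T)
    {x : State M} (hx : x a₀ = s₀) {a b : Fin M} (h : (a, b) ∈ freeRects T x) :
    (corner a₁ a₀ s₁ s₀ (box a b (x a) (x b)) = (0, 0, 0, 0) ∧ (x * Equiv.swap a b) a₀ = s₀ ∧
      a ≠ a₀ ∧ b ≠ a₀) ∨
    corner a₁ a₀ s₁ s₀ (box a b (x a) (x b)) = (0, 1, 0, 0) ∨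
    corner a₁ a₀ s₁ s₀ (box a b (x a) (x b)) = (1, 0, 0, 0) := by
  rw [mem_freeRects] at h
  obtain ⟨hat, hbt, hab, hf⟩ := h
  have inj : ∀ d, x d = s₀ → d = a₀ := fun d hd => x.injective (hd.trans hx.symm)
  have h0 := hf a₀ ha₀
  rw [hx] at h0
  simp only [box] at h0
  simp only [corner, box, Prod.mk.injEq]
  rcases arcInd_pair ha hab with ⟨e1, e2, e3, e4⟩ | ⟨e1, e2, e3, e4⟩ | ⟨e1, e2, e3, e4⟩ |
    ⟨e1, e2, e3, e4⟩ <;>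
  rcases arcInd_pair hs (x.injective.ne hab) with ⟨f1, f2, f3, f4⟩ | ⟨f1, f2, f3, f4⟩ |
    ⟨f1, f2, f3, f4⟩ | ⟨f1, f2, f3, f4⟩ <;>
  simp only [e3, e4, f3, f4] at h0 ⊢
  · simp
  · exact absurd (inj _ f1) e2
  · subst e1; exact absurd hx f1
  · subst e1; exact absurd hx f1
  · exact absurd (inj _ f1) e2
  · simp
  · subst e1; exact absurd hx f2
  · subst e1; exact absurd hx f2
  · exact absurd (inj _ f1) e1
  · exact absurd (inj _ f1) e2
  · exact absurd (h0 (Ne.symm e1)) (by norm_num)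
  · refine Or.inl ⟨by simp, ?_, e1, e2⟩
    rw [Equiv.Perm.mul_apply, Equiv.swap_apply_of_ne_of_ne (Ne.symm e1) (Ne.symm e2), hx]
  · exact absurd (inj _ f1) e1
  · exact absurd (inj _ f1) e2
  · refine Or.inl ⟨by simp, ?_, e1, e2⟩
    rw [Equiv.Perm.mul_apply, Equiv.swap_apply_of_ne_of_ne (Ne.symm e1) (Ne.symm e2), hx]
  · refine Or.inl ⟨by simp, ?_, e1, e2⟩
    rw [Equiv.Perm.mul_apply, Equiv.swap_apply_of_ne_of_ne (Ne.symm e1) (Ne.symm e2), hx]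

/-- A rectangle reaches the point only by creating it as its own north-west or south-east corner. It
then covers just the south-east, respectively north-west, one of the four squares. -/
theorem corner_of_ne (ha : (a₁ : ℕ) + 1 = a₀) (hs : (s₁ : ℕ) + 1 = s₀)
    {x : State M} (hx : x a₀ ≠ s₀) {a b : Fin M} (h : (a, b) ∈ freeRects T x) :
    (corner a₁ a₀ s₁ s₀ (box a b (x a) (x b)) = (0, 0, 1, 0) ∧ (x * Equiv.swap a b) a₀ = s₀) ∨
    (corner a₁ a₀ s₁ s₀ (box a b (x a) (x b)) = (0, 0, 0, 1) ∧ (x * Equiv.swap a b) a₀ = s₀) ∨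
    ((corner a₁ a₀ s₁ s₀ (box a b (x a) (x b)) = (0, 0, 0, 0) ∨
      corner a₁ a₀ s₁ s₀ (box a b (x a) (x b)) = (0, 1, 1, 0) ∨
      corner a₁ a₀ s₁ s₀ (box a b (x a) (x b)) = (0, 1, 0, 1) ∨
      corner a₁ a₀ s₁ s₀ (box a b (x a) (x b)) = (1, 0, 1, 0) ∨
      corner a₁ a₀ s₁ s₀ (box a b (x a) (x b)) = (1, 0, 0, 1) ∨
      corner a₁ a₀ s₁ s₀ (box a b (x a) (x b)) = (1, 1, 1, 1)) ∧
        (x * Equiv.swap a b) a₀ ≠ s₀) := by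
  rw [mem_freeRects] at h
  obtain ⟨-, -, hab, -⟩ := h
  have ya : a = a₀ → (x * Equiv.swap a b) a₀ = x b := by rintro rfl; simp
  have yb : b = a₀ → (x * Equiv.swap a b) a₀ = x a := by rintro rfl; simp
  have yo : a ≠ a₀ → b ≠ a₀ → (x * Equiv.swap a b) a₀ = x a₀ := fun h1 h2 => by
    rw [Equiv.Perm.mul_apply, Equiv.swap_apply_of_ne_of_ne h1.symm h2.symm]
  simp only [corner, box, Prod.mk.injEq]
  rcases arcInd_pair ha hab with ⟨e1, e2, e3, e4⟩ | ⟨e1, e2, e3, e4⟩ | ⟨e1, e2, e3, e4⟩ |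
    ⟨e1, e2, e3, e4⟩ <;>
  rcases arcInd_pair hs (x.injective.ne hab) with ⟨f1, f2, f3, f4⟩ | ⟨f1, f2, f3, f4⟩ |
    ⟨f1, f2, f3, f4⟩ | ⟨f1, f2, f3, f4⟩ <;>
  simp only [e3, e4, f3, f4]
  · exact absurd (e1 ▸ f1) hx
  · simp [ya e1, f1]
  · simp [ya e1, f2]
  · simp [ya e1, f2]
  · simp [yb e1, f1]
  · exact absurd (e1 ▸ f1) hx
  · simp [yb e1, f1]
  · simp [yb e1, f1]
  all_goals simp [yo e1 e2, hx]

/-- The part of the monomial with given multiplicities at the four squares around a point. -/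
def cornerMono (ω : Fin M → Fin M → R) (a₁ a₀ s₁ s₀ : Fin M) (v : ℕ × ℕ × ℕ × ℕ)
    (m : Fin M → Fin M → ℕ) : R :=
  if corner a₁ a₀ s₁ s₀ m = v then mono ω m else 0

/-- The part of the differential with given multiplicities at the four squares around a point. -/
noncomputable def cornerOp (T : Finset (Fin M)) (ω : Fin M → Fin M → R) (a₁ a₀ s₁ s₀ : Fin M)
    (v : ℕ × ℕ × ℕ × ℕ) : (State M →₀ R) →ₗ[R] (State M →₀ R) :=
  domOp T (cornerMono ω a₁ a₀ s₁ s₀ v)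

theorem corner_add (m m' : Fin M → Fin M → ℕ) : corner a₁ a₀ s₁ s₀ (m + m') =
    corner a₁ a₀ s₁ s₀ m + corner a₁ a₀ s₁ s₀ m' := rfl

theorem corner_col (a b : Fin M) :
    corner a₁ a₀ s₁ s₀ (fun c _ => arcInd a b c) =
      (arcInd a b a₁, arcInd a b a₀, arcInd a b a₁, arcInd a b a₀) := rfl

theorem corner_row (i k : Fin M) :
    corner a₁ a₀ s₁ s₀ (fun _ r => arcInd i k r) =
      (arcInd i k s₁, arcInd i k s₀, arcInd i k s₀, arcInd i k s₁) := rfl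

/-- The products that occur in a commutator at multiplicities of total `v`. -/
theorem corner_products {ω : Fin M → Fin M → R} {u v : ℕ × ℕ × ℕ × ℕ}
    (huv : (u, v) ∈ ({((0, 1, 0, 0), (0, 0, 1, 0)), ((0, 1, 0, 0), (0, 0, 0, 1)),
      ((1, 0, 0, 0), (0, 0, 1, 0)), ((1, 0, 0, 0), (0, 0, 0, 1))} : Set _))
    (m m' : Fin M → Fin M → ℕ) :
    cornerMono ω a₁ a₀ s₁ s₀ u m *
      cornerMono ω a₁ a₀ s₁ s₀ v m' +
    cornerMono ω a₁ a₀ s₁ s₀ v m *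
      cornerMono ω a₁ a₀ s₁ s₀ u m' +
    (cornerMono ω a₁ a₀ s₁ s₀ (0, 0, 0, 0) m *
      cornerMono ω a₁ a₀ s₁ s₀ (u + v) m' +
    cornerMono ω a₁ a₀ s₁ s₀ (u + v) m *
      cornerMono ω a₁ a₀ s₁ s₀ (0, 0, 0, 0) m') =
    cornerMono ω a₁ a₀ s₁ s₀ (u + v) (m + m') := by
  simp only [cornerMono, mono_add, corner_add]
  generalize corner a₁ a₀ s₁ s₀ m = p
  generalize corner a₁ a₀ s₁ s₀ m' = q
  obtain ⟨p1, p2, p3, p4⟩ := p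
  obtain ⟨q1, q2, q3, q4⟩ := q
  simp only [Set.mem_insert_iff, Set.mem_singleton_iff, Prod.mk.injEq] at huv
  rcases huv with ⟨rfl, rfl⟩ | ⟨rfl, rfl⟩ | ⟨rfl, rfl⟩ | ⟨rfl, rfl⟩ <;>
  simp only [Prod.mk_add_mk, Prod.mk.injEq, ite_zero_mul_ite_zero, Nat.add_eq_one_iff,
    Nat.add_eq_zero_iff, add_zero, zero_add] <;>
  split_ifs <;> first | (exfalso; omega) | simp

/-- A single square cannot be split further, so one of the two rectangles must miss all four
squares. -/
theorem corner_products_zero {ω : Fin M → Fin M → R} {v : ℕ × ℕ × ℕ × ℕ}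
    (hv : v ∈ ({(0, 0, 1, 0), (0, 0, 0, 1)} : Set _)) (m m' : Fin M → Fin M → ℕ) :
    cornerMono ω a₁ a₀ s₁ s₀ (0, 0, 0, 0) m *
      cornerMono ω a₁ a₀ s₁ s₀ v m' +
    cornerMono ω a₁ a₀ s₁ s₀ v m *
      cornerMono ω a₁ a₀ s₁ s₀ (0, 0, 0, 0) m' =
    cornerMono ω a₁ a₀ s₁ s₀ (v) (m + m') := by
  simp only [cornerMono, mono_add, corner_add]
  generalize corner a₁ a₀ s₁ s₀ m = p
  generalize corner a₁ a₀ s₁ s₀ m' = q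
  obtain ⟨p1, p2, p3, p4⟩ := p
  obtain ⟨q1, q2, q3, q4⟩ := q
  simp only [Set.mem_insert_iff, Set.mem_singleton_iff] at hv
  rcases hv with rfl | rfl <;>
  simp only [Prod.mk_add_mk, Prod.mk.injEq, ite_zero_mul_ite_zero, Nat.add_eq_one_iff,
    Nat.add_eq_zero_iff] <;>
  split_ifs <;> first | (exfalso; omega) | simp

variable {ω : Fin M → Fin M → R}

/-- Of the strips between neighbouring lines, only the one beginning at `a₀` covers the column to
the right of this line without the column to its left. -/
theorem sum_corner_zero_one (ha : (a₁ : ℕ) + 1 = a₀) {b : Fin M}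
    (hb : (a₀, b) ∈ colStrips T) (g : Fin M → Fin M → R) :
    (∑ r ∈ colStrips T, if arcInd r.1 r.2 a₁ = 0 ∧ arcInd r.1 r.2 a₀ = 1 then g r.1 r.2 else 0) =
      g a₀ b := by
  have key : ∀ a b, a ≠ b → (arcInd a b a₁ = 0 ∧ arcInd a b a₀ = 1 ↔ a = a₀) := by
    intro a b hab
    rcases arcInd_pair ha hab with ⟨e1, e2, e3, e4⟩ | ⟨e1, e2, e3, e4⟩ | ⟨e1, e2, e3, e4⟩ |
      ⟨e1, e2, e3, e4⟩ <;> rw [e3, e4] <;> simp [e1, e2]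
  rw [Finset.sum_eq_single (a₀, b)]
  · rw [if_pos ((key _ _ (mem_colStrips.1 hb).2.2.1).2 rfl)]
  · rintro ⟨a, b'⟩ h hne
    refine if_neg fun h' => hne ?_
    obtain rfl := (key _ _ (mem_colStrips.1 h).2.2.1).1 h'
    rw [colStrips_right_unique h hb]
  · exact fun h => absurd hb h

theorem sum_corner_one_zero (ha : (a₁ : ℕ) + 1 = a₀) {b : Fin M}
    (hb : (b, a₀) ∈ colStrips T) (g : Fin M → Fin M → R) :
    (∑ r ∈ colStrips T, if arcInd r.1 r.2 a₁ = 1 ∧ arcInd r.1 r.2 a₀ = 0 then g r.1 r.2 else 0) =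
      g b a₀ := by
  have key : ∀ a b, a ≠ b → (arcInd a b a₁ = 1 ∧ arcInd a b a₀ = 0 ↔ b = a₀) := by
    intro a b hab
    rcases arcInd_pair ha hab with ⟨e1, e2, e3, e4⟩ | ⟨e1, e2, e3, e4⟩ | ⟨e1, e2, e3, e4⟩ |
      ⟨e1, e2, e3, e4⟩ <;> rw [e3, e4] <;> simp [e1, e2]
  rw [Finset.sum_eq_single (b, a₀)]
  · rw [if_pos ((key _ _ (mem_colStrips.1 hb).2.2.1).2 rfl)]
  · rintro ⟨b', a⟩ h hne
    refine if_neg fun h' => hne ?_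
    obtain rfl := (key _ _ (mem_colStrips.1 h).2.2.1).1 h'
    rw [colStrips_left_unique h hb]
  · exact fun h => absurd hb h

variable [CharP R 2]

/-- No annulus covers exactly one of the four squares, so the commutator has no scalar term. -/
theorem cornerOp_comm {v : ℕ × ℕ × ℕ × ℕ} (hv : v ∈ ({(0, 0, 1, 0), (0, 0, 0, 1)} : Set _))
    (f : State M →₀ R) :
    cornerOp T ω a₁ a₀ s₁ s₀ (0, 0, 0, 0) (cornerOp T ω a₁ a₀ s₁ s₀ v f) =
      cornerOp T ω a₁ a₀ s₁ s₀ v (cornerOp T ω a₁ a₀ s₁ s₀ (0, 0, 0, 0) f) := by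
  simp only [cornerOp, ← LinearMap.comp_apply]
  refine linearMap_eq_of_supported (S := Set.univ) (fun x _ => ?_) (by simp)
  simp only [LinearMap.comp_apply]
  have h := domOp_domOp_add_two T (corner_products_zero (a₁ := a₁) (a₀ := a₀) (s₁ := s₁)
    (s₀ := s₀) (ω := ω) hv) x
  rw [Finset.sum_eq_zero, Finset.sum_eq_zero, add_zero, zero_smul] at h
  · exact (chain_eq_of_add h).symm
  · rintro ⟨i, k⟩ -
    rw [cornerMono, corner_row]
    rcases hv with rfl | rfl <;> simp <;> omega
  · rintro ⟨i, k⟩ -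
    rw [cornerMono, corner_col]
    rcases hv with rfl | rfl <;> simp <;> omega

end Merge

end Grid

namespace Grid

variable {M : ℕ} {R : Type*} [CommRing R]

section Merge

variable {T : Finset (Fin M)} {Z : State M} {a₁ a₀ s₁ s₀ : Fin M} {ω : Fin M → Fin M → R}

theorem freeRects_ends {x : State M} {a b : Fin M} (h : (a, b) ∈ freeRects T x) :
    a ∈ T ∧ b ∈ T :=
  ⟨(mem_freeRects.1 h).1, (mem_freeRects.1 h).2.1⟩

theorem cornerOp_merged_eq_zero (ha : (a₁ : ℕ) + 1 = a₀) (hs : (s₁ : ℕ) + 1 = s₀) (ha₀ : a₀ ∈ T)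
    (hZ : Z a₀ = s₀) {t : ℕ × ℕ × ℕ × ℕ}
    (ht : t ≠ (0, 0, 0, 0) ∧ t ≠ (0, 1, 0, 0) ∧ t ≠ (1, 0, 0, 0)) {v : State M →₀ R}
    (hv : v ∈ Finsupp.supported R R (compat (T.erase a₀) Z)) :
    cornerOp T ω a₁ a₀ s₁ s₀ t v = 0 := by
  simp only [cornerOp]
  refine domOp_eq_zero_of_supported (fun x hx a b hab => ?_) hv
  rw [mem_compat_erase ha₀, hZ] at hx
  rcases corner_of_eq ha hs ha₀ hx.2 hab with ⟨h, -⟩ | h | h <;> rw [cornerMono, h, if_neg]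
  · exact ht.1.symm
  · exact ht.2.1.symm
  · exact ht.2.2.symm

theorem cornerOp_merged_mem (ha : (a₁ : ℕ) + 1 = a₀) (hs : (s₁ : ℕ) + 1 = s₀) (ha₀ : a₀ ∈ T)
    (hZ : Z a₀ = s₀) {v : State M →₀ R}
    (hv : v ∈ Finsupp.supported R R (compat (T.erase a₀) Z)) :
    cornerOp T ω a₁ a₀ s₁ s₀ (0, 0, 0, 0) v ∈ Finsupp.supported R R (compat (T.erase a₀) Z) := by
  simp only [cornerOp]
  refine domOp_mem_supported (fun x hx a b hab => ?_) hv
  rw [mem_compat_erase ha₀, hZ] at hx ⊢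
  rcases corner_of_eq ha hs ha₀ hx.2 hab with ⟨h, h', -⟩ | h | h
  · exact Or.inr ⟨compat_swap hx.1 (freeRects_ends hab).1 (freeRects_ends hab).2, h'⟩
  · left; simp [cornerMono, h]
  · left; simp [cornerMono, h]

/-- The states that agree with `Z` off `T` but not on the line `a₀`. -/
def unmerged (T : Finset (Fin M)) (Z : State M) (a₀ : Fin M) : Set (State M) :=
  {x | x ∈ compat T Z ∧ x a₀ ≠ Z a₀}

theorem cornerOp_unmerged_eq_zero (ha : (a₁ : ℕ) + 1 = a₀) (hs : (s₁ : ℕ) + 1 = s₀)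
    (hZ : Z a₀ = s₀) {t : ℕ × ℕ × ℕ × ℕ} (ht : t = (0, 1, 0, 0) ∨ t = (1, 0, 0, 0))
    {v : State M →₀ R} (hv : v ∈ Finsupp.supported R R (unmerged T Z a₀)) :
    cornerOp T ω a₁ a₀ s₁ s₀ t v = 0 := by
  simp only [cornerOp]
  refine domOp_eq_zero_of_supported (fun x hx a b hab => ?_) hv
  have hx2 : x a₀ ≠ s₀ := hZ ▸ hx.2
  rcases corner_of_ne ha hs hx2 hab with ⟨h, -⟩ | ⟨h, -⟩ | ⟨h | h | h | h | h | h, -⟩ <;>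
    rw [cornerMono, h, if_neg] <;>
    rcases ht with rfl | rfl <;> simp

theorem cornerOp_unmerged_mem (ha : (a₁ : ℕ) + 1 = a₀) (hs : (s₁ : ℕ) + 1 = s₀)
    (hZ : Z a₀ = s₀) {t : ℕ × ℕ × ℕ × ℕ} (ht : t ≠ (0, 0, 1, 0) ∧ t ≠ (0, 0, 0, 1))
    {v : State M →₀ R} (hv : v ∈ Finsupp.supported R R (unmerged T Z a₀)) :
    cornerOp T ω a₁ a₀ s₁ s₀ t v ∈ Finsupp.supported R R (unmerged T Z a₀) := by
  simp only [cornerOp]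
  refine domOp_mem_supported (fun x hx a b hab => ?_) hv
  have hx2 : x a₀ ≠ s₀ := hZ ▸ hx.2
  rcases corner_of_ne ha hs hx2 hab with ⟨h, -⟩ | ⟨h, -⟩ | ⟨-, h⟩
  · left; rw [cornerMono, h, if_neg ht.1.symm]
  · left; rw [cornerMono, h, if_neg ht.2.symm]
  · exact Or.inr ⟨compat_swap hx.1 (freeRects_ends hab).1 (freeRects_ends hab).2, hZ.symm ▸ h⟩

theorem cornerOp_unmerged_mem_merged (ha : (a₁ : ℕ) + 1 = a₀) (hs : (s₁ : ℕ) + 1 = s₀)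
    (ha₀ : a₀ ∈ T) (hZ : Z a₀ = s₀) {t : ℕ × ℕ × ℕ × ℕ} (ht : t = (0, 0, 1, 0) ∨ t = (0, 0, 0, 1))
    {v : State M →₀ R} (hv : v ∈ Finsupp.supported R R (unmerged T Z a₀)) :
    cornerOp T ω a₁ a₀ s₁ s₀ t v ∈ Finsupp.supported R R (compat (T.erase a₀) Z) := by
  simp only [cornerOp]
  refine domOp_mem_supported (fun x hx a b hab => ?_) hv
  have hx2 : x a₀ ≠ s₀ := hZ ▸ hx.2
  have hs := compat_swap hx.1 (freeRects_ends hab).1 (freeRects_ends hab).2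
  rw [mem_compat_erase ha₀, hZ]
  rcases corner_of_ne ha ‹_› hx2 hab with ⟨-, h⟩ | ⟨-, h⟩ | ⟨h, -⟩
  · exact Or.inr ⟨hs, h⟩
  · exact Or.inr ⟨hs, h⟩
  · left
    rcases h with h | h | h | h | h | h <;> rw [cornerMono, h] <;> rcases ht with rfl | rfl <;> simp

/-- The weights with `0` in the squares south-west and north-east of a point and factors `σ₁`, `σ₂`
in the squares north-west and south-east of it. -/
def cornerWeights (ω : Fin M → Fin M → R) (a₁ a₀ s₁ s₀ : Fin M) (σ₁ σ₂ : R) :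
    Fin M → Fin M → R := fun c r =>
  ω c r * (spot a₁ s₁ 0 c r * (spot a₀ s₀ 0 c r * (spot a₁ s₀ σ₁ c r * spot a₀ s₁ σ₂ c r)))

theorem mono_cornerWeights (σ₁ σ₂ : R) (m : Fin M → Fin M → ℕ) :
    mono (cornerWeights ω a₁ a₀ s₁ s₀ σ₁ σ₂) m =
      mono ω m * (0 ^ m a₁ s₁ * (0 ^ m a₀ s₀ * (σ₁ ^ m a₁ s₀ * σ₂ ^ m a₀ s₁))) := by
  unfold cornerWeights
  rw [mono_mul, mono_mul, mono_mul, mono_mul, mono_spot, mono_spot, mono_spot, mono_spot]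

theorem mono_cornerWeights_of_corner (σ₁ σ₂ : R) {m : Fin M → Fin M → ℕ} {p q r s : ℕ}
    (h : corner a₁ a₀ s₁ s₀ m = (p, q, r, s)) :
    mono (cornerWeights ω a₁ a₀ s₁ s₀ σ₁ σ₂) m =
      mono ω m * (0 ^ p * (0 ^ q * (σ₁ ^ r * σ₂ ^ s))) := by
  simp only [corner, Prod.mk.injEq] at h
  rw [mono_cornerWeights, h.1, h.2.1, h.2.2.1, h.2.2.2]

/-- The states through the point form a subcomplex: a rectangle that uses the point as a corner
covers one of the two squares of weight zero. Neither `σ₁` nor `σ₂` is felt there. -/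
theorem diff_merged (ha : (a₁ : ℕ) + 1 = a₀) (hs : (s₁ : ℕ) + 1 = s₀) (ha₀ : a₀ ∈ T)
    (hZ : Z a₀ = s₀) (σ₁ σ₂ : R) {v : State M →₀ R}
    (hv : v ∈ Finsupp.supported R R (compat (T.erase a₀) Z)) :
    diff T (cornerWeights ω a₁ a₀ s₁ s₀ σ₁ σ₂) v = cornerOp T ω a₁ a₀ s₁ s₀ (0, 0, 0, 0) v := by
  simp only [cornerOp, diff]
  refine domOp_eq_of_supported (fun x hx a b => ?_) hv
  rw [mem_compat_erase ha₀, hZ] at hx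
  by_cases hab : (a, b) ∈ freeRects T x
  · rw [if_pos hab, if_pos hab]
    rcases corner_of_eq ha hs ha₀ hx.2 hab with ⟨h, -⟩ | h | h <;>
      rw [mono_cornerWeights_of_corner _ _ h] <;> simp [cornerMono, h]
  · rw [if_neg hab, if_neg hab]

/-- Forgetting the frozen point admits new rectangles, but these have it in their interior, hence
cover the square of weight zero north-east of it. -/
theorem diff_erase (ha : (a₁ : ℕ) + 1 = a₀) (hs : (s₁ : ℕ) + 1 = s₀) (ha₀ : a₀ ∈ T)
    (hZ : Z a₀ = s₀) (σ₁ σ₂ : R) {v : State M →₀ R}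
    (hv : v ∈ Finsupp.supported R R (compat (T.erase a₀) Z)) :
    diff (T.erase a₀) (cornerWeights ω a₁ a₀ s₁ s₀ σ₁ σ₂) v =
      diff T (cornerWeights ω a₁ a₀ s₁ s₀ σ₁ σ₂) v := by
  simp only [diff]
  refine domOp_eq_of_supported (fun x hx a b => ?_) hv
  rw [mem_compat_erase ha₀, hZ] at hx
  by_cases hab : (a, b) ∈ freeRects T x
  · rw [if_pos hab]
    rcases corner_of_eq ha hs ha₀ hx.2 hab with ⟨-, -, h1, h2⟩ | h | h
    · rw [if_pos]
      rw [mem_freeRects] at hab ⊢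
      exact ⟨Finset.mem_erase.2 ⟨h1, hab.1⟩, Finset.mem_erase.2 ⟨h2, hab.2.1⟩, hab.2.2.1,
        fun c hc => hab.2.2.2 c (Finset.mem_of_mem_erase hc)⟩
    · rw [mono_cornerWeights_of_corner _ _ h]; simp
    · rw [mono_cornerWeights_of_corner _ _ h]; simp
  · rw [if_neg hab]
    by_cases hab' : (a, b) ∈ freeRects (T.erase a₀) x
    · rw [if_pos hab', mono_cornerWeights]
      have : box a b (x a) (x b) a₀ s₀ ≠ 0 := by
        intro h0
        refine hab ?_
        rw [mem_freeRects] at hab' ⊢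
        refine ⟨Finset.mem_of_mem_erase hab'.1, Finset.mem_of_mem_erase hab'.2.1, hab'.2.2.1,
          fun c hc hca => ?_⟩
        by_cases hc0 : c = a₀
        · rw [hc0, hx.2, h0]
        · exact hab'.2.2.2 c (Finset.mem_erase.2 ⟨hc0, hc⟩) hca
      rw [zero_pow this]; simp
    · rw [if_neg hab']

theorem domOp_add (θ₁ θ₂ : (Fin M → Fin M → ℕ) → R) :
    domOp T (fun m => θ₁ m + θ₂ m) = domOp T θ₁ + domOp T θ₂ := by
  refine Finsupp.lhom_ext' fun x => LinearMap.ext_ring ?_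
  simp only [domOp, LinearMap.comp_apply, Finsupp.lsingle_apply, LinearMap.add_apply, rectOp_single,
    Finsupp.single_add, Finset.sum_add_distrib]

theorem domOp_smul (k : R) (θ : (Fin M → Fin M → ℕ) → R) :
    domOp T (fun m => k * θ m) = k • domOp T θ := by
  refine Finsupp.lhom_ext' fun x => LinearMap.ext_ring ?_
  simp only [domOp, LinearMap.comp_apply, Finsupp.lsingle_apply, LinearMap.smul_apply,
    rectOp_single,
    Finset.smul_sum, Finsupp.smul_single, smul_eq_mul]

/-- Only the patterns that avoid both squares of weight zero survive. The terms with `σ₁` and `σ₂`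
are those that lead into the subcomplex. -/
theorem diff_unmerged (ha : (a₁ : ℕ) + 1 = a₀) (hs : (s₁ : ℕ) + 1 = s₀)
    (hZ : Z a₀ = s₀) (σ₁ σ₂ : R) {v : State M →₀ R}
    (hv : v ∈ Finsupp.supported R R (unmerged T Z a₀)) :
    diff T (cornerWeights ω a₁ a₀ s₁ s₀ σ₁ σ₂) v = cornerOp T ω a₁ a₀ s₁ s₀ (0, 0, 0, 0) v +
      σ₁ • cornerOp T ω a₁ a₀ s₁ s₀ (0, 0, 1, 0) v +
      σ₂ • cornerOp T ω a₁ a₀ s₁ s₀ (0, 0, 0, 1) v := by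
  simp only [cornerOp, diff, ← LinearMap.smul_apply, ← LinearMap.add_apply, ← domOp_smul,
    ← domOp_add]
  refine domOp_eq_of_supported (fun x hx a b => ?_) hv
  have hx2 : x a₀ ≠ s₀ := hZ ▸ hx.2
  by_cases hab : (a, b) ∈ freeRects T x
  · rw [if_pos hab, if_pos hab]
    rcases corner_of_ne ha hs hx2 hab with ⟨h, -⟩ | ⟨h, -⟩ | ⟨h | h | h | h | h | h, -⟩ <;>
      rw [mono_cornerWeights_of_corner _ _ h] <;> simp [cornerMono, h, mul_comm]
  · rw [if_neg hab, if_neg hab]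

variable [CharP R 2]

/-- `K` collects the annuli of type `u + v`. All compatible states occupy the same rows as `Z` over
`T`, so it is one scalar. -/
theorem cornerOp_commutator {u v : ℕ × ℕ × ℕ × ℕ}
    (huv : (u, v) ∈ ({((0, 1, 0, 0), (0, 0, 1, 0)), ((0, 1, 0, 0), (0, 0, 0, 1)),
      ((1, 0, 0, 0), (0, 0, 1, 0)), ((1, 0, 0, 0), (0, 0, 0, 1))} : Set _))
    {K : R}
    (hK : (∑ r ∈ colStrips T,
        cornerMono ω a₁ a₀ s₁ s₀ (u + v) (fun c _ => arcInd r.1 r.2 c)) +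
      (∑ r ∈ colStrips (T.image Z),
        cornerMono ω a₁ a₀ s₁ s₀ (u + v) (fun _ r' => arcInd r.1 r.2 r'))
        = K)
    {w : State M →₀ R} (hw : w ∈ Finsupp.supported R R (compat T Z)) :
    cornerOp T ω a₁ a₀ s₁ s₀ v (cornerOp T ω a₁ a₀ s₁ s₀ u w) +
      cornerOp T ω a₁ a₀ s₁ s₀ u (cornerOp T ω a₁ a₀ s₁ s₀ v w) +
      (cornerOp T ω a₁ a₀ s₁ s₀ (u + v) (cornerOp T ω a₁ a₀ s₁ s₀ (0, 0, 0, 0) w) +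
        cornerOp T ω a₁ a₀ s₁ s₀ (0, 0, 0, 0) (cornerOp T ω a₁ a₀ s₁ s₀ (u + v) w)) = K • w := by
  set op := cornerOp T ω a₁ a₀ s₁ s₀ with hop
  refine linearMap_eq_of_supported
    (f := (op v).comp (op u) + (op u).comp (op v) + ((op (u + v)).comp (op (0, 0, 0, 0)) +
      (op (0, 0, 0, 0)).comp (op (u + v)))) (g := K • LinearMap.id) (fun x hx => ?_) hw
  have h := domOp_domOp_add T (corner_products (a₁ := a₁) (a₀ := a₀) (s₁ := s₁) (s₀ := s₀)
    (ω := ω) huv) x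
  rw [image_compat hx] at h
  simp only [LinearMap.add_apply, LinearMap.comp_apply, LinearMap.smul_apply, LinearMap.id_apply]
  rw [← hK]
  exact h

/-- The data from which one builds chain maps when the point of the states on the line `a₀` is
frozen. -/
theorem exists_merge (ha : (a₁ : ℕ) + 1 = a₀) (hs : (s₁ : ℕ) + 1 = s₀) (ha₀ : a₀ ∈ T)
    (hZ : Z a₀ = s₀) {aL aR sL sR : Fin M} (hL : (aL, a₀) ∈ colStrips T)
    (hR : (a₀, aR) ∈ colStrips T) (hsL : (sL, s₀) ∈ colStrips (T.image Z))
    (hsR : (s₀, sR) ∈ colStrips (T.image Z)) (σ₁ σ₂ : R) {c w : State M →₀ R}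
    (hc : c ∈ Finsupp.supported R R (compat T Z))
    (hw : w ∈ Finsupp.supported R R (compat (T.erase a₀) Z))
    (hcw : diff T (cornerWeights ω a₁ a₀ s₁ s₀ σ₁ σ₂) c = w) :
    ∃ d ∈ Finsupp.supported R R (compat (T.erase a₀) Z),
    ∃ e ∈ Finsupp.supported R R (compat (T.erase a₀) Z),
    ∃ f ∈ Finsupp.supported R R (compat (T.erase a₀) Z),
    ∃ g ∈ Finsupp.supported R R (compat (T.erase a₀) Z),
    ∃ h ∈ Finsupp.supported R R (compat (T.erase a₀) Z),
      diff (T.erase a₀) (cornerWeights ω a₁ a₀ s₁ s₀ σ₁ σ₂) d + σ₁ • e + σ₂ • f = w ∧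
      diff (T.erase a₀) (cornerWeights ω a₁ a₀ s₁ s₀ σ₁ σ₂) f = 0 ∧
      diff (T.erase a₀) (cornerWeights ω a₁ a₀ s₁ s₀ σ₁ σ₂) g =
        colMono ω aL a₀ • f + rowMono ω sL s₀ • e ∧
      diff (T.erase a₀) (cornerWeights ω a₁ a₀ s₁ s₀ σ₁ σ₂) h =
        colMono ω a₀ aR • e + rowMono ω s₀ sR • f := by
  classical
  set op := cornerOp T ω a₁ a₀ s₁ s₀ with hop
  set D := diff (T.erase a₀) (cornerWeights ω a₁ a₀ s₁ s₀ σ₁ σ₂) with hD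
  have hD0 : ∀ v ∈ Finsupp.supported R R (compat (T.erase a₀) Z), D v = op (0, 0, 0, 0) v :=
    fun v hv => by rw [hD, diff_erase ha hs ha₀ hZ _ _ hv, diff_merged ha hs ha₀ hZ _ _ hv]
  set d := c.filter (fun x => x a₀ = Z a₀) with hd
  set n := c.filter (fun x => ¬ x a₀ = Z a₀) with hn
  have hdn : d + n = c := Finsupp.filter_add_filter_not _ _
  have hdm : d ∈ Finsupp.supported R R (compat (T.erase a₀) Z) := by
    intro x hx
    rw [hd, Finsupp.support_filter, Finset.coe_filter] at hx
    exact (mem_compat_erase ha₀).2 ⟨hc hx.1, hx.2⟩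
  have hnm : n ∈ Finsupp.supported R R (unmerged T Z a₀) := by
    intro x hx
    rw [hn, Finsupp.support_filter, Finset.coe_filter] at hx
    exact ⟨hc hx.1, hx.2⟩
  have sub1 : Finsupp.supported R R (unmerged T Z a₀) ≤ Finsupp.supported R R (compat T Z) :=
    Finsupp.supported_mono fun x hx => hx.1
  have sub2 : Finsupp.supported R R (compat (T.erase a₀) Z) ≤ Finsupp.supported R R (compat T Z) :=
    Finsupp.supported_mono fun x hx => ((mem_compat_erase ha₀).1 hx).1
  -- The scalars are the four strips adjoining the point, in this order: above, right, left, below.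
  have k1 : ∀ v ∈ Finsupp.supported R R (compat T Z), _ := fun v hv =>
    cornerOp_commutator (T := T) (Z := Z) (a₁ := a₁) (a₀ := a₀) (s₁ := s₁) (s₀ := s₀) (ω := ω)
      (u := (0, 1, 0, 0)) (v := (0, 0, 1, 0)) (by simp) (K := rowMono ω s₀ sR) (by
        rw [Finset.sum_eq_zero (s := colStrips T), zero_add]
        · rw [← sum_corner_zero_one hs hsR (rowMono ω)]
          refine Finset.sum_congr rfl fun r _ => if_congr ?_ rfl rfl
          rw [corner_row]; simp; tauto
        · intro r _; rw [cornerMono, corner_col]; simp; omega) hv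
  have k2 : ∀ v ∈ Finsupp.supported R R (compat T Z), _ := fun v hv =>
    cornerOp_commutator (T := T) (Z := Z) (a₁ := a₁) (a₀ := a₀) (s₁ := s₁) (s₀ := s₀) (ω := ω)
      (u := (0, 1, 0, 0)) (v := (0, 0, 0, 1)) (by simp) (K := colMono ω a₀ aR) (by
        rw [Finset.sum_eq_zero (s := colStrips (T.image Z)), add_zero]
        · rw [← sum_corner_zero_one ha hR (colMono ω)]
          refine Finset.sum_congr rfl fun r _ => if_congr ?_ rfl rfl
          rw [corner_col]; simp; tauto
        · intro r _; rw [cornerMono, corner_row]; simp; omega) hv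
  have k3 : ∀ v ∈ Finsupp.supported R R (compat T Z), _ := fun v hv =>
    cornerOp_commutator (T := T) (Z := Z) (a₁ := a₁) (a₀ := a₀) (s₁ := s₁) (s₀ := s₀) (ω := ω)
      (u := (1, 0, 0, 0)) (v := (0, 0, 1, 0)) (by simp) (K := colMono ω aL a₀) (by
        rw [Finset.sum_eq_zero (s := colStrips (T.image Z)), add_zero]
        · rw [← sum_corner_one_zero ha hL (colMono ω)]
          refine Finset.sum_congr rfl fun r _ => if_congr ?_ rfl rfl
          rw [corner_col]; simp; tauto
        · intro r _; rw [cornerMono, corner_row]; simp; omega) hv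
  have k4 : ∀ v ∈ Finsupp.supported R R (compat T Z), _ := fun v hv =>
    cornerOp_commutator (T := T) (Z := Z) (a₁ := a₁) (a₀ := a₀) (s₁ := s₁) (s₀ := s₀) (ω := ω)
      (u := (1, 0, 0, 0)) (v := (0, 0, 0, 1)) (by simp) (K := rowMono ω sL s₀) (by
        rw [Finset.sum_eq_zero (s := colStrips T), zero_add]
        · rw [← sum_corner_one_zero hs hsL (rowMono ω)]
          refine Finset.sum_congr rfl fun r _ => if_congr ?_ rfl rfl
          rw [corner_row]; simp; tauto
        · intro r _; rw [cornerMono, corner_col]; simp; omega) hv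
  rw [← hop] at k1 k2 k3 k4
  simp only [Prod.mk_add_mk, add_zero, zero_add] at k1 k2 k3 k4
  have toMerged : ∀ t, t = (0, 0, 1, 0) ∨ t = (0, 0, 0, 1) →
      ∀ v ∈ Finsupp.supported R R (unmerged T Z a₀),
      op t v ∈ Finsupp.supported R R (compat (T.erase a₀) Z) := fun t ht v hv =>
    cornerOp_unmerged_mem_merged ha hs ha₀ hZ ht hv
  have mergedZero : ∀ t, t ≠ (0, 0, 0, 0) ∧ t ≠ (0, 1, 0, 0) ∧ t ≠ (1, 0, 0, 0) →
      ∀ v ∈ Finsupp.supported R R (compat (T.erase a₀) Z), op t v = 0 := fun t ht v hv =>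
    cornerOp_merged_eq_zero ha hs ha₀ hZ ht hv
  have unmergedZero : ∀ t, t = (0, 1, 0, 0) ∨ t = (1, 0, 0, 0) →
      ∀ v ∈ Finsupp.supported R R (unmerged T Z a₀), op t v = 0 := fun t ht v hv =>
    cornerOp_unmerged_eq_zero ha hs hZ ht hv
  have stay : ∀ v ∈ Finsupp.supported R R (compat (T.erase a₀) Z),
      op (0, 0, 0, 0) v ∈ Finsupp.supported R R (compat (T.erase a₀) Z) := fun v hv =>
    cornerOp_merged_mem ha hs ha₀ hZ hv
  have comm : ∀ t, t = (0, 0, 1, 0) ∨ t = (0, 0, 0, 1) → ∀ v,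
      op (0, 0, 0, 0) (op t v) = op t (op (0, 0, 0, 0) v) := fun t ht v =>
    cornerOp_comm (by simpa using ht) v
  have hf := toMerged _ (Or.inr rfl) n hnm
  have he := toMerged _ (Or.inl rfl) n hnm
  have hg : op (1, 0, 0, 1) n ∈ Finsupp.supported R R (unmerged T Z a₀) :=
    cornerOp_unmerged_mem ha hs hZ (by simp) hnm
  have hh : op (0, 1, 1, 0) n ∈ Finsupp.supported R R (unmerged T Z a₀) :=
    cornerOp_unmerged_mem ha hs hZ (by simp) hnm
  have hsum : op (0, 0, 0, 0) n + (D d + σ₁ • op (0, 0, 1, 0) n + σ₂ • op (0, 0, 0, 1) n + w) = 0 :=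
    by
    rw [← hcw, ← hdn, map_add, diff_unmerged ha hs hZ _ _ hnm, hD, diff_erase ha hs ha₀ hZ _ _ hdm]
    exact Eq.trans (by abel) (chain_add_self (diff T (cornerWeights ω a₁ a₀ s₁ s₀ σ₁ σ₂) d +
      op (0, 0, 0, 0) n + σ₁ • op (0, 0, 1, 0) n + σ₂ • op (0, 0, 0, 1) n))
  -- This chain is supported off the point, whereas `hsum` expresses it by chains supported on
  -- states through the point.
  have hn0 : op (0, 0, 0, 0) n = 0 := by
    have hdisj : Disjoint (Finsupp.supported R R (unmerged T Z a₀))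
        (Finsupp.supported R R (compat (T.erase a₀) Z)) := by
      refine Finsupp.disjoint_supported_supported (Set.disjoint_left.2 fun x hx hx' => ?_)
      exact hx.2 ((mem_compat_erase ha₀).1 hx').2
    refine (Submodule.disjoint_def.1 hdisj) _ (cornerOp_unmerged_mem ha hs hZ (by simp) hnm) ?_
    rw [chain_eq_of_add hsum]
    refine add_mem (add_mem (add_mem ?_ (Submodule.smul_mem _ _ he)) (Submodule.smul_mem _ _ hf)) hw
    rw [hD0 d hdm]
    exact cornerOp_merged_mem ha hs ha₀ hZ hdm
  have hEg := toMerged _ (Or.inl rfl) _ hg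
  have hFh := toMerged _ (Or.inr rfl) _ hh
  -- `e` and `f` are the north-west and south-east parts of the differential of `n`. `g` and `h`
  -- apply to `n` the operators of the same type as the annuli below and above the point, and then
  -- return to the point.
  refine ⟨d, hdm, _, he, _, hf, _, hEg, _, hFh, ?_, ?_, ?_, ?_⟩
  · rw [hn0, zero_add] at hsum
    exact chain_eq_of_add hsum
  · rw [hD0 _ hf, comm _ (Or.inr rfl), hn0, map_zero]
  · rw [hD0 _ hEg, comm _ (Or.inl rfl)]
    have h4 := k4 n (sub1 hnm)
    rw [unmergedZero _ (Or.inr rfl) n hnm, hn0, map_zero, map_zero, zero_add, zero_add] at h4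
    have h3 := k3 _ (sub2 hf)
    rw [mergedZero (0, 0, 1, 0) (by simp) _ hf, mergedZero (1, 0, 1, 0) (by simp) _ (stay _ hf),
      mergedZero (1, 0, 1, 0) (by simp) _ hf, map_zero, map_zero, add_zero, add_zero,
        add_zero] at h3
    rw [← h3, ← map_smul, ← h4, ← map_add, ← add_assoc, chain_add_self, zero_add]
  · rw [hD0 _ hFh, comm _ (Or.inr rfl)]
    have h4 := k1 n (sub1 hnm)
    rw [unmergedZero _ (Or.inl rfl) n hnm, hn0, map_zero, map_zero, zero_add, zero_add] at h4
    have h3 := k2 _ (sub2 he)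
    rw [mergedZero (0, 0, 0, 1) (by simp) _ he, mergedZero (0, 1, 0, 1) (by simp) _ (stay _ he),
      mergedZero (0, 1, 0, 1) (by simp) _ he, map_zero, map_zero, add_zero, add_zero,
        add_zero] at h3
    rw [← h3, ← map_smul, ← h4, ← map_add, ← add_assoc, chain_add_self, zero_add]

end Merge

end Grid

namespace Grid

/-! ### Consequences of merging -/

section Scale

variable {M : ℕ} {R : Type*} [CommRing R] [CharP R 2]
  {T : Finset (Fin M)} {Z : State M} {a₁ a₀ s₁ s₀ : Fin M} {ω : Fin M → Fin M → R}

/-- Freezing the point on the line `a₀` multiplies a boundary by `κ`. -/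
theorem exists_merge_scale (ha : (a₁ : ℕ) + 1 = a₀) (hs : (s₁ : ℕ) + 1 = s₀) (ha₀ : a₀ ∈ T)
    (hZ : Z a₀ = s₀) {aL aR sL sR : Fin M} (hL : (aL, a₀) ∈ colStrips T)
    (hR : (a₀, aR) ∈ colStrips T) (hsL : (sL, s₀) ∈ colStrips (T.image Z))
    (hsR : (s₀, sR) ∈ colStrips (T.image Z)) {σ₁ σ₂ l₁ l₂ κ : R}
    (h₁ : l₁ * rowMono ω sL s₀ + l₂ * colMono ω a₀ aR = κ * σ₁)
    (h₂ : l₁ * colMono ω aL a₀ + l₂ * rowMono ω s₀ sR = κ * σ₂) {c w : State M →₀ R}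
    (hc : c ∈ Finsupp.supported R R (compat T Z))
    (hw : w ∈ Finsupp.supported R R (compat (T.erase a₀) Z))
    (hcw : diff T (cornerWeights ω a₁ a₀ s₁ s₀ σ₁ σ₂) c = w) :
    ∃ c' ∈ Finsupp.supported R R (compat (T.erase a₀) Z),
      diff (T.erase a₀) (cornerWeights ω a₁ a₀ s₁ s₀ σ₁ σ₂) c' = κ • w := by
  obtain ⟨d, hd, e, he, f, hf, g, hg, h, hh, k1, k2, k3, k4⟩ :=
    exists_merge ha hs ha₀ hZ hL hR hsL hsR σ₁ σ₂ hc hw hcw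
  -- The hypotheses `h₁` and `h₂` give `e` and `f` the coefficients that they have in `κ • w`.
  refine ⟨κ • d + l₁ • g + l₂ • h, add_mem (add_mem (Submodule.smul_mem _ _ hd)
    (Submodule.smul_mem _ _ hg)) (Submodule.smul_mem _ _ hh), ?_⟩
  rw [map_add, map_add, map_smul, map_smul, map_smul, k3, k4, ← k1]
  simp only [smul_add, smul_smul, ← h₁, ← h₂, add_smul]
  abel

end Scale

/-! ### Reindexing -/

/-- An embedding of the lines of a small grid into those of a large one, in which each square of the
small grid becomes a rectangle of squares of the large one. The states of the small grid become
states that agree with `Z` off the image. -/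
structure LineEmbedding (n M : ℕ) where
  col : Fin n ↪ Fin M
  row : Fin n ↪ Fin M
  colCell : Fin M → Fin n
  rowCell : Fin M → Fin n
  colCell_col : ∀ c, colCell (col c) = c
  rowCell_row : ∀ c, rowCell (row c) = c
  inArc_col : ∀ a b k, InArc (col a) (col b) k ↔ InArc a b (colCell k)
  inArc_row : ∀ a b k, InArc (row a) (row b) k ↔ InArc a b (rowCell k)
  Z : State M
  z : State n
  Z_col : ∀ c, Z (col c) = row (z c)

namespace LineEmbedding

variable {n M : ℕ} (L : LineEmbedding n M)

/-- The image of the lines. -/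
def lines : Finset (Fin M) := Finset.univ.map L.col

theorem mem_lines {m : Fin M} : m ∈ L.lines ↔ ∃ c, L.col c = m := by
  simp [lines]

theorem col_mem (c : Fin n) : L.col c ∈ L.lines := L.mem_lines.2 ⟨c, rfl⟩

/-- The image of a state. -/
noncomputable def state (y : State n) : State M :=
  Equiv.Perm.viaEmbedding (y * L.z⁻¹) L.row * L.Z

theorem state_col (y : State n) (c : Fin n) : L.state y (L.col c) = L.row (y c) := by
  rw [state, Equiv.Perm.mul_apply, L.Z_col, Equiv.Perm.viaEmbedding_apply, Equiv.Perm.mul_apply]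
  rw [show L.z⁻¹ (L.z c) = c from L.z.symm_apply_apply c]

theorem state_of_notMem (y : State n) {m : Fin M} (hm : m ∉ L.lines) : L.state y m = L.Z m := by
  rw [state, Equiv.Perm.mul_apply, Equiv.Perm.viaEmbedding_apply_of_notMem]
  rintro ⟨r, hr⟩
  refine hm (L.mem_lines.2 ⟨L.z⁻¹ r, L.Z.injective ?_⟩)
  rw [L.Z_col, show L.z (L.z⁻¹ r) = r from L.z.apply_symm_apply r, hr]

theorem eq_state_iff {x : State M} {y : State n} :
    x = L.state y ↔ x ∈ compat L.lines L.Z ∧ ∀ c, x (L.col c) = L.row (y c) := by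
  constructor
  · rintro rfl
    exact ⟨fun m hm => L.state_of_notMem y hm, L.state_col y⟩
  · rintro ⟨h1, h2⟩
    ext m
    by_cases hm : m ∈ L.lines
    · obtain ⟨c, rfl⟩ := L.mem_lines.1 hm
      rw [h2, L.state_col]
    · rw [h1 m hm, L.state_of_notMem y hm]

theorem state_mem_compat (y : State n) : L.state y ∈ compat L.lines L.Z :=
  fun _ hm => L.state_of_notMem y hm

theorem state_injective : Function.Injective L.state := by
  intro y y' h
  ext c
  rw [L.row.injective ((L.state_col y c).symm.trans ((DFunLike.congr_fun h _).trans
    (L.state_col y' c)))]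

/-- Over the lines of the embedding a compatible state occupies the same rows as `Z`, and by `Z_col`
these are rows of the embedding. -/
theorem exists_state {x : State M} (hx : x ∈ compat L.lines L.Z) : ∃ y, L.state y = x := by
  have h1 : ∀ c, ∃ r, L.row r = x (L.col c) := by
    intro c
    have : x (L.col c) ∈ L.lines.image x := Finset.mem_image_of_mem _ (L.col_mem c)
    rw [image_compat hx] at this
    obtain ⟨m, hm, h⟩ := Finset.mem_image.1 this
    obtain ⟨d, rfl⟩ := L.mem_lines.1 hm
    exact ⟨L.z d, by rw [← L.Z_col, h]⟩
  choose f hf using h1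
  have hinj : Function.Injective f := by
    intro c d h
    have := congrArg L.row h
    rw [hf, hf] at this
    exact L.col.injective (x.injective this)
  exact ⟨Equiv.ofBijective f hinj.bijective_of_finite, (L.eq_state_iff.2 ⟨hx, fun c =>
    (hf c).symm⟩).symm⟩

theorem state_swap (y : State n) (a b : Fin n) :
    L.state (y * Equiv.swap a b) = L.state y * Equiv.swap (L.col a) (L.col b) := by
  refine (L.eq_state_iff.2 ⟨compat_swap (L.state_mem_compat y) (L.col_mem a) (L.col_mem b),
    fun c => ?_⟩).symm
  rw [Equiv.Perm.mul_apply, Equiv.Perm.mul_apply,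
    L.col.injective.swap_apply, L.state_col]

variable {R : Type*} [CommRing R]

/-- The weights of the small grid. -/
def weights (ω : Fin M → Fin M → R) (c r : Fin n) : R :=
  ∏ k ∈ Finset.univ.filter (fun k => L.colCell k = c),
    ∏ l ∈ Finset.univ.filter (fun l => L.rowCell l = r), ω k l

theorem box_col (a b i k : Fin n) (c r : Fin M) :
    box (L.col a) (L.col b) (L.row i) (L.row k) c r = box a b i k (L.colCell c) (L.rowCell r) := by
  simp only [box, arcInd, L.inArc_col, L.inArc_row]

/-- A multiplicity pulled back from the small grid is constant on the large squares that make up one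
small square, so their weights multiply. -/
theorem mono_weights (ω : Fin M → Fin M → R) (m : Fin n → Fin n → ℕ) :
    mono ω (fun c r => m (L.colCell c) (L.rowCell r)) = mono (L.weights ω) m := by
  unfold mono weights
  rw [← Finset.prod_fiberwise Finset.univ L.colCell
    (fun c => ∏ r, ω c r ^ m (L.colCell c) (L.rowCell r))]
  refine Finset.prod_congr rfl fun c _ => ?_
  simp only [← Finset.prod_pow]
  rw [Finset.prod_comm (s := (Finset.univ : Finset (Fin n)))]
  refine Finset.prod_congr rfl fun k hk => ?_
  rw [← Finset.prod_fiberwise Finset.univ L.rowCell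
    (fun r => ω k r ^ m (L.colCell k) (L.rowCell r))]
  refine Finset.prod_congr rfl fun r _ => Finset.prod_congr rfl fun l hl => ?_
  rw [(Finset.mem_filter.1 hk).2, (Finset.mem_filter.1 hl).2]

theorem mem_freeRects_state {y : State n} {a b : Fin n} :
    (L.col a, L.col b) ∈ freeRects L.lines (L.state y) ↔ (a, b) ∈ freeRects Finset.univ y := by
  rw [mem_freeRects, mem_freeRects]
  simp only [L.state_col, L.box_col, L.col_mem, true_and, Finset.mem_univ]
  refine and_congr L.col.injective.ne_iff ⟨fun h c _ hc => ?_, fun h m hm hma => ?_⟩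
  · have := h (L.col c) (L.col_mem c) (L.col.injective.ne hc)
    rwa [L.state_col, L.colCell_col, L.rowCell_row] at this
  · obtain ⟨c, rfl⟩ := L.mem_lines.1 hm
    rw [L.state_col, L.colCell_col, L.rowCell_row]
    exact h c trivial fun h => hma (by rw [h])

theorem diff_mapDomain (ω : Fin M → Fin M → R) (f : State n →₀ R) :
    diff L.lines ω (Finsupp.lmapDomain R R L.state f) =
      Finsupp.lmapDomain R R L.state (diff Finset.univ (L.weights ω) f) := by
  rw [← LinearMap.comp_apply, ← LinearMap.comp_apply]
  refine LinearMap.congr_fun (Finsupp.lhom_ext' fun y => LinearMap.ext_ring ?_) f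
  simp only [LinearMap.comp_apply, Finsupp.lsingle_apply, Finsupp.lmapDomain_apply,
    Finsupp.mapDomain_single, diff, domOp, rectOp_single]
  rw [← Finsupp.lmapDomain_apply R R, map_sum]
  refine (Finset.sum_bij (fun r _ => (L.col r.1, L.col r.2)) ?_ ?_ ?_ ?_).symm
  · rintro ⟨a, b⟩ h
    exact L.mem_freeRects_state.2 h
  · rintro ⟨a, b⟩ _ ⟨a', b'⟩ _ h
    simpa using h
  · rintro ⟨A, B⟩ h
    obtain ⟨a, rfl⟩ := L.mem_lines.1 (freeRects_ends h).1
    obtain ⟨b, rfl⟩ := L.mem_lines.1 (freeRects_ends h).2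
    exact ⟨(a, b), L.mem_freeRects_state.1 h, rfl⟩
  · rintro ⟨a, b⟩ h
    simp only [Finsupp.lmapDomain_apply, Finsupp.mapDomain_single, L.state_swap, L.state_col]
    congr 1
    rw [← L.mono_weights]
    congr 1
    funext c r
    exact (L.box_col _ _ _ _ _ _).symm

/-- The small complex is identified with the chains on compatible states, so a bounding chain may be
sought on either side. -/
theorem exists_diff_iff (ω : Fin M → Fin M → R) (w : State n →₀ R) :
    (∃ c, diff Finset.univ (L.weights ω) c = w) ↔
      ∃ c ∈ Finsupp.supported R R (compat L.lines L.Z),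
        diff L.lines ω c = Finsupp.lmapDomain R R L.state w := by
  constructor
  · rintro ⟨c, rfl⟩
    refine ⟨Finsupp.lmapDomain R R L.state c, ?_, L.diff_mapDomain ω c⟩
    refine linearMap_mem_of_supported (S := Set.univ) (fun y _ => ?_) (by simp)
    rw [Finsupp.lmapDomain_apply, Finsupp.mapDomain_single]
    exact Finsupp.single_mem_supported _ _ (L.state_mem_compat y)
  · rintro ⟨c, hc, h⟩
    have : c ∈ LinearMap.range (Finsupp.lmapDomain R R L.state) := by
      rw [Finsupp.range_lmapDomain]
      refine linearMap_mem_of_supported (f := LinearMap.id) (fun x hx => ?_) hc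
      obtain ⟨y, rfl⟩ := L.exists_state hx
      exact Submodule.subset_span ⟨y, rfl⟩
    obtain ⟨d, rfl⟩ := this
    rw [L.diff_mapDomain] at h
    exact ⟨d, Finsupp.mapDomain_injective L.state_injective h⟩

end LineEmbedding

end Grid

namespace Grid

/-! ### Change of coefficients, and the invariants as a question about boundaries -/

section BaseChange

variable {M : ℕ} {R S : Type*} [CommRing R] [CommRing S]

theorem mono_map (f : R →+* S) (ω : Fin M → Fin M → R) (m : Fin M → Fin M → ℕ) :
    mono (fun c r => f (ω c r)) m = f (mono ω m) := by
  simp [mono, map_prod]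

theorem diff_single (T : Finset (Fin M)) (ω : Fin M → Fin M → R) (x : State M) (k : R) :
    diff T ω (Finsupp.single x k) = ∑ r ∈ freeRects T x,
      Finsupp.single (x * Equiv.swap r.1 r.2) (k * mono ω (box r.1 r.2 (x r.1) (x r.2))) := by
  rw [diff, domOp, rectOp, Finsupp.linearCombination_single, Finset.smul_sum]
  simp

theorem diff_mapRange (f : R →+* S) (T : Finset (Fin M)) (ω : Fin M → Fin M → R)
    (v : State M →₀ R) : diff T (fun c r => f (ω c r))
      (Finsupp.mapRange.addMonoidHom f.toAddMonoidHom v) =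
      Finsupp.mapRange.addMonoidHom f.toAddMonoidHom (diff T ω v) := by
  induction v using Finsupp.induction_linear with
  | zero => simp
  | add u v hu hv => rw [map_add, map_add, hu, hv, map_add, map_add]
  | single x k =>
    rw [diff_single, map_sum]
    simp only [Finsupp.mapRange.addMonoidHom_apply, Finsupp.mapRange_single]
    rw [diff_single]
    refine Finset.sum_congr rfl fun r _ => ?_
    simp [mono_map]

end BaseChange

variable {n : ℕ} {R : Type*} [CommRing R]

/-- The weights of the squares of a grid diagram. -/
def gridWeights (G : Grid n) (V : Fin n → R) (c r : Fin n) : R :=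
  if r = G.X c then 0 else if r = G.O c then V c else 1

theorem mono_gridWeights_eq_zero (G : Grid n) (V : Fin n → R) {m : Fin n → Fin n → ℕ} {c : Fin n}
    (h : m c (G.X c) ≠ 0) : mono (G.gridWeights V) m = 0 :=
  mono_eq_zero (by simp [gridWeights]) h

theorem mono_gridWeights (G : Grid n) (V : Fin n → R) {m : Fin n → Fin n → ℕ}
    (h : ∀ c, m c (G.X c) = 0) : mono (G.gridWeights V) m = ∏ c, V c ^ m c (G.O c) := by
  refine Finset.prod_congr rfl fun c _ => ?_
  rw [Finset.prod_eq_single (G.O c)]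
  · simp [gridWeights, (G.disjoint c).symm]
  · intro r _ hr
    by_cases hX : r = G.X c
    · rw [hX, h c, pow_zero]
    · simp [gridWeights, hX, hr]
  · simp

/-- Giving the `X`s weight `0` has the same effect as excluding the rectangles that contain them.
The grid complex thus becomes an instance of the weighted one. -/
theorem boundary_eq_diff (G : Grid n) :
    G.boundary = diff Finset.univ (G.gridWeights (MvPolynomial.X : Fin n → Coeff n)) := by
  refine Finsupp.lhom_ext' fun x => LinearMap.ext_ring ?_
  simp only [boundary, LinearMap.comp_apply, Finsupp.lsingle_apply, diff, domOp, rectOp_single,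
    Finsupp.linearCombination_single, one_smul]
  rw [← Finset.sum_filter_add_sum_filter_not (freeRects Finset.univ x)
    (fun r => ∀ c, ¬ InRect x r.1 r.2 c (G.X c))]
  rw [Finset.sum_eq_zero (s := (freeRects Finset.univ x).filter
    (fun r => ¬ ∀ c, ¬ InRect x r.1 r.2 c (G.X c))), add_zero]
  · have he : G.rectangles x = (freeRects Finset.univ x).filter
        (fun r => ∀ c, ¬ InRect x r.1 r.2 c (G.X c)) := by
      ext ⟨a, b⟩
      rw [rectangles, Finset.mem_filter, Finset.mem_filter, mem_freeRects]
      simp only [IsEmptyRect, Finset.mem_univ, true_and, box_eq_zero, and_assoc, forall_const]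
    rw [he]
    refine Finset.sum_congr rfl fun r hr => ?_
    have hX := (Finset.mem_filter.1 hr).2
    rw [mono_gridWeights]
    · congr 1
      rw [weight, Finset.prod_filter]
      refine Finset.prod_congr rfl fun c _ => ?_
      simp only [box, arcInd, InRect, ite_zero_mul_ite_zero, mul_one, pow_ite, pow_one, pow_zero]
      exact if_congr Iff.rfl rfl rfl
    · exact fun c => box_eq_zero.2 (hX c)
  · intro r hr
    have hX := (Finset.mem_filter.1 hr).2
    push Not at hX
    obtain ⟨c, hc⟩ := hX
    rw [mono_gridWeights_eq_zero (c := c), Finsupp.single_zero]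
    rw [Ne, box_eq_zero, not_not]
    exact hc

/-- The cycle `x⁺ + x⁻`. -/
noncomputable def etaChain (G : Grid n) (R : Type*) [CommRing R] : State n →₀ R :=
  Finsupp.single G.statePlus 1 + Finsupp.single G.stateMinus 1

/-- The cycle `x⁺ + x⁻` is a boundary for the values `V` of the variables. -/
def NullOver (G : Grid n) {R : Type*} [CommRing R] (V : Fin n → R) : Prop :=
  ∃ c, diff Finset.univ (G.gridWeights V) c = G.etaChain R

/-- The cycle `x⁺ + x⁻` is a boundary. -/
def Null (G : Grid n) : Prop := G.NullOver (MvPolynomial.X : Fin n → Coeff n)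

theorem NullOver.map {G : Grid n} {S : Type*} [CommRing S] {V : Fin n → R} (h : G.NullOver V)
    (f : R →+* S) : G.NullOver (fun c => f (V c)) := by
  obtain ⟨c, hc⟩ := h
  refine ⟨Finsupp.mapRange.addMonoidHom f.toAddMonoidHom c, ?_⟩
  have : G.gridWeights (fun c => f (V c)) = fun c r => f (G.gridWeights V c r) := by
    funext c r
    simp only [gridWeights]
    split_ifs <;> simp
  rw [this, diff_mapRange, hc]
  simp only [etaChain, map_add, Finsupp.mapRange.addMonoidHom_apply, Finsupp.mapRange_single]
  simp

/-- The polynomial ring is universal among rings of characteristic two with chosen values of the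
variables. -/
theorem Null.nullOver {G : Grid n} (h : G.Null) [CharP R 2] (V : Fin n → R) : G.NullOver V := by
  have := NullOver.map h (MvPolynomial.eval₂Hom (ZMod.castHom (dvd_refl 2) R) V)
  simpa using this

theorem null_iff_mem_range (G : Grid n) :
    G.Null ↔ G.etaChain (Coeff n) ∈ LinearMap.range G.boundary := by
  rw [boundary_eq_diff]; rfl

theorem lambda_eq_iff (G : Grid n) : G.lambdaPlus = G.lambdaMinus ↔ G.Null := by
  rw [lambdaPlus, lambdaMinus, Submodule.Quotient.eq, null_iff_mem_range,
    Submodule.submoduleOf, Submodule.mem_comap, etaChain]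
  have : ∀ u v : Chain n, u - v = u + v := fun u v => by
    rw [sub_eq_add_neg]
    congr 1
    exact neg_eq_of_add_eq_zero_left (chain_add_self v)
  rw [← this]
  rfl

theorem eta_eq_zero_iff (G : Grid n) : G.eta = 0 ↔ G.Null := by
  rw [eta, lambdaPlus, lambdaMinus, ← Submodule.Quotient.mk_add, Submodule.Quotient.mk_eq_zero,
    null_iff_mem_range, Submodule.submoduleOf, Submodule.mem_comap]
  rfl

end Grid

namespace Grid

/-! ### Translations of the torus -/

theorem inArc_finRotate {n : ℕ} (a b k : Fin n) :
    InArc (finRotate n a) (finRotate n b) k ↔ InArc a b ((finRotate n).symm k) := by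
  obtain ⟨k, rfl⟩ := (finRotate n).surjective k
  rw [Equiv.symm_apply_apply]
  obtain _ | n := n
  · exact a.elim0
  · simp only [InArc, finRotate_apply, add_sub_add_right_eq_sub]

namespace LineEmbedding

variable {n M : ℕ} (L : LineEmbedding n M)

theorem exists_diff_etaChain_iff {R : Type*} [CommRing R] {G : Grid n} {G' : Grid M} {V : Fin n → R}
    {V' : Fin M → R} (hw : L.weights (G'.gridWeights V') = G.gridWeights V)
    (hp : L.state G.statePlus = G'.statePlus) (hm : L.state G.stateMinus = G'.stateMinus) :
    G.NullOver V ↔ ∃ c ∈ Finsupp.supported R R (compat L.lines L.Z),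
      diff L.lines (G'.gridWeights V') c = G'.etaChain R := by
  have h := L.exists_diff_iff (G'.gridWeights V') (G.etaChain R)
  rw [hw] at h
  rw [NullOver, h, etaChain, map_add]
  simp only [Finsupp.lmapDomain_apply, Finsupp.mapDomain_single, hp, hm, etaChain]

/-- The embedding that shifts the columns. -/
def shiftColumns (n : ℕ) : LineEmbedding n n where
  col := (finRotate n).toEmbedding
  row := Function.Embedding.refl _
  colCell := (finRotate n).symm
  rowCell := id
  colCell_col := (finRotate n).symm_apply_apply
  rowCell_row _ := rfl
  inArc_col := inArc_finRotate
  inArc_row _ _ _ := Iff.rfl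
  Z := (finRotate n)⁻¹
  z := 1
  Z_col := (finRotate n).symm_apply_apply

/-- The embedding that shifts the rows. -/
def shiftRows (n : ℕ) : LineEmbedding n n where
  col := Function.Embedding.refl _
  row := (finRotate n).toEmbedding
  colCell := id
  rowCell := (finRotate n).symm
  colCell_col _ := rfl
  rowCell_row := (finRotate n).symm_apply_apply
  inArc_col _ _ _ := Iff.rfl
  inArc_row := inArc_finRotate
  Z := finRotate n
  z := 1
  Z_col _ := rfl

end LineEmbedding

variable {n : ℕ} {R : Type*} [CommRing R]

theorem filter_symm_eq (e : Equiv.Perm (Fin n)) (c : Fin n) :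
    Finset.univ.filter (fun k => e.symm k = c) = {e c} := by
  ext k
  rw [Finset.mem_filter, Finset.mem_singleton, Equiv.symm_apply_eq]
  simp only [Finset.mem_univ, true_and]

theorem nullOver_shiftColumns (G : Grid n) (V : Fin n → R) :
    G.shiftColumns.NullOver V ↔ G.NullOver (fun c => V (finRotate n c)) := by
  have hl : (LineEmbedding.shiftColumns n).lines = Finset.univ := by
    ext c
    simp only [LineEmbedding.mem_lines, Finset.mem_univ, iff_true]
    exact (finRotate n).surjective c
  have hs : ∀ y, (LineEmbedding.shiftColumns n).state y = y * (finRotate n)⁻¹ := fun y => by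
    refine (((LineEmbedding.shiftColumns n).eq_state_iff).2 ⟨fun m hm => ?_, fun c => ?_⟩).symm
    · rw [hl] at hm; simp at hm
    · exact congrArg y ((finRotate n).symm_apply_apply c)
  rw [(LineEmbedding.shiftColumns n).exists_diff_etaChain_iff (G' := G.shiftColumns) (V' := V) ?_
    (hs _) (hs _), hl]
  · simp [NullOver, compat]
  · funext c r
    have h1 : Finset.univ.filter (fun k => (LineEmbedding.shiftColumns n).colCell k = c) =
        {finRotate n c} := by
      exact filter_symm_eq _ _
    have h2 : Finset.univ.filter (fun k => (LineEmbedding.shiftColumns n).rowCell k = r) =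
        {r} := by
      exact filter_symm_eq (Equiv.refl _) _
    rw [LineEmbedding.weights, h1, h2, Finset.prod_singleton, Finset.prod_singleton]
    have hX : G.shiftColumns.X (finRotate n c) = G.X c :=
      congrArg G.X ((finRotate n).symm_apply_apply c)
    have hO : G.shiftColumns.O (finRotate n c) = G.O c :=
      congrArg G.O ((finRotate n).symm_apply_apply c)
    simp only [gridWeights, hX, hO]

theorem nullOver_shiftRows (G : Grid n) (V : Fin n → R) :
    G.shiftRows.NullOver V ↔ G.NullOver V := by
  have hl : (LineEmbedding.shiftRows n).lines = Finset.univ := by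
    ext c
    simp [LineEmbedding.mem_lines, LineEmbedding.shiftRows]
  have hs : ∀ y, (LineEmbedding.shiftRows n).state y = finRotate n * y := fun y => by
    refine (((LineEmbedding.shiftRows n).eq_state_iff).2 ⟨fun m hm => ?_, fun c => rfl⟩).symm
    rw [hl] at hm; simp at hm
  rw [(LineEmbedding.shiftRows n).exists_diff_etaChain_iff (G' := G.shiftRows) (V' := V) ?_
    (hs _) (hs _), hl]
  · simp [NullOver, compat]
  · funext c r
    have h1 : Finset.univ.filter (fun k => (LineEmbedding.shiftRows n).rowCell k = r) =
        {finRotate n r} := by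
      exact filter_symm_eq _ _
    have h2 : Finset.univ.filter (fun k => (LineEmbedding.shiftRows n).colCell k = c) =
        {c} := by
      exact filter_symm_eq (Equiv.refl _) _
    rw [LineEmbedding.weights, h1, h2, Finset.prod_singleton, Finset.prod_singleton]
    have hX : finRotate n r = G.shiftRows.X c ↔ r = G.X c := (finRotate n).injective.eq_iff
    have hO : finRotate n r = G.shiftRows.O c ↔ r = G.O c := (finRotate n).injective.eq_iff
    simp only [gridWeights, hX, hO]

theorem null_shiftColumns (G : Grid n) : G.shiftColumns.Null ↔ G.Null := by
  constructor
  · intro h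
    -- Variables are labelled by columns, so they have to be rotated back.
    have h1 := (G.nullOver_shiftColumns _).1 (Null.nullOver (R := Coeff n) h
      (fun c => (MvPolynomial.X ((finRotate n).symm c))))
    have h2 : (fun c => (MvPolynomial.X ((finRotate n).symm (finRotate n c)) : Coeff n)) =
        MvPolynomial.X := by
      funext c
      rw [Equiv.symm_apply_apply]
    rw [h2] at h1
    exact h1
  · intro h
    exact (G.nullOver_shiftColumns _).2 (h.nullOver _)

theorem null_shiftRows (G : Grid n) : G.shiftRows.Null ↔ G.Null :=
  G.nullOver_shiftRows _

end Grid

namespace Grid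

/-! ### Weights as products over marked squares -/

section Spots

variable {M : ℕ} {R : Type*} [CommRing R] {ι : Type*}

/-- The product of the weights `t i` in the squares `(f i, g i)`. -/
def spots (s : Finset ι) (f g : ι → Fin M) (t : ι → R) (c r : Fin M) : R :=
  ∏ i ∈ s, spot (f i) (g i) (t i) c r

theorem mono_spots (s : Finset ι) (f g : ι → Fin M) (t : ι → R) (m : Fin M → Fin M → ℕ) :
    mono (spots s f g t) m = ∏ i ∈ s, t i ^ m (f i) (g i) := by
  have : mono (spots s f g t) m = ∏ i ∈ s, mono (spot (f i) (g i) (t i)) m := by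
    simp only [mono, spots, ← Finset.prod_pow]
    rw [Finset.prod_comm]
    refine Eq.trans ?_ Finset.prod_comm
    rw [Finset.prod_comm]
    exact Finset.prod_congr rfl fun _ _ => Finset.prod_comm
  rw [this]
  simp only [mono_spot]

theorem gridWeights_eq_spots (G : Grid M) (V : Fin M → R) (c r : Fin M) :
    G.gridWeights V c r = spots Finset.univ id G.X (fun _ => 0) c r *
      spots Finset.univ id G.O V c r := by
  have h : ∀ (Y : State M) (t : Fin M → R), spots Finset.univ id Y t c r =
      if r = Y c then t c else 1 := by
    intro Y t
    rw [spots, Finset.prod_eq_single c]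
    · simp [spot]
    · intro d _ hd; simp [spot, hd.symm]
    · simp
  rw [h, h, gridWeights]
  split_ifs <;> simp

theorem LineEmbedding.weights_mul {n : ℕ} (L : LineEmbedding n M) (ω ω' : Fin M → Fin M → R)
    (c r : Fin n) :
    L.weights (fun c r => ω c r * ω' c r) c r = L.weights ω c r * L.weights ω' c r := by
  simp only [LineEmbedding.weights, Finset.prod_mul_distrib]

theorem LineEmbedding.weights_spot {n : ℕ} (L : LineEmbedding n M) (k l : Fin M) (t : R)
    (c r : Fin n) : L.weights (spot k l t) c r = spot (L.colCell k) (L.rowCell l) t c r := by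
  have h1 : ∀ k', ∏ l' ∈ Finset.univ.filter (fun l => L.rowCell l = r), spot k l t k' l' =
      if k' = k ∧ r = L.rowCell l then t else 1 := by
    intro k'
    by_cases hk : k' = k
    · simp only [spot, hk, true_and]
      rw [Finset.prod_ite_eq']
      simp [eq_comm]
    · simp [spot, hk]
  rw [LineEmbedding.weights]
  simp only [h1]
  by_cases hl : r = L.rowCell l
  · simp only [hl, and_true, spot]
    rw [Finset.prod_ite_eq']
    simp [eq_comm]
  · simp [hl, spot]

theorem LineEmbedding.weights_spots {n : ℕ} (L : LineEmbedding n M) (s : Finset ι)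
    (f g : ι → Fin M) (t : ι → R) (c r : Fin n) : L.weights (spots s f g t) c r =
      spots s (fun i => L.colCell (f i)) (fun i => L.rowCell (g i)) t c r := by
  rw [spots]
  simp only [← L.weights_spot]
  simp only [LineEmbedding.weights, spots]
  rw [Finset.prod_comm]
  refine Eq.trans ?_ Finset.prod_comm
  rw [Finset.prod_comm]
  exact Finset.prod_congr rfl fun _ _ => Finset.prod_comm

theorem mem_colStrips_univ {a b : Fin M} :
    (a, b) ∈ colStrips Finset.univ ↔ a ≠ b ∧ ∀ k, InArc a b k ↔ k = a := by
  rw [mem_colStrips]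
  constructor
  · rintro ⟨-, -, h, h'⟩
    refine ⟨h, fun k => ⟨fun hk => ?_, ?_⟩⟩
    · by_contra hka; exact h' k (Finset.mem_univ _) hka hk
    · rintro rfl; exact inArc_left h
  · rintro ⟨h, h'⟩
    exact ⟨Finset.mem_univ _, Finset.mem_univ _, h, fun c _ hca hi => hca ((h' c).1 hi)⟩

theorem succ_mem_colStrips_univ {a b : Fin M} (h : (a : ℕ) + 1 = b) :
    (a, b) ∈ colStrips Finset.univ := by
  rw [mem_colStrips_univ]
  refine ⟨by rintro rfl; omega, fun k => ?_⟩
  rw [inArc_iff]; omega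

theorem exists_colStrips_univ (hM : 2 ≤ M) (a : Fin M) :
    ∃ b, (a, b) ∈ colStrips Finset.univ := by
  by_cases h : (a : ℕ) + 1 < M
  · exact ⟨⟨a + 1, h⟩, succ_mem_colStrips_univ rfl⟩
  · refine ⟨⟨0, by omega⟩, mem_colStrips_univ.2 ⟨?_, fun k => ?_⟩⟩
    · intro h'
      have := congrArg Fin.val h'
      simp at this
      omega
    · rw [inArc_iff]
      simp only [Fin.le_def, Fin.lt_def, Fin.ext_iff]
      omega

theorem arcInd_univ {a b : Fin M} (h : (a, b) ∈ colStrips Finset.univ) (k : Fin M) :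
    arcInd a b k = if k = a then 1 else 0 := by
  rw [arcInd]
  exact if_congr ((mem_colStrips_univ.1 h).2 k) rfl rfl

end Spots

/-! ### Invariance under stabilization -/

section Stabilization

variable {n : ℕ}

theorem val_succ_succAbove (c a : Fin n) :
    (c.succ.succAbove a : ℕ) = if (a : ℕ) ≤ c then (a : ℕ) else a + 1 := by
  simp only [Fin.succAbove, Fin.lt_def, Fin.val_castSucc, Fin.val_succ]
  split_ifs <;> simp <;> omega

theorem val_castSucc_succAbove (c a : Fin n) :
    (c.castSucc.succAbove a : ℕ) = if (a : ℕ) < c then (a : ℕ) else a + 1 := by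
  simp only [Fin.succAbove, Fin.lt_def, Fin.val_castSucc]
  split_ifs <;> simp

theorem val_predAbove (c : Fin n) (k : Fin (n + 1)) :
    (c.predAbove k : ℕ) = if (k : ℕ) ≤ c then (k : ℕ) else k - 1 := by
  simp only [Fin.predAbove, Fin.lt_def, Fin.val_castSucc]
  split_ifs <;> first | omega | simp

theorem predAbove_succ_succAbove (c a : Fin n) : c.predAbove (c.succ.succAbove a) = a := by
  ext
  rw [val_predAbove, val_succ_succAbove]
  split_ifs <;> omega

theorem predAbove_castSucc_succAbove (c a : Fin n) : c.predAbove (c.castSucc.succAbove a) = a :=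
  Fin.predAbove_succAbove c a

theorem inArc_succAbove (c a b : Fin n) (k : Fin (n + 1)) :
    InArc (c.succ.succAbove a) (c.succ.succAbove b) k ↔ InArc a b (c.predAbove k) := by
  simp only [inArc_iff, Fin.lt_def, Fin.le_def, val_succ_succAbove, val_predAbove]
  split_ifs <;> omega

/-- The embedding that splits the column `c` and the row `r`. -/
def LineEmbedding.stabilize (c r : Fin n) : LineEmbedding n (n + 1) where
  col := c.succ.succAboveEmb
  row := r.succ.succAboveEmb
  colCell := c.predAbove
  rowCell := r.predAbove
  colCell_col := predAbove_succ_succAbove c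
  rowCell_row := predAbove_succ_succAbove r
  inArc_col := inArc_succAbove c
  inArc_row := inArc_succAbove r
  Z := insertPoint 1 c.succ r.succ
  z := 1
  Z_col _ := insertPoint_succAbove _ _ _ _

theorem val_finRotate (a : Fin n) :
    (finRotate n a : ℕ) = if (a : ℕ) + 1 = n then 0 else (a : ℕ) + 1 := by
  obtain _ | n := n
  · exact a.elim0
  · rw [coe_finRotate]
    simp [Fin.ext_iff]

theorem finRotate_succAbove {c e : Fin n} (h : e ≠ c) :
    finRotate (n + 1) (c.succ.succAbove e) = c.succ.succAbove (finRotate n e) := by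
  have := Fin.val_ne_of_ne h
  ext
  rw [val_finRotate, val_succ_succAbove, val_succ_succAbove, val_finRotate]
  split_ifs <;> omega

theorem finRotate_succ (c : Fin n) :
    finRotate (n + 1) c.succ = c.succ.succAbove (finRotate n c) := by
  ext
  rw [val_finRotate, val_succ_succAbove, val_finRotate, Fin.val_succ]
  split_ifs <;> omega

theorem finRotate_castSucc (c : Fin n) : finRotate (n + 1) c.castSucc = c.succ := by
  ext
  rw [val_finRotate, Fin.val_succ, Fin.val_castSucc]
  split_ifs <;> omega

theorem statePlus_finRotate (G : Grid n) (c : Fin n) :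
    G.statePlus (finRotate n c) = finRotate n (G.X c) := by
  show finRotate n (G.X ((finRotate n).symm (finRotate n c))) = _
  rw [Equiv.symm_apply_apply]

theorem insertPoint_castSucc (σ : Equiv.Perm (Fin n)) (c : Fin n) :
    insertPoint σ c.castSucc (σ c).castSucc = insertPoint σ c.succ (σ c).succ := by
  have h1 : ∀ d e : Fin n, d ≠ e → e.castSucc.succAbove d = e.succ.succAbove d := by
    intro d e h
    have := Fin.val_ne_of_ne h
    ext
    rw [val_castSucc_succAbove, val_succ_succAbove]
    split_ifs <;> omega
  ext x
  congr 1
  by_cases hx : x = c.castSucc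
  · subst hx
    rw [insertPoint_self]
    conv_rhs => rw [← Fin.succAbove_succ_self c, insertPoint_succAbove, Fin.succAbove_succ_self]
  · obtain ⟨d, rfl⟩ := Fin.exists_succAbove_eq hx
    rw [insertPoint_succAbove]
    by_cases hd : d = c
    · subst hd
      rw [Fin.succAbove_castSucc_self, Fin.succAbove_castSucc_self, insertPoint_self]
    · rw [h1 d c hd, insertPoint_succAbove, h1 _ _ (σ.injective.ne hd)]

/-- The weights of a stabilized diagram outside of the `2 × 2` block. -/
def stabilizeWeights {R : Type*} [CommRing R] (G : Grid n) (c : Fin n) (f g : Fin n → Fin (n + 1))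
    (V : Fin n → R) (k l : Fin (n + 1)) : R :=
  spots (Finset.univ.erase c) c.succ.succAbove (fun d => (G.X c).succ.succAbove (G.X d))
    (fun _ => 0) k l * spots Finset.univ f g V k l

variable {R : Type*} [CommRing R]

theorem prod_pow_ite {G : Grid n} {V : Fin n → R} {r : Fin n} {g : Fin n → Fin (n + 1)}
    {s : Fin (n + 1)} (h : ∀ d, g d = s ↔ G.O d = r) :
    ∏ d, V d ^ (if g d = s then 1 else 0) = V (G.O.symm r) := by
  rw [Finset.prod_eq_single (G.O.symm r)]
  · rw [if_pos ((h _).2 (G.O.apply_symm_apply r)), pow_one]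
  · intro d _ hd
    rw [if_neg, pow_zero]
    rw [h, ← Equiv.eq_symm_apply]
    exact hd
  · simp

theorem prod_pow_ite_eq_one {V : Fin n → R} {f : Fin n → Fin (n + 1)}
    {s : Fin (n + 1)} (h : ∀ d, f d ≠ s) : ∏ d, V d ^ (if f d = s then 1 else 0) = 1 :=
  Finset.prod_eq_one fun d _ => by rw [if_neg (h d), pow_zero]

theorem mono_stabilizeWeights {G : Grid n} {c : Fin n} {f g : Fin n → Fin (n + 1)} {V : Fin n → R}
    {m : Fin (n + 1) → Fin (n + 1) → ℕ}
    (hm : ∀ d, d ≠ c → m (c.succ.succAbove d) ((G.X c).succ.succAbove (G.X d)) = 0) :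
    mono (stabilizeWeights G c f g V) m = ∏ d, V d ^ m (f d) (g d) := by
  unfold stabilizeWeights
  rw [mono_mul, mono_spots, mono_spots, Finset.prod_eq_one, one_mul]
  intro d hd
  rw [hm d (Finset.ne_of_mem_erase hd), pow_zero]

theorem spots_univ_succAbove {M : ℕ} {f g : Fin (n + 1) → Fin M} {V : Fin (n + 1) → R} (p : Fin (n +
    1))
    (k l : Fin M) : spots Finset.univ f g V k l = spot (f p) (g p) (V p) k l *
      spots Finset.univ (fun d => f (p.succAbove d)) (fun d => g (p.succAbove d))
        (fun d => V (p.succAbove d)) k l :=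
  Fin.prod_univ_succAbove _ p

theorem spots_X_stabilize (G : Grid n) (c : Fin n) (k l : Fin (n + 1)) :
    spots Finset.univ id (insertPoint G.X c.succ (G.X c).succ) (fun _ => (0 : R)) k l =
      spot c.succ (G.X c).succ 0 k l * (spot c.castSucc (G.X c).castSucc 0 k l *
      spots (Finset.univ.erase c) c.succ.succAbove (fun d => (G.X c).succ.succAbove (G.X d))
        (fun _ => 0) k l) := by
  rw [spots_univ_succAbove c.succ, id, insertPoint_self]
  congr 1
  simp only [id, insertPoint_succAbove]
  rw [spots, ← Finset.mul_prod_erase _ _ (Finset.mem_univ c), Fin.succAbove_succ_self,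
    Fin.succAbove_succ_self]
  rfl

/-- At the centre of the new block the `X`s are the two squares of weight zero, and the new `O`, to
the south-east, supplies `σ₂`. -/
theorem stabilizeSE_weights (G : Grid n) (c : Fin n) (V' : Fin (n + 1) → R) :
    (G.stabilizeSE c).gridWeights V' = cornerWeights (stabilizeWeights G c c.succ.succAbove
      (fun d => (G.X c).castSucc.succAbove (G.O d)) fun d => V' (c.succ.succAbove d)) c.castSucc
        c.succ (G.X c).castSucc (G.X c).succ 1 (V' c.succ) := by
  funext k l
  rw [gridWeights_eq_spots, show (G.stabilizeSE c).X = insertPoint G.X c.succ (G.X c).succ from rfl,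
    spots_X_stabilize, spots_univ_succAbove c.succ,
    show (G.stabilizeSE c).O = insertPoint G.O c.succ (G.X c).castSucc from rfl]
  simp only [id, insertPoint_self, insertPoint_succAbove]
  have : spot c.castSucc (G.X c).succ (1 : R) k l = 1 := by simp [spot]
  rw [cornerWeights, stabilizeWeights, this]
  ring

theorem stabilizeNW_weights (G : Grid n) (c : Fin n) (V' : Fin (n + 1) → R) :
    (G.stabilizeNW c).gridWeights V' = cornerWeights (stabilizeWeights G c c.castSucc.succAbove
      (fun d => (G.X c).succ.succAbove (G.O d)) fun d => V' (c.castSucc.succAbove d)) c.castSucc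
        c.succ (G.X c).castSucc (G.X c).succ (V' c.castSucc) 1 := by
  funext k l
  rw [gridWeights_eq_spots, show (G.stabilizeNW c).X = insertPoint G.X c.succ (G.X c).succ from
    insertPoint_castSucc _ _, spots_X_stabilize, spots_univ_succAbove c.castSucc,
    show (G.stabilizeNW c).O = insertPoint G.O c.castSucc (G.X c).succ from rfl]
  simp only [id, insertPoint_self, insertPoint_succAbove]
  have : spot c.succ (G.X c).castSucc (1 : R) k l = 1 := by simp [spot]
  rw [cornerWeights, stabilizeWeights, this]
  ring

variable [CharP R 2]

/-- The states of the stabilized grid through the centre of the new block are the states of `G`, and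
`x⁺` and `x⁻` correspond. One implication is the inclusion of this subcomplex. The other is a merge
with `κ = 1`, for which the adjoining strips have to be balanced by `l₁` and `l₂`. -/
theorem nullOver_stabilize {G : Grid n} {c : Fin n} {G' : Grid (n + 1)} {f g : Fin n → Fin (n + 1)}
    {V : Fin n → R} {V' : Fin (n + 1) → R}
    (hX : G'.X = insertPoint G.X c.succ (G.X c).succ)
    (hf : ∀ d, c.predAbove (f d) = d) (hg : ∀ d, (G.X c).predAbove (g d) = G.O d) {σ₁ σ₂ : R}
    (hw : G'.gridWeights V' = cornerWeights (stabilizeWeights G c f g V) c.castSucc c.succ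
      (G.X c).castSucc (G.X c).succ σ₁ σ₂) :
    (G.NullOver V → G'.NullOver V') ∧ ∀ l₁ l₂,
    l₁ * (∏ d, V d ^ (if g d = (G.X c).castSucc then 1 else 0)) +
      l₂ * (∏ d, V d ^ (if f d = c.succ then 1 else 0)) = σ₁ →
    l₁ * (∏ d, V d ^ (if f d = c.castSucc then 1 else 0)) +
      l₂ * (∏ d, V d ^ (if g d = (G.X c).succ then 1 else 0)) = σ₂ →
    G'.NullOver V' → G.NullOver V := by
  set r := G.X c with hr
  have hn : 0 < n := c.pos
  set L := LineEmbedding.stabilize c r with hL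
  have hlines : L.lines = Finset.univ.erase c.succ := by
    ext k
    rw [L.mem_lines, Finset.mem_erase]
    simp only [Finset.mem_univ, and_true]
    exact Fin.exists_succAbove_eq_iff
  have hXs : ∀ d, G'.X (c.succ.succAbove d) = r.succ.succAbove (G.X d) := fun d => by
    rw [hX, insertPoint_succAbove]
  have hX0 : G'.X c.succ = r.succ := by rw [hX, insertPoint_self]
  have hX1 : G'.X c.castSucc = r.castSucc := by
    have := hXs c
    rwa [Fin.succAbove_succ_self, ← hr, Fin.succAbove_succ_self] at this
  have hZ : L.Z c.succ = r.succ := insertPoint_self _ _ _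
  have hcompat : ∀ x : State (n + 1), x ∈ compat L.lines L.Z ↔ x c.succ = r.succ := by
    intro x
    constructor
    · intro h
      rw [h _ (by rw [hlines]; simp), hZ]
    · intro h m hm
      rw [hlines] at hm
      have : m = c.succ := by simpa using hm
      rw [this, h, hZ]
  have hp : L.state G.statePlus = G'.statePlus := by
    refine (L.eq_state_iff.2 ⟨(hcompat _).2 ?_, fun d => ?_⟩).symm
    · rw [← finRotate_castSucc c, statePlus_finRotate, hX1, finRotate_castSucc]
    · obtain ⟨e, rfl⟩ := (finRotate n).surjective d
      show G'.statePlus (c.succ.succAbove (finRotate n e)) = r.succ.succAbove _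
      rw [statePlus_finRotate]
      by_cases he : e = c
      · subst he
        rw [← finRotate_succ, statePlus_finRotate, hX0, finRotate_succ]
      · rw [← finRotate_succAbove he, statePlus_finRotate, hXs,
          finRotate_succAbove (G.X.injective.ne he)]
  have hm : L.state G.stateMinus = G'.stateMinus := by
    refine (L.eq_state_iff.2 ⟨(hcompat _).2 hX0, hXs⟩).symm
  have hLw : L.weights (G'.gridWeights V') = G.gridWeights V := by
    rw [hw]
    unfold cornerWeights stabilizeWeights
    funext k l
    rw [L.weights_mul, L.weights_mul, L.weights_mul, L.weights_mul, L.weights_mul, L.weights_spots,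
      L.weights_spots, L.weights_spot, L.weights_spot, L.weights_spot, L.weights_spot,
      gridWeights_eq_spots]
    have e1 : L.colCell c.castSucc = c := by ext; rw [hL]; simp [LineEmbedding.stabilize]
    have e2 : L.colCell c.succ = c := by ext; rw [hL]; simp [LineEmbedding.stabilize]
    have e3 : L.rowCell r.castSucc = r := by ext; rw [hL]; simp [LineEmbedding.stabilize]
    have e4 : L.rowCell r.succ = r := by ext; rw [hL]; simp [LineEmbedding.stabilize]
    have e5 : ∀ d, L.colCell (c.succ.succAbove d) = d := predAbove_succ_succAbove c
    have e6 : ∀ d, L.rowCell (r.succ.succAbove d) = d := predAbove_succ_succAbove r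
    have e7 : ∀ d, L.colCell (f d) = d := hf
    have e8 : ∀ d, L.rowCell (g d) = G.O d := hg
    simp only [e1, e2, e3, e4, e5, ← hr, e6, e7, e8]
    have e9 : spots Finset.univ id G.X (fun _ => (0 : R)) k l =
        spots (Finset.univ.erase c) (fun d => d) G.X (fun _ => 0) k l * spot c r 0 k l := by
      rw [spots, spots, mul_comm, hr]
      exact (Finset.mul_prod_erase _ _ (Finset.mem_univ c)).symm
    -- Over the old marked square lie both new `X`s and the new `O`; the zero absorbs the other
    -- factors.
    have e10 : spot c r (0 : R) k l * (spot c r 0 k l * (spot c r σ₁ k l * spot c r σ₂ k l)) =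
        spot c r 0 k l := by
      simp only [spot]; split_ifs <;> simp
    rw [e9, e10, mul_right_comm]
    rfl
  rw [L.exists_diff_etaChain_iff hLw hp hm]
  have ha : (c.castSucc : ℕ) + 1 = c.succ := by simp
  have hs : (r.castSucc : ℕ) + 1 = r.succ := by simp
  have hdiff : ∀ v ∈ Finsupp.supported R R (compat (Finset.univ.erase c.succ) L.Z),
      diff (Finset.univ.erase c.succ) (G'.gridWeights V') v =
        diff Finset.univ (G'.gridWeights V') v := by
    intro v hv
    rw [hw, diff_erase ha hs (Finset.mem_univ _) hZ _ _ hv]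
  rw [hlines]
  constructor
  · rintro ⟨v, hv, h⟩
    exact ⟨v, by rw [← hdiff v hv, h]⟩
  · rintro l₁ l₂ h₁ h₂ ⟨v, h⟩
    obtain ⟨aR, haR⟩ := exists_colStrips_univ (M := n + 1) (by omega) c.succ
    obtain ⟨sR, hsR⟩ := exists_colStrips_univ (M := n + 1) (by omega) r.succ
    have hi : Finset.univ.image L.Z = Finset.univ := Finset.image_univ_equiv _
    have key := exists_merge_scale (T := Finset.univ) (Z := L.Z) (ω := stabilizeWeights G c f g V)
      (σ₁ := σ₁) (σ₂ := σ₂) (l₁ := l₁) (l₂ := l₂) (κ := 1) ha hs (Finset.mem_univ _) hZ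
      (succ_mem_colStrips_univ ha) haR (by rw [hi]; exact succ_mem_colStrips_univ hs)
      (by rw [hi]; exact hsR) ?_ ?_ (c := v) (w := G'.etaChain R) (by simp [compat]) ?_
        (by rw [← hw, h])
    · rw [one_smul, ← hw] at key
      exact key
    · rw [one_mul, ← h₁, rowMono, colMono, mono_stabilizeWeights, mono_stabilizeWeights]
      · simp only [arcInd_univ haR, arcInd_univ (succ_mem_colStrips_univ hs)]
      · intro d hd
        rw [arcInd_univ haR, if_neg (Fin.succAbove_ne _ _)]
      · intro d hd
        rw [arcInd_univ (succ_mem_colStrips_univ hs), if_neg]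
        rw [← Fin.succAbove_succ_self]
        exact fun h => hd (G.X.injective (Fin.succAbove_right_injective h))
    · rw [one_mul, ← h₂, rowMono, colMono, mono_stabilizeWeights, mono_stabilizeWeights]
      · simp only [arcInd_univ hsR, arcInd_univ (succ_mem_colStrips_univ ha)]
      · intro d hd
        rw [arcInd_univ hsR, if_neg (Fin.succAbove_ne _ _)]
      · intro d hd
        rw [arcInd_univ (succ_mem_colStrips_univ ha), if_neg]
        rw [← Fin.succAbove_succ_self]
        exact fun h => hd (Fin.succAbove_right_injective h)
    · rw [← hlines, etaChain, ← hp, ← hm]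
      exact add_mem (Finsupp.single_mem_supported _ _ (L.state_mem_compat _))
        (Finsupp.single_mem_supported _ _ (L.state_mem_compat _))

theorem null_stabilizeSE (G : Grid n) (c : Fin n) : (G.stabilizeSE c).Null ↔ G.Null := by
  constructor
  · intro h
    -- The new variable is set equal to that of the `O` in the row of the old `X`. Then the strips
    -- to the right of the centre and above it have weights `σ₁ = 1` and `σ₂`, whence `l₁ = 0` and
    -- `l₂ = 1`.
    have h' := h.nullOver (c.succ.insertNth (MvPolynomial.X (G.O.symm (G.X c))) MvPolynomial.X :
      Fin (n + 1) → Coeff n)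
    have key := (nullOver_stabilize rfl (predAbove_succ_succAbove c)
      (fun d => predAbove_castSucc_succAbove _ _) (G.stabilizeSE_weights c _)).2 0 1 ?_ ?_ h'
    · simp only [Fin.insertNth_apply_succAbove] at key
      exact key
    · rw [zero_mul, one_mul, zero_add, prod_pow_ite_eq_one]
      exact fun d => Fin.succAbove_ne _ _
    · rw [zero_mul, one_mul, zero_add, Fin.insertNth_apply_same]
      simp only [Fin.insertNth_apply_succAbove]
      refine prod_pow_ite fun d => ?_
      rw [← Fin.succAbove_castSucc_self, Fin.succAbove_right_inj]
  · intro h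
    exact (nullOver_stabilize rfl (predAbove_succ_succAbove c)
      (fun d => predAbove_castSucc_succAbove _ _) (G.stabilizeSE_weights c _)).1 (h.nullOver _)

theorem null_stabilizeNW (G : Grid n) (c : Fin n) : (G.stabilizeNW c).Null ↔ G.Null := by
  constructor
  · intro h
    -- With the same value of the new variable, the strips below the centre and to its left now have
    -- weights `σ₁` and `σ₂ = 1`, whence `l₁ = 1` and `l₂ = 0`.
    have h' := h.nullOver (c.castSucc.insertNth (MvPolynomial.X (G.O.symm (G.X c)))
      MvPolynomial.X : Fin (n + 1) → Coeff n)
    have key := (nullOver_stabilize (insertPoint_castSucc _ _) (predAbove_castSucc_succAbove c)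
      (fun d => predAbove_succ_succAbove _ _) (G.stabilizeNW_weights c _)).2 1 0 ?_ ?_ h'
    · simp only [Fin.insertNth_apply_succAbove] at key
      exact key
    · rw [zero_mul, one_mul, add_zero, Fin.insertNth_apply_same]
      simp only [Fin.insertNth_apply_succAbove]
      refine prod_pow_ite fun d => ?_
      rw [← Fin.succAbove_succ_self, Fin.succAbove_right_inj]
    · rw [zero_mul, one_mul, add_zero, prod_pow_ite_eq_one]
      exact fun d => Fin.succAbove_ne _ _
  · intro h
    exact (nullOver_stabilize (insertPoint_castSucc _ _) (predAbove_castSucc_succAbove c)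
      (fun d => predAbove_succ_succAbove _ _) (G.stabilizeNW_weights c _)).1 (h.nullOver _)

end Stabilization

end Grid

namespace Grid

/-! ### Commutation of columns -/

section Pentagons

variable {M : ℕ} {R : Type*} [CommRing R]

/-- The product of `φ` over an arc. -/
def arcProd (φ : Fin M → R) (s t : Fin M) : R := ∏ r, φ r ^ arcInd s t r

/-- The product of `φ` over the arc from the point after `e` to `t`. -/
def arcAfter (φ : Fin M → R) (e t : Fin M) : R :=
  ∏ r, φ r ^ (if r = e ∨ InArc t e r then 0 else 1)

theorem arcProd_of_inArc (φ : Fin M → R) {s t e : Fin M} (h : InArc s t e) :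
    arcProd φ s t = arcProd φ s e * φ e * arcAfter φ e t := by
  have h1 : φ e = ∏ r, φ r ^ (if r = e then 1 else 0) := by
    rw [Finset.prod_eq_single e] <;> simp +contextual
  rw [h1]
  simp only [arcProd, arcAfter, ← Finset.prod_mul_distrib, ← pow_add]
  refine Finset.prod_congr rfl fun r _ => ?_
  congr 1
  simp only [arcInd, inArc_iff] at h ⊢
  split_ifs <;> omega

theorem arcProd_mul_arcAfter (φ : Fin M → R) {s t e : Fin M} (h : ¬ InArc s t e) :
    arcProd φ s t * arcAfter φ e s = arcAfter φ e t := by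
  simp only [arcProd, arcAfter, ← Finset.prod_mul_distrib, ← pow_add]
  refine Finset.prod_congr rfl fun r _ => ?_
  congr 1
  simp only [arcInd, inArc_iff] at h ⊢
  split_ifs <;> omega

theorem arcProd_mul_arcProd (φ : Fin M → R) {s t e : Fin M} (h : ¬ InArc s t e) :
    arcProd φ s t * arcProd φ t e = arcProd φ s e := by
  simp only [arcProd, ← Finset.prod_mul_distrib, ← pow_add]
  refine Finset.prod_congr rfl fun r _ => ?_
  congr 1
  simp only [arcInd, inArc_iff] at h ⊢
  split_ifs <;> omega

/-- Also for `t = e` the three factors exhaust the circle: then `arcProd` is empty and `arcAfter`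
runs over all other rows. -/
theorem arcProd_mul_mul_arcAfter (φ : Fin M → R) (e t : Fin M) :
    arcProd φ t e * φ e * arcAfter φ e t = ∏ r, φ r := by
  have h1 : φ e = ∏ r, φ r ^ (if r = e then 1 else 0) := by
    rw [Finset.prod_eq_single e] <;> simp +contextual
  conv_lhs => rw [h1]
  simp only [arcProd, arcAfter, ← Finset.prod_mul_distrib, ← pow_add]
  refine Finset.prod_congr rfl fun r _ => ?_
  conv_rhs => rw [← pow_one (φ r)]
  congr 1
  simp only [arcInd, inArc_iff]
  split_ifs <;> omega

variable {a b e : Fin M} {ω ω' : Fin M → Fin M → R}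

/-- The part of the monomial in the columns other than `a` and `b`. -/
def monoOff (a b : Fin M) (ω : Fin M → Fin M → R) (m : Fin M → Fin M → ℕ) : R :=
  ∏ c ∈ (Finset.univ.erase a).erase b, ∏ r, ω c r ^ m c r

theorem mono_eq_mul_monoOff (hab : a ≠ b) (ω : Fin M → Fin M → R) (m : Fin M → Fin M → ℕ) :
    mono ω m = (∏ r, ω a r ^ m a r) * (∏ r, ω b r ^ m b r) * monoOff a b ω m := by
  rw [mono, monoOff, mul_assoc, Finset.mul_prod_erase _ (fun c => ∏ r, ω c r ^ m c r)
    (Finset.mem_erase.2 ⟨hab.symm, Finset.mem_univ _⟩), 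
    Finset.mul_prod_erase _ (fun c => ∏ r, ω c r ^ m c r) (Finset.mem_univ a)]

theorem monoOff_add (ω : Fin M → Fin M → R) (m m' : Fin M → Fin M → ℕ) :
    monoOff a b ω (m + m') = monoOff a b ω m * monoOff a b ω m' := by
  simp only [monoOff, Pi.add_apply, pow_add, Finset.prod_mul_distrib]

/-- The weight of the pentagon from a diagram to the one with columns `a` and `b` interchanged that
corresponds to a rectangle out of `x`. -/
def pentagonWeight (a b e : Fin M) (ω : Fin M → Fin M → R) (x : State M) (i j : Fin M) : R :=
  if (i = b ∨ j = b) ∧ InArc (x i) (x j) e then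
    arcAfter (ω a) e (x j) * arcProd (ω b) (x i) e * monoOff a b ω (box i j (x i) (x j))
  else 0

/-- The product over the rows of both columns with given multiplicities. -/
def rowsProd (a b : Fin M) (ω : Fin M → Fin M → R) (m : Fin M → ℕ) : R :=
  ∏ r, (ω a r * ω b r) ^ m r

theorem rowsProd_add (m m' : Fin M → ℕ) :
    rowsProd a b ω (m + m') = rowsProd a b ω m * rowsProd a b ω m' := by
  simp only [rowsProd, Pi.add_apply, pow_add, Finset.prod_mul_distrib]

/-- What a rectangle with row `u` of the initial and row `v` of the final state on the line `b`
contributes to pairs of a rectangle and a pentagon. -/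
theorem pentagon_cases (hab : (a : ℕ) + 1 = b) (ha : ω' a = ω b) (hb : ω' b = ω a)
    (hω : ∀ c, c ≠ a → c ≠ b → ω' c = ω c) (x : State M) {i j : Fin M} (hij : i ≠ j) :
    let u := x b
    let v := (x * Equiv.swap i j) b
    let m := box i j (x i) (x j)
    (pentagonWeight a b e ω x i j = 0 ∧ m a e = m b e ∧
      mono ω m * arcAfter (ω a) e v = arcAfter (ω a) e u * rowsProd a b ω (m b) * monoOff a b ω m ∧
      mono ω m * arcProd (ω b) v e = arcProd (ω b) u e * rowsProd a b ω (m a) * monoOff a b ω m ∧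
      mono ω' m * arcProd (ω b) u e = arcProd (ω b) v e * rowsProd a b ω (m b) * monoOff a b ω m ∧
      mono ω' m * arcAfter (ω a) e u = arcAfter (ω a) e v * rowsProd a b ω (m a) *
        monoOff a b ω m) ∨
    (pentagonWeight a b e ω x i j = arcAfter (ω a) e u * arcProd (ω b) v e * monoOff a b ω m ∧
      m a e = 1 ∧ m b e = 0 ∧ rowsProd a b ω (m b) = 1 ∧
      mono ω m = arcProd (ω a) v e * ω a e * arcAfter (ω a) e u * monoOff a b ω m ∧
      mono ω' m = arcProd (ω b) v e * ω b e * arcAfter (ω b) e u * monoOff a b ω m) ∨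
    (pentagonWeight a b e ω x i j = arcAfter (ω a) e v * arcProd (ω b) u e * monoOff a b ω m ∧
      m a e = 0 ∧ m b e = 1 ∧ rowsProd a b ω (m a) = 1 ∧
      mono ω m = arcProd (ω b) u e * ω b e * arcAfter (ω b) e v * monoOff a b ω m ∧
      mono ω' m = arcProd (ω a) u e * ω a e * arcAfter (ω a) e v * monoOff a b ω m) := by
  intro u v m
  have hne : a ≠ b := by rintro rfl; omega
  have hoff : monoOff a b ω' m = monoOff a b ω m := by
    refine Finset.prod_congr rfl fun c hc => ?_
    rw [Finset.mem_erase, Finset.mem_erase] at hc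
    rw [hω c hc.2.1 hc.1]
  have hm : mono ω m = (∏ r, ω a r ^ m a r) * (∏ r, ω b r ^ m b r) * monoOff a b ω m :=
    mono_eq_mul_monoOff hne ω m
  have hm' : mono ω' m = (∏ r, ω b r ^ m a r) * (∏ r, ω a r ^ m b r) * monoOff a b ω m := by
    rw [mono_eq_mul_monoOff hne ω' m, ha, hb, hoff]
  have hma : ∀ r, m a r = arcInd i j a * arcInd (x i) (x j) r := fun r => rfl
  have hmb : ∀ r, m b r = arcInd i j b * arcInd (x i) (x j) r := fun r => rfl
  have hrows : ∀ k : Fin M, (∀ r, m k r = arcInd (x i) (x j) r) →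
      rowsProd a b ω (m k) = arcProd (ω a) (x i) (x j) * arcProd (ω b) (x i) (x j) := by
    intro k hk
    simp only [rowsProd, arcProd, hk, mul_pow, Finset.prod_mul_distrib]
  have hrows0 : ∀ k : Fin M, (∀ r, m k r = 0) → rowsProd a b ω (m k) = 1 := by
    intro k hk
    simp [rowsProd, hk]
  -- The rectangle begins at the line `b`, ends there, or covers both or neither of the columns `a`
  -- and `b`; only in the first two cases can it become a pentagon.
  rcases arcInd_pair hab hij with ⟨e1, e2, e3, e4⟩ | ⟨e1, e2, e3, e4⟩ | ⟨e1, e2, e3, e4⟩ |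
    ⟨e1, e2, e3, e4⟩
  · simp only [e3, e4, one_mul, zero_mul] at hma hmb
    have hu : u = x i := by rw [e1]
    have hv : v = x j := by show (x * Equiv.swap i j) b = _; rw [← e1]; simp
    rw [hu, hv, hm, hm', hrows b hmb, hrows0 a hma, hma, hmb]
    simp only [hma, hmb, pow_zero, Finset.prod_const_one, one_mul]
    change _ ∨ _ ∨ _ ∧ _ ∧ _ ∧ _ ∧ arcProd (ω b) (x i) (x j) * _ = _ ∧
      arcProd (ω a) (x i) (x j) * _ = _
    by_cases he : InArc (x i) (x j) e
    · refine Or.inr (Or.inr ⟨?_, trivial, ?_, trivial, ?_, ?_⟩)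
      · rw [pentagonWeight, if_pos ⟨Or.inl e1, he⟩]
      · rw [arcInd, if_pos he]
      · rw [arcProd_of_inArc _ he]
      · rw [arcProd_of_inArc _ he]
    · have k1 := arcProd_mul_arcAfter (ω a) he
      have k2 := arcProd_mul_arcProd (ω b) he
      refine Or.inl ⟨?_, ?_, ?_, ?_, ?_, ?_⟩
      · rw [pentagonWeight, if_neg fun h => he h.2]
      · rw [arcInd, if_neg he]
      · change arcProd (ω b) (x i) (x j) * _ * _ = _
        rw [← k1]; ring
      · change arcProd (ω b) (x i) (x j) * _ * _ = _
        rw [← k2]; ring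
      · change arcProd (ω a) (x i) (x j) * _ * _ = _
        rw [← k2]; ring
      · change arcProd (ω a) (x i) (x j) * _ * _ = _
        rw [← k1]; ring
  · simp only [e3, e4, one_mul, zero_mul] at hma hmb
    have hu : u = x j := by rw [e1]
    have hv : v = x i := by show (x * Equiv.swap i j) b = _; rw [← e1]; simp
    rw [hu, hv, hm, hm', hrows a hma, hrows0 b hmb, hma, hmb]
    simp only [hma, hmb, pow_zero, Finset.prod_const_one, mul_one]
    by_cases he : InArc (x i) (x j) e
    · refine Or.inr (Or.inl ⟨?_, ?_, trivial, trivial, ?_, ?_⟩)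
      · rw [pentagonWeight, if_pos ⟨Or.inr e1, he⟩]
      · rw [arcInd, if_pos he]
      · change arcProd (ω a) (x i) (x j) * _ = _
        rw [arcProd_of_inArc _ he]
      · change arcProd (ω b) (x i) (x j) * _ = _
        rw [arcProd_of_inArc _ he]
    · have k1 := arcProd_mul_arcAfter (ω a) he
      have k2 := arcProd_mul_arcProd (ω b) he
      refine Or.inl ⟨?_, ?_, ?_, ?_, ?_, ?_⟩
      · rw [pentagonWeight, if_neg fun h => he h.2]
      · rw [arcInd, if_neg he]
      · change arcProd (ω a) (x i) (x j) * _ * _ = _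
        rw [← k1]; ring
      · change arcProd (ω a) (x i) (x j) * _ * _ = _
        rw [← k2]; ring
      · change arcProd (ω b) (x i) (x j) * _ * _ = _
        rw [← k2]; ring
      · change arcProd (ω b) (x i) (x j) * _ * _ = _
        rw [← k1]; ring
  all_goals
    have hv : v = u := by
      show x (Equiv.swap i j b) = x b
      rw [Equiv.swap_apply_of_ne_of_ne e1.symm e2.symm]
    have hw : pentagonWeight a b e ω x i j = 0 := by
      rw [pentagonWeight, if_neg]
      rintro ⟨rfl | rfl, -⟩
      · exact e1 rfl
      · exact e2 rfl
    have hmab : m a = m b := by funext r; rw [hma, hmb, e3, e4]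
    rw [hv, hm, hm', hmab]
    refine Or.inl ⟨hw, rfl, ?_, ?_, ?_, ?_⟩ <;>
      simp only [rowsProd, mul_pow, Finset.prod_mul_distrib] <;> ring

end Pentagons

end Grid

namespace Grid

section PentagonMap

variable {M : ℕ} {R : Type*} [CommRing R] {a b e : Fin M} {ω ω' : Fin M → Fin M → R}

/-- The map of pentagons. -/
noncomputable def pentagonOp (a b e : Fin M) (ω : Fin M → Fin M → R) :
    (State M →₀ R) →ₗ[R] (State M →₀ R) :=
  rectOp Finset.univ (pentagonWeight a b e ω)

/-- The weight of a domain from a state with row `u` to a state with row `w` on the line `b` that is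
composed of a rectangle and a pentagon. -/
def pentagonPair (a b e : Fin M) (ω : Fin M → Fin M → R) (m : Fin M → Fin M → ℕ) (u w : Fin M) :
    R :=
  if m a e = m b e + 1 then
    arcAfter (ω a) e u * arcProd (ω b) w e * rowsProd a b ω (m b) * monoOff a b ω m
  else if m b e = m a e + 1 then
    arcProd (ω b) u e * arcAfter (ω a) e w * rowsProd a b ω (m a) * monoOff a b ω m
  else 0

variable [CharP R 2]

/-- If only one of the rectangles yields a pentagon, the multiplicities of columns `a` and `b` at
row `e` of the total domain reveal its side. If both do on the same side of the line, products over
full columns appear and vanish by `h₁` and `h₂`. If they do on opposite sides, the two terms are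
equal and cancel. -/
theorem pentagonWeight_mul_add (hab : (a : ℕ) + 1 = b) (ha : ω' a = ω b) (hb : ω' b = ω a)
    (hω : ∀ c, c ≠ a → c ≠ b → ω' c = ω c) (h₁ : ∏ r, ω a r = 0) (h₂ : ∏ r, ω b r = 0)
    (x : State M) {i j i' j' : Fin M} (hij : i ≠ j) (hij' : i' ≠ j') :
    let y := x * Equiv.swap i j
    let m₁ := box i j (x i) (x j)
    let m₂ := box i' j' (y i') (y j')
    mono ω m₁ * pentagonWeight a b e ω y i' j' + pentagonWeight a b e ω x i j * mono ω' m₂ =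
      pentagonPair a b e ω (m₁ + m₂) (x b) ((y * Equiv.swap i' j') b) := by
  intro y m₁ m₂
  have c₁ := pentagon_cases (e := e) hab ha hb hω x hij
  have c₂ := pentagon_cases (e := e) hab ha hb hω y hij'
  have h2 : (2 : R) = 0 := CharTwo.two_eq_zero
  have z₁ := arcProd_mul_mul_arcAfter (ω a) e (y b)
  have z₂ := arcProd_mul_mul_arcAfter (ω b) e (y b)
  rw [h₁] at z₁
  rw [h₂] at z₂
  simp only at c₁ c₂
  simp only [pentagonPair, Pi.add_apply, rowsProd_add, monoOff_add]
  change mono ω m₁ * pentagonWeight a b e ω y i' j' + pentagonWeight a b e ω x i j * mono ω' m₂ =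
    _
  generalize hw : (y * Equiv.swap i' j') b = w at *
  rw [show x * Equiv.swap i j = y from rfl, show box i j (x i) (x j) = m₁ from rfl] at c₁
  rw [show box i' j' (y i') (y j') = m₂ from rfl] at c₂
  generalize y b = v at *
  generalize x b = u at *
  rcases c₁ with ⟨p, q, f1, f2, f3, f4⟩ | ⟨p, q, q', f0, f1, f2⟩ | ⟨p, q, q', f0, f1, f2⟩ <;>
    rcases c₂ with ⟨P, Q, F1, F2, F3, F4⟩ | ⟨P, Q, Q', F0, F1, F2⟩ | ⟨P, Q, Q', F0, F1, F2⟩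
  · rw [p, P, q, Q, if_neg (by omega), if_neg (by omega)]; ring
  · rw [p, P, q, Q, Q', if_pos (by omega), F0]
    linear_combination (arcProd (ω b) w e * monoOff a b ω m₂) * f1
  · rw [p, P, q, Q, Q', if_neg (by omega), if_pos (by omega), F0]
    linear_combination (arcAfter (ω a) e w * monoOff a b ω m₂) * f2
  · rw [p, P, q, q', Q, if_pos (by omega), f0]
    linear_combination (arcAfter (ω a) e u * monoOff a b ω m₁) * F3
  · rw [p, P, q, q', Q, Q', if_neg (by omega), if_neg (by omega), f1, F2]
    linear_combination (arcAfter (ω a) e u * arcProd (ω b) w e * monoOff a b ω m₁ *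
      monoOff a b ω m₂) * (z₁ + z₂)
  · rw [p, P, q, q', Q, Q', if_neg (by omega), if_neg (by omega), f1, F2]
    linear_combination (arcProd (ω a) v e * ω a e * arcAfter (ω a) e u * arcAfter (ω a) e w *
      arcProd (ω b) v e * monoOff a b ω m₁ * monoOff a b ω m₂) * h2
  · rw [p, P, q, q', Q, if_neg (by omega), if_pos (by omega), f0]
    linear_combination (arcProd (ω b) u e * monoOff a b ω m₁) * F4
  · rw [p, P, q, q', Q, Q', if_neg (by omega), if_neg (by omega), f1, F2]
    linear_combination (arcProd (ω b) u e * ω b e * arcAfter (ω b) e v * arcAfter (ω a) e v *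
      arcProd (ω b) w e * monoOff a b ω m₁ * monoOff a b ω m₂) * h2
  · rw [p, P, q, q', Q, Q', if_neg (by omega), if_neg (by omega), f1, F2]
    linear_combination (arcAfter (ω a) e w * arcProd (ω b) u e * monoOff a b ω m₁ *
      monoOff a b ω m₂) * (z₁ + z₂)

/-- Only annuli could remain. Horizontal ones have equal multiplicities in columns `a` and `b` and
contribute nothing. Of the vertical ones, those of column `a` and of column `b` contribute the same
weight and cancel. -/
theorem diff_pentagonOp (hab : (a : ℕ) + 1 = b) (ha : ω' a = ω b) (hb : ω' b = ω a)
    (hω : ∀ c, c ≠ a → c ≠ b → ω' c = ω c) (h₁ : ∏ r, ω a r = 0) (h₂ : ∏ r, ω b r = 0)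
    (v : State M →₀ R) : diff Finset.univ ω' (pentagonOp a b e ω v) =
      pentagonOp a b e ω (diff Finset.univ ω v) := by
  rw [← LinearMap.comp_apply, ← LinearMap.comp_apply]
  refine LinearMap.congr_fun (Finsupp.lhom_ext' fun x => LinearMap.ext_ring ?_) v
  simp only [LinearMap.comp_apply, Finsupp.lsingle_apply]
  symm
  refine chain_eq_of_add ?_
  simp only [diff, domOp, pentagonOp, rectOp_rectOp_single, ← Finset.sum_add_distrib,
    ← Finsupp.single_add]
  have key := sum_freeRects_freeRects chain_add_self Finset.univ x
    (fun m y => Finsupp.single y (pentagonPair a b e ω m (x b) (y b)))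
  have hne : a ≠ b := by rintro rfl; omega
  obtain ⟨k, hk⟩ := exists_colStrips_univ (M := M) (by have := a.2; have := b.2; omega) b
  refine Eq.trans (Finset.sum_congr rfl fun r hr => Finset.sum_congr rfl fun s hs => ?_)
    (key.trans ?_)
  · rw [pentagonWeight_mul_add hab ha hb hω h₁ h₂ x (mem_freeRects.1 hr).2.2.1
      (mem_freeRects.1 hs).2.2.1]
  · rw [Finset.sum_eq_zero (s := rowStrips Finset.univ x), add_zero]
    · rw [Finset.sum_eq_add (a, b) (b, k)]
      · have e₁ := arcInd_univ (succ_mem_colStrips_univ hab)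
        have e₂ := arcInd_univ hk
        have e₃ : monoOff a b ω (fun c _ => arcInd a b c) = 1 :=
          Finset.prod_eq_one fun c hc => Finset.prod_eq_one fun r _ => by
            change ω c r ^ arcInd a b c = 1
            rw [e₁, if_neg (Finset.ne_of_mem_erase (Finset.mem_of_mem_erase hc)), pow_zero]
        have e₄ : monoOff a b ω (fun c _ => arcInd b k c) = 1 :=
          Finset.prod_eq_one fun c hc => Finset.prod_eq_one fun r _ => by
            change ω c r ^ arcInd b k c = 1
            rw [e₂, if_neg (Finset.ne_of_mem_erase hc), pow_zero]
        simp only [pentagonPair, e₃, e₄]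
        simp only [e₁, e₂, hne, hne.symm, if_true, if_false, rowsProd, pow_zero,
          Finset.prod_const_one]
        rw [← Finsupp.single_add]
        refine (congrArg (Finsupp.single x) ?_).trans (Finsupp.single_zero x)
        rw [if_neg (by omega), mul_comm (arcAfter (ω a) e (x b)), CharTwo.add_self_eq_zero]
      · simp [hne]
      · rintro ⟨c, d⟩ hr ⟨hc, hd⟩
        have e₁ := arcInd_univ hr
        have hca : a ≠ c := by
          rintro rfl
          exact hc (by rw [colStrips_right_unique hr (succ_mem_colStrips_univ hab)])
        have hcb : b ≠ c := by
          rintro rfl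
          exact hd (by rw [colStrips_right_unique hr hk])
        simp [pentagonPair, e₁, hca, hcb]
      · exact fun h => absurd (succ_mem_colStrips_univ hab) h
      · exact fun h => absurd hk h
    · intro r hr
      rw [pentagonPair, if_neg (by simp), if_neg (by simp), Finsupp.single_zero]

end PentagonMap

end Grid

namespace Grid

/-! ### The images of `x⁺` and `x⁻` under the pentagon map -/

section Commutation

variable {n : ℕ} {R : Type*} [CommRing R] {a b e : Fin n}

theorem arcProd_eq_one {φ : Fin n → R} {s t : Fin n} (h : ∀ r, InArc s t r → φ r = 1) :
    arcProd φ s t = 1 :=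
  Finset.prod_eq_one fun r _ => by
    rw [arcInd]
    split_ifs with hr
    · rw [h r hr, one_pow]
    · rw [pow_zero]

theorem arcProd_eq_zero {φ : Fin n → R} {s t r : Fin n} (h : InArc s t r) (hr : φ r = 0) :
    arcProd φ s t = 0 :=
  Finset.prod_eq_zero (Finset.mem_univ r) (by rw [arcInd, if_pos h, hr, pow_one])

theorem arcAfter_eq_one {φ : Fin n → R} {e t : Fin n}
    (h : ∀ r, r ≠ e → ¬ InArc t e r → φ r = 1) : arcAfter φ e t = 1 :=
  Finset.prod_eq_one fun r _ => by
    split_ifs with hr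
    · rw [pow_zero]
    · rw [not_or] at hr
      rw [h r hr.1 hr.2, one_pow]

theorem arcAfter_eq_zero {φ : Fin n → R} {e t r : Fin n} (h : r ≠ e) (h' : ¬ InArc t e r)
    (hr : φ r = 0) : arcAfter φ e t = 0 :=
  Finset.prod_eq_zero (Finset.mem_univ r) (by rw [if_neg (by tauto), hr, pow_one])

theorem monoOff_eq_zero {ω : Fin n → Fin n → R} {m : Fin n → Fin n → ℕ} {c r : Fin n} (hca : c ≠ a)
    (hcb : c ≠ b) (h : ω c r = 0) (hm : m c r ≠ 0) : monoOff a b ω m = 0 :=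
  Finset.prod_eq_zero (Finset.mem_erase.2 ⟨hcb, Finset.mem_erase.2 ⟨hca, Finset.mem_univ c⟩⟩)
    (Finset.prod_eq_zero (Finset.mem_univ r) (by rw [h, zero_pow hm]))

theorem monoOff_eq_one {ω : Fin n → Fin n → R} {m : Fin n → Fin n → ℕ}
    (h : ∀ c r, c ≠ a → c ≠ b → m c r = 0) : monoOff a b ω m = 1 :=
  Finset.prod_eq_one fun c hc => Finset.prod_eq_one fun r _ => by
    rw [h c r (Finset.ne_of_mem_erase (Finset.mem_of_mem_erase hc)) (Finset.ne_of_mem_erase hc),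
      pow_zero]

variable {G : Grid n} {V : Fin n → R}

theorem gridWeights_X (G : Grid n) (V : Fin n → R) (c : Fin n) : G.gridWeights V c (G.X c) = 0 :=
  if_pos rfl

theorem gridWeights_of_ne {c r : Fin n} (h : r ≠ G.X c) (h' : r ≠ G.O c) :
    G.gridWeights V c r = 1 := by
  rw [gridWeights, if_neg h, if_neg h']

theorem finRotate_of_succ (hab : (a : ℕ) + 1 = b) : finRotate n a = b := by
  ext
  rw [val_finRotate, if_neg (by have := b.2; omega), hab]

theorem finRotate_mem_colStrips (hab : (a : ℕ) + 1 = b) (c : Fin n) :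
    (c, finRotate n c) ∈ colStrips Finset.univ := by
  by_cases h : (c : ℕ) + 1 < n
  · exact succ_mem_colStrips_univ (by rw [val_finRotate, if_neg (by omega)])
  · have hc : (finRotate n c : ℕ) = 0 := by rw [val_finRotate, if_pos (by omega)]
    have := b.2
    refine mem_colStrips_univ.2 ⟨fun h' => ?_, fun k => ?_⟩
    · have := congrArg Fin.val h'
      omega
    · rw [inArc_iff]
      simp only [Fin.le_def, Fin.lt_def, Fin.ext_iff]
      omega

theorem mem_freeRects_of_colStrips {x : State n} {c d : Fin n} (h : (c,
    d) ∈ colStrips Finset.univ) :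
    (c, d) ∈ freeRects Finset.univ x := by
  rw [mem_freeRects]
  refine ⟨Finset.mem_univ _, Finset.mem_univ _, (mem_colStrips.1 h).2.2.1, fun k _ hk => ?_⟩
  rw [box, arcInd_univ h, if_neg hk, zero_mul]

/-- A rectangle out of `x⁻` has an `X` in its south-west square. Only a pentagon that starts in
column `a` escapes it, since up to row `e` it takes its weights from column `b` instead. This leaves
the thin pentagon, and the conditions on the `O`s give it weight `1`. -/
theorem pentagonOp_stateMinus (hab : (a : ℕ) + 1 = b) (he : InArc (G.X a) (G.X b) e)
    (hOa : G.O a = e ∨ ¬ InArc e (G.X b) (G.O a)) (hOb : ¬ InArc (G.X a) e (G.O b)) :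
    pentagonOp a b e (G.gridWeights V) (Finsupp.single G.stateMinus 1) =
      Finsupp.single (G.swapColumns a b).stateMinus 1 := by
  have hne : a ≠ b := by rintro rfl; omega
  have hX : G.X a ≠ G.X b := G.X.injective.ne hne
  have hst := succ_mem_colStrips_univ hab
  rw [pentagonOp, rectOp_single, Finset.sum_eq_single (a, b)]
  · rw [show G.stateMinus * Equiv.swap a b = (G.swapColumns a b).stateMinus from rfl]
    congr 1
    rw [pentagonWeight, if_pos ⟨Or.inr rfl, he⟩]
    rw [monoOff_eq_one, mul_one, arcAfter_eq_one, arcProd_eq_one, mul_one]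
    · intro r hr
      refine gridWeights_of_ne ?_ ?_
      · rintro rfl
        change InArc (G.X a) e (G.X b) at hr
        rw [inArc_iff] at hr he
        omega
      · rintro rfl
        exact hOb hr
    · intro r hr hr'
      change ¬ InArc (G.X b) e r at hr'
      refine gridWeights_of_ne ?_ ?_
      · rintro rfl
        rw [inArc_iff] at hr' he
        omega
      · rintro rfl
        have := hOa.resolve_left hr
        have hre := Fin.val_ne_of_ne hr
        rw [inArc_iff] at hr' this he
        omega
    · intro c r hca _
      rw [box, arcInd_univ hst, if_neg hca, zero_mul]
  · rintro ⟨i, j⟩ hij hne'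
    have hij' := (mem_freeRects.1 hij).2.2.1
    dsimp only
    rw [pentagonWeight]
    split_ifs with h
    · have hm : box i j (G.X i) (G.X j) i (G.X i) ≠ 0 := by
        rw [Ne, box_eq_zero, not_not]
        exact ⟨inArc_left hij', inArc_left (G.X.injective.ne hij')⟩
      by_cases hib : i = b
      · subst hib
        rw [show G.stateMinus = G.X from rfl, arcProd_eq_zero (r := G.X i) (inArc_left ?_)
          (gridWeights_X G V i), mul_zero, zero_mul,
          Finsupp.single_zero]
        rintro rfl
        exact not_inArc_right _ _ he
      · have hia : i ≠ a := by
          rintro rfl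
          exact hne' (by rw [h.1.resolve_left hib])
        rw [show G.stateMinus = G.X from rfl, monoOff_eq_zero hia hib (gridWeights_X G V i) hm,
          mul_zero, Finsupp.single_zero]
    · rw [Finsupp.single_zero]
  · exact fun h => absurd (mem_freeRects_of_colStrips hst) h

theorem box_strip_ne_zero {i j : Fin n} (hij : i ≠ finRotate n j) :
    box i (finRotate n j) (G.statePlus i) (G.statePlus (finRotate n j)) j (G.X j) ≠ 0 := by
  rw [Ne, box_eq_zero, not_not, statePlus_finRotate]
  refine ⟨inArc_right hij, inArc_right ?_⟩
  rw [← statePlus_finRotate]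
  exact G.statePlus.injective.ne hij

theorem statePlus_swapColumns (G : Grid n) (a b : Fin n) : (G.swapColumns a b).statePlus =
    G.statePlus * Equiv.swap (finRotate n a) (finRotate n b) := by
  ext c
  obtain ⟨c, rfl⟩ := (finRotate n).surjective c
  rw [statePlus_finRotate, Equiv.Perm.mul_apply, (finRotate n).injective.swap_apply,
    statePlus_finRotate]
  rfl

/-- The same with the `X`s in north-east squares and the thin pentagon on the other side of the line
`b`. -/
theorem pentagonOp_statePlus (hab : (a : ℕ) + 1 = b)
    (he : InArc (finRotate n (G.X a)) (finRotate n (G.X b)) e)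
    (hOa : G.O a = e ∨ ¬ InArc e (finRotate n (G.X b)) (G.O a))
    (hOb : ¬ InArc (finRotate n (G.X a)) e (G.O b)) :
    pentagonOp a b e (G.gridWeights V) (Finsupp.single G.statePlus 1) =
      Finsupp.single (G.swapColumns a b).statePlus 1 := by
  have hne : a ≠ b := by rintro rfl; omega
  have hX : G.X a ≠ G.X b := G.X.injective.ne hne
  have hra := finRotate_of_succ hab
  have hst := finRotate_mem_colStrips hab b
  have sa : G.statePlus b = finRotate n (G.X a) := by rw [← hra, statePlus_finRotate]
  have va := val_finRotate (G.X a)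
  have vb := val_finRotate (G.X b)
  rw [pentagonOp, rectOp_single, Finset.sum_eq_single (b, finRotate n b)]
  · rw [statePlus_swapColumns, hra]
    congr 1
    rw [pentagonWeight, statePlus_finRotate, sa, if_pos ⟨Or.inl rfl, he⟩]
    rw [monoOff_eq_one, mul_one, arcAfter_eq_one, arcProd_eq_one, mul_one]
    · intro r hr
      refine gridWeights_of_ne ?_ ?_
      · rintro rfl
        rw [inArc_iff] at hr he
        split_ifs at * <;> omega
      · rintro rfl
        exact hOb hr
    · intro r hr hr'
      refine gridWeights_of_ne ?_ ?_
      · rintro rfl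
        rw [inArc_iff] at hr' he
        split_ifs at * <;> omega
      · rintro rfl
        have := hOa.resolve_left hr
        have hre := Fin.val_ne_of_ne hr
        rw [inArc_iff] at hr' this he
        split_ifs at * <;> omega
    · intro c r _ hcb
      rw [box, arcInd_univ hst, if_neg hcb, zero_mul]
  · rintro ⟨i, j⟩ hij hne'
    obtain ⟨j, rfl⟩ := (finRotate n).surjective j
    have hij' := (mem_freeRects.1 hij).2.2.1
    dsimp only
    rw [pentagonWeight]
    split_ifs with h
    · have hm := box_strip_ne_zero (G := G) hij'
      by_cases hja : j = a
      · subst hja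
        rw [arcAfter_eq_zero (r := G.X j) ?_ ?_ (gridWeights_X G V j), zero_mul, zero_mul,
          Finsupp.single_zero]
        · rintro rfl
          rw [inArc_iff] at he
          split_ifs at * <;> omega
        · rw [statePlus_finRotate]
          rw [inArc_iff] at he ⊢
          split_ifs at * <;> omega
      · have hjb : j ≠ b := by
          rintro rfl
          refine hne' (Prod.ext (h.1.resolve_right fun h1 => ?_) rfl)
          exact hne ((finRotate n).injective (hra.trans h1.symm))
        rw [monoOff_eq_zero hja hjb (gridWeights_X G V j) hm, mul_zero, Finsupp.single_zero]
    · rw [Finsupp.single_zero]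
  · exact fun h => absurd (mem_freeRects_of_colStrips hst) h

end Commutation

end Grid

namespace Grid

section Commutation

variable {n : ℕ} {R : Type*} [CommRing R] {a b e : Fin n} {G : Grid n} {V : Fin n → R}

theorem gridWeights_swapColumns (G : Grid n) (V : Fin n → R) (c : Fin n) :
    (G.swapColumns a b).gridWeights (fun d => V (Equiv.swap a b d)) c =
      G.gridWeights V (Equiv.swap a b c) := rfl

/-- If the `X`s are in consecutive rows, the thin pentagon out of `x⁺` meets an `X`. The pentagons
coming from rectangles that end at the line `b` have the same weights as these rectangles in the new
diagram, and cancel with them. The thin rectangle of the new diagram that is left leads to the new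
`x⁺`. -/
theorem pentagonOp_statePlus_add [CharP R 2] (hab : (a : ℕ) + 1 = b)
    (hX : finRotate n (G.X a) = G.X b) (hOa : G.O a ≠ G.X b) (hOb : G.O b ≠ G.X a) :
    pentagonOp a b (G.X a) (G.gridWeights V) (Finsupp.single G.statePlus 1) +
      diff Finset.univ ((G.swapColumns a b).gridWeights fun d => V (Equiv.swap a b d))
        (Finsupp.single G.statePlus 1) = Finsupp.single (G.swapColumns a b).statePlus 1 := by
  have hne : a ≠ b := by rintro rfl; omega
  have hXne : G.X a ≠ G.X b := G.X.injective.ne hne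
  have hra := finRotate_of_succ hab
  have hst := finRotate_mem_colStrips hab b
  have hsr := finRotate_mem_colStrips hab (G.X a)
  have hsr' := finRotate_mem_colStrips hab (G.X b)
  have sa : G.statePlus b = G.X b := by rw [← hX, ← hra, statePlus_finRotate]
  set ω' := (G.swapColumns a b).gridWeights fun d => V (Equiv.swap a b d) with hω'
  have hwa : ω' a = G.gridWeights V b := by rw [hω', gridWeights_swapColumns, Equiv.swap_apply_left]
  have hwb : ω' b = G.gridWeights V a := by rw [hω', gridWeights_swapColumns,
    Equiv.swap_apply_right]
  have hwc : ∀ c, c ≠ a → c ≠ b → ω' c = G.gridWeights V c := fun c h h' => by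
    rw [hω', gridWeights_swapColumns, Equiv.swap_apply_of_ne_of_ne h h']
  have hoff : ∀ m, monoOff a b ω' m = monoOff a b (G.gridWeights V) m := fun m =>
    Finset.prod_congr rfl fun c hc => by
      rw [hwc c (Finset.ne_of_mem_erase (Finset.mem_of_mem_erase hc)) (Finset.ne_of_mem_erase hc)]
  rw [pentagonOp, diff, domOp, rectOp_single, rectOp_single, ← Finset.sum_add_distrib,
    Finset.sum_eq_single (b, finRotate n b)]
  · dsimp only
    rw [← Finsupp.single_add, statePlus_swapColumns, hra]
    congr 1
    rw [pentagonWeight, arcProd_eq_zero (r := G.X b) _ (gridWeights_X G V b), mul_zero, zero_mul,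
      ite_self, zero_add, mono_eq_mul_monoOff hne, hwa, hwb, hoff, monoOff_eq_one, mul_one]
    · have e₁ : ∀ r, box b (finRotate n b) (G.statePlus b) (G.statePlus (finRotate n b)) a r = 0 :=
        fun r => by rw [box, arcInd_univ hst, if_neg hne, zero_mul]
      have e₂ : ∀ r, box b (finRotate n b) (G.statePlus b) (G.statePlus (finRotate n b)) b r =
          if r = G.X b then 1 else 0 := fun r => by
        rw [box, arcInd_univ hst, if_pos rfl, one_mul, sa, statePlus_finRotate, arcInd_univ hsr']
      simp only [e₁, e₂, pow_zero, Finset.prod_const_one, one_mul]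
      rw [Finset.prod_eq_single (G.X b), if_pos rfl, pow_one,
        gridWeights_of_ne hXne.symm hOa.symm]
      · intro r _ hr
        rw [if_neg hr, pow_zero]
      · simp
    · intro c r _ hcb
      rw [box, arcInd_univ hst, if_neg hcb, zero_mul]
    · rw [sa]
      exact inArc_left hXne.symm
  · rintro ⟨i, j⟩ hij hne'
    obtain ⟨j, rfl⟩ := (finRotate n).surjective j
    have hij' := (mem_freeRects.1 hij).2.2.1
    have hm := box_strip_ne_zero (G := G) hij'
    dsimp only
    rw [← Finsupp.single_add]
    refine (congrArg (Finsupp.single _) ?_).trans (Finsupp.single_zero _)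
    have hin : InArc i (finRotate n j) j := inArc_right hij'
    by_cases hja : j = a
    · subst hja
      rw [hra] at hin hij' hm ⊢
      have hxi : G.statePlus i ≠ G.X b := by rw [← sa]; exact G.statePlus.injective.ne hij'
      have hxj : InArc (G.statePlus i) (G.statePlus b) (G.X j) := by
        rw [sa, ← hX]
        exact inArc_right (by rw [hX]; exact hxi)
      rw [pentagonWeight, if_pos ⟨Or.inr rfl, hxj⟩, mono_eq_mul_monoOff hne, hwa, hwb, hoff]
      have e₁ : ∏ r, G.gridWeights V j r ^ box i b (G.statePlus i) (G.statePlus b) b r = 1 := by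
        refine Finset.prod_eq_one fun r _ => ?_
        rw [box, arcInd, if_neg (not_inArc_right _ _), zero_mul, pow_zero]
      have e₂ : ∏ r, G.gridWeights V b r ^ box i b (G.statePlus i) (G.statePlus b) j r =
          arcProd (G.gridWeights V b) (G.statePlus i) (G.statePlus b) := by
        refine Finset.prod_congr rfl fun r _ => ?_
        rw [box, arcInd, if_pos hin, one_mul]
      have e₃ : arcAfter (G.gridWeights V j) (G.X j) (G.statePlus b) = 1 := by
        refine arcAfter_eq_one fun r hr hr' => ?_
        exfalso
        have h1 := mem_colStrips_univ.1 hsr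
        rw [hX] at h1
        have h2 := (h1.2 r).not.2 hr
        have h3 := Fin.val_ne_of_ne hXne
        rw [sa] at hr'
        rw [inArc_iff] at h2 hr'
        omega
      have e₄ : arcAfter (G.gridWeights V b) (G.X j) (G.statePlus b) = 1 := by
        refine arcAfter_eq_one fun r hr hr' => ?_
        exfalso
        have h1 := mem_colStrips_univ.1 hsr
        rw [hX] at h1
        have h2 := (h1.2 r).not.2 hr
        have h3 := Fin.val_ne_of_ne hXne
        rw [sa] at hr'
        rw [inArc_iff] at h2 hr'
        omega
      rw [e₁, e₂, e₃, arcProd_of_inArc _ hxj, e₄, gridWeights_of_ne hXne hOb.symm]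
      rw [mul_one, mul_one, mul_one, one_mul, CharTwo.add_self_eq_zero]
    · by_cases hjb : j = b
      · subst hjb
        have hij : i ≠ j := fun h => hne' (by rw [h])
        have h1 : ω' a (G.X j) = 0 := by rw [hwa, gridWeights_X]
        rw [mono_eq_zero h1, add_zero, pentagonWeight, if_neg]
        · rintro ⟨h | h, -⟩
          · exact hij h
          · exact hne ((finRotate n).injective (hra.trans h.symm))
        · rw [Ne, box_eq_zero, not_not] at hm ⊢
          refine ⟨?_, hm.2⟩
          have := mem_colStrips_univ.1 hst
          have h3 := Fin.val_ne_of_ne hij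
          rw [inArc_iff] at hin ⊢
          have h4 := (this.2 a).not.2 hne
          rw [inArc_iff] at h4
          omega
      · rw [mono_eq_zero (by rw [hwc j hja hjb, gridWeights_X]) hm, add_zero, pentagonWeight,
          monoOff_eq_zero hja hjb (gridWeights_X G V j) hm, mul_zero, ite_self]
  · exact fun h => absurd (mem_freeRects_of_colStrips hst) h

theorem NullOver.swapColumns [CharP R 2] (h : G.NullOver V) (hab : (a : ℕ) + 1 = b)
    (hu : Unlinked (G.X a) (G.O a) (G.X b) (G.O b)) :
    (G.swapColumns a b).NullOver (fun d => V (Equiv.swap a b d)) := by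
  have hne : a ≠ b := by rintro rfl; omega
  obtain ⟨v, hv⟩ := h
  have hprod : ∀ c, ∏ r, G.gridWeights V c r = 0 := fun c =>
    Finset.prod_eq_zero (Finset.mem_univ (G.X c)) (gridWeights_X G V c)
  have hD : ∀ e, diff Finset.univ
      ((G.swapColumns a b).gridWeights fun d => V (Equiv.swap a b d))
      (pentagonOp a b e (G.gridWeights V) v) = pentagonOp a b e (G.gridWeights V) (G.etaChain R) :=
        by
    intro e
    rw [diff_pentagonOp hab ?_ ?_ ?_ (hprod a) (hprod b), hv]
    · rw [gridWeights_swapColumns, Equiv.swap_apply_left]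
    · rw [gridWeights_swapColumns, Equiv.swap_apply_right]
    · intro c h h'
      rw [gridWeights_swapColumns, Equiv.swap_apply_of_ne_of_ne h h']
  obtain ⟨h1, h2, h3, h4, h5, h6, h7⟩ := hu
  have h7' : InArc (G.X a) (G.O a) (G.X b) ↔ InArc (G.X a) (G.O a) (G.O b) := h7
  have v1 := Fin.val_ne_of_ne h1
  have v2 := Fin.val_ne_of_ne h2
  have v3 := Fin.val_ne_of_ne h3
  have v4 := Fin.val_ne_of_ne h4
  have v5 := Fin.val_ne_of_ne h5
  have v6 := Fin.val_ne_of_ne h6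
  have va := val_finRotate (G.X a)
  have vb := val_finRotate (G.X b)
  by_cases hX : finRotate n (G.X a) = G.X b
  -- The correction term in `pentagonOp_statePlus_add` is the boundary of `x⁺` itself.
  · refine ⟨pentagonOp a b (G.X a) (G.gridWeights V) v + Finsupp.single G.statePlus 1, ?_⟩
    rw [map_add, hD, etaChain, map_add, add_right_comm, pentagonOp_statePlus_add hab hX h4 h3.symm,
      pentagonOp_stateMinus hab (inArc_left h2), etaChain]
    · right
      have h8 := (mem_colStrips_univ.1 (finRotate_mem_colStrips hab (G.X a))).2 (G.O a)
      rw [hX] at h8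
      exact h8.not.2 h1.symm
    · exact not_inArc_self _ _
  -- The old and the new curve cross at row `e`. It is the row of the `O` of column `a` if that lies
  -- on the arc between the `X`s, otherwise that of the `O` of column `b` if this does, and
  -- otherwise the row just above the `X` of column `a`. Unlinkedness keeps the other `O` off the
  -- pentagon.
  · have key : ∃ e, (InArc (G.X a) (G.X b) e ∧ e ≠ G.X a) ∧
        (G.O a = e ∨ ¬ InArc e (G.X b) (G.O a)) ∧ ¬ InArc (G.X a) e (G.O b) := by
      by_cases ha : InArc (G.X a) (G.X b) (G.O a)
      · refine ⟨G.O a, ⟨ha, h1.symm⟩, Or.inl rfl, ?_⟩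
        rw [inArc_iff] at ha h7' ⊢
        rw [inArc_iff] at h7'
        omega
      · by_cases hb : InArc (G.X a) (G.X b) (G.O b)
        · refine ⟨G.O b, ⟨hb, h3.symm⟩, Or.inr ?_, not_inArc_right _ _⟩
          rw [inArc_iff] at *
          omega
        · refine ⟨finRotate n (G.X a), ⟨?_, ?_⟩, Or.inr ?_, ?_⟩
          · have := Fin.val_ne_of_ne hX
            rw [inArc_iff]
            split_ifs at va <;> omega
          · exact (mem_colStrips_univ.1 (finRotate_mem_colStrips hab (G.X a))).1.symm
          · have := Fin.val_ne_of_ne hX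
            rw [inArc_iff] at ha ⊢
            split_ifs at va <;> omega
          · have := ((mem_colStrips_univ.1 (finRotate_mem_colStrips hab (G.X a))).2 (G.O b)).not.2
              h3.symm
            exact this
    obtain ⟨e, ⟨k1, k2⟩, k3, k4⟩ := key
    have w2 := Fin.val_ne_of_ne k2
    refine ⟨pentagonOp a b e (G.gridWeights V) v, ?_⟩
    rw [hD, etaChain, map_add, pentagonOp_stateMinus hab k1 k3 k4, pentagonOp_statePlus hab,
      etaChain]
    · rw [inArc_iff] at k1 ⊢
      split_ifs at va <;> split_ifs at vb <;> omega
    · refine k3.imp_right fun k3 => ?_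
      rw [inArc_iff] at k1 k3 ⊢
      split_ifs at vb <;> omega
    · rw [inArc_iff] at k1 k4 ⊢
      split_ifs at va <;> omega

end Commutation

end Grid

namespace Grid

variable {n : ℕ} {R : Type*} [CommRing R]

theorem Unlinked.symm {x o x' o' : Fin n} (h : Unlinked x o x' o') : Unlinked x' o' x o := by
  obtain ⟨h1, h2, h3, h4, h5, h6, h7⟩ := h
  refine ⟨h6, h2.symm, h4.symm, h3.symm, h5.symm, h1, ?_⟩
  have h7' : InArc x o x' ↔ InArc x o o' := h7
  change InArc x' o' x ↔ InArc x' o' o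
  have v1 := Fin.val_ne_of_ne h1
  have v2 := Fin.val_ne_of_ne h2
  have v3 := Fin.val_ne_of_ne h3
  have v4 := Fin.val_ne_of_ne h4
  have v5 := Fin.val_ne_of_ne h5
  have v6 := Fin.val_ne_of_ne h6
  rw [inArc_iff] at *
  rw [inArc_iff] at *
  omega

theorem ext_grid {G G' : Grid n} (hX : G.X = G'.X) (hO : G.O = G'.O) : G = G' := by
  cases G; cases G'; simp_all

theorem swapColumns_swapColumns (G : Grid n) (a b : Fin n) :
    (G.swapColumns a b).swapColumns a b = G :=
  ext_grid (by simp [swapColumns, mul_assoc]) (by simp [swapColumns, mul_assoc])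

theorem nullOver_swapColumns [CharP R 2] {G : Grid n} {a b : Fin n} (hab : (a : ℕ) + 1 = b)
    (hu : Unlinked (G.X a) (G.O a) (G.X b) (G.O b)) (V : Fin n → R) :
    (G.swapColumns a b).NullOver (fun d => V (Equiv.swap a b d)) ↔ G.NullOver V := by
  refine ⟨fun h => ?_, fun h => h.swapColumns hab hu⟩
  have h' := NullOver.swapColumns h hab ?_
  · rw [swapColumns_swapColumns] at h'
    simpa using h'
  · simpa [swapColumns] using hu.symm

theorem null_swapColumns {G : Grid n} {a b : Fin n} (hab : (a : ℕ) + 1 = b)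
    (hu : Unlinked (G.X a) (G.O a) (G.X b) (G.O b)) : (G.swapColumns a b).Null ↔ G.Null := by
  constructor
  · intro h
    exact (nullOver_swapColumns (R := Coeff n) hab hu _).1 (h.nullOver _)
  · intro h
    have := (nullOver_swapColumns (R := Coeff n) hab hu fun d =>
      MvPolynomial.X (Equiv.swap a b d)).2 (h.nullOver _)
    simpa [Null] using this

/-! ### Transposition -/

/-- The diagram with columns and rows interchanged. -/
def transpose (G : Grid n) : Grid n where
  X := G.X⁻¹
  O := G.O⁻¹
  disjoint c h := by
    refine G.disjoint (G.X⁻¹ c) ?_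
    conv_rhs => rw [h]
    simp

theorem transpose_transpose (G : Grid n) : G.transpose.transpose = G :=
  ext_grid (inv_inv _) (inv_inv _)

theorem perm_inv_apply (x : State n) (a : Fin n) : x⁻¹ (x a) = a :=
  x.symm_apply_apply a

theorem freeRects_inv {x : State n} {a b : Fin n} :
    (x a, x b) ∈ freeRects Finset.univ x⁻¹ ↔ (a, b) ∈ freeRects Finset.univ x := by
  rw [mem_freeRects, mem_freeRects]
  simp only [perm_inv_apply, Finset.mem_univ, true_and, ne_eq, x.injective.eq_iff,
    forall_const]
  refine and_congr_right fun hab => ?_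
  rw [x.symm.forall_congr_left]
  refine forall_congr' fun c => ?_
  rw [Equiv.symm_symm, x.injective.eq_iff, perm_inv_apply, box_eq_zero, box_eq_zero,
    and_comm]

theorem mono_transpose (ω : Fin n → Fin n → R) (m : Fin n → Fin n → ℕ) :
    mono (fun c r => ω r c) (fun c r => m r c) = mono ω m :=
  Finset.prod_comm

/-- Reflection in the diagonal inverts states and preserves the south-west and north-east corners of
rectangles. -/
theorem diff_transpose (ω : Fin n → Fin n → R) (v : State n →₀ R) :
    diff Finset.univ (fun c r => ω r c) (Finsupp.lmapDomain R R (fun x => x⁻¹) v) =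
      Finsupp.lmapDomain R R (fun x => x⁻¹) (diff Finset.univ ω v) := by
  rw [← LinearMap.comp_apply, ← LinearMap.comp_apply]
  refine LinearMap.congr_fun (Finsupp.lhom_ext' fun x => LinearMap.ext_ring ?_) v
  simp only [LinearMap.comp_apply, Finsupp.lsingle_apply, Finsupp.lmapDomain_apply,
    Finsupp.mapDomain_single, diff, domOp, rectOp_single]
  rw [← Finsupp.lmapDomain_apply R R, map_sum]
  refine (Finset.sum_bij (fun r _ => (x r.1, x r.2)) ?_ ?_ ?_ ?_).symm
  · rintro ⟨a, b⟩ h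
    exact freeRects_inv.2 h
  · rintro ⟨a, b⟩ _ ⟨a', b'⟩ _ h
    simpa using h
  · rintro ⟨i, k⟩ h
    refine ⟨(x⁻¹ i, x⁻¹ k), ?_, by simp⟩
    rw [← freeRects_inv]
    simpa using h
  · rintro ⟨a, b⟩ h
    simp only [Finsupp.lmapDomain_apply, Finsupp.mapDomain_single, perm_inv_apply]
    rw [← mono_transpose]
    congr 1
    · rw [mul_inv_rev, Equiv.swap_inv, Equiv.swap_mul_eq_mul_swap, inv_inv]
    · congr 1
      funext c r
      exact mul_comm _ _

/-- Variables are labelled by the columns of the `O`s, so the reflection relabels them along `O⁻¹`.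
-/
theorem NullOver.transpose {G : Grid n} {V : Fin n → R} (h : G.NullOver V) :
    G.transpose.NullOver (fun d => V (G.O⁻¹ d)) := by
  obtain ⟨v, hv⟩ := h
  refine ⟨Finsupp.lmapDomain R R (fun x => x⁻¹) v, ?_⟩
  have : G.transpose.gridWeights (fun d => V (G.O⁻¹ d)) = fun c r => G.gridWeights V r c := by
    funext c r
    have h1 : r = G.X⁻¹ c ↔ c = G.X r := by rw [Equiv.Perm.eq_inv_iff_eq, eq_comm]
    have h2 : r = G.O⁻¹ c ↔ c = G.O r := by rw [Equiv.Perm.eq_inv_iff_eq, eq_comm]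
    simp only [gridWeights, Grid.transpose, h1, h2]
    split_ifs with h3 h4
    · rfl
    · rw [h4, perm_inv_apply]
    · rfl
  rw [this, diff_transpose, hv, etaChain, map_add, Finsupp.lmapDomain_apply,
    Finsupp.lmapDomain_apply, Finsupp.mapDomain_single, Finsupp.mapDomain_single, etaChain]
  congr 2

theorem null_transpose (G : Grid n) : G.transpose.Null ↔ G.Null := by
  have key : ∀ G : Grid n, G.Null → G.transpose.Null := by
    intro G h
    have := (h.nullOver (R := Coeff n) fun d => MvPolynomial.X (G.O d)).transpose
    simpa [Null] using this
  exact ⟨fun h => by simpa [transpose_transpose] using key _ h, key G⟩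

theorem null_swapRows {G : Grid n} {a b : Fin n} (hab : (a : ℕ) + 1 = b)
    (hu : Unlinked (G.X⁻¹ a) (G.O⁻¹ a) (G.X⁻¹ b) (G.O⁻¹ b)) : (G.swapRows a b).Null ↔ G.Null := by
  have h : G.swapRows a b = (G.transpose.swapColumns a b).transpose :=
    ext_grid (by simp [swapRows, swapColumns, transpose]) (by simp [swapRows, swapColumns,
      transpose])
  rw [h, null_transpose, null_swapColumns hab hu, null_transpose]

/-! ### Invariance under Legendrian equivalence -/

theorem _root_.LegendrianMove.null_iff {D D' : Σ n, Grid n} (h : LegendrianMove D D') :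
    D.2.Null ↔ D'.2.Null := by
  cases h with
  | shiftColumns G => exact (null_shiftColumns G).symm
  | shiftRows G => exact (null_shiftRows G).symm
  | swapColumns G a b hab hu => exact (null_swapColumns hab hu).symm
  | swapRows G a b hab hu => exact (null_swapRows hab hu).symm
  | stabilizeSE G c => exact (null_stabilizeSE G c).symm
  | stabilizeNW G c => exact (null_stabilizeNW G c).symm

theorem null_iff_of_toLegendrian_eq {n n' : ℕ} {G : Grid n} {G' : Grid n'}
    (h : G.toLegendrian = G'.toLegendrian) : G.Null ↔ G'.Null := by
  have h' := Quot.eqvGen_exact h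
  generalize hD : (⟨n, G⟩ : Σ n, Grid n) = D at h'
  generalize hD' : (⟨n', G'⟩ : Σ n, Grid n) = D' at h'
  have key : D.2.Null ↔ D'.2.Null := by
    clear hD hD'
    induction h' with
    | rel _ _ h => exact h.null_iff
    | refl => exact Iff.rfl
    | symm _ _ _ ih => exact ih.symm
    | trans _ _ _ _ _ ih ih' => exact ih.trans ih'
  subst hD hD'
  exact key

end Grid

namespace Grid

/-! ### Lines of a cable -/

section Keep

variable {n p : ℕ}

/-- Line `i` of block `c`. -/
def unit (c : Fin n) (i : Fin p) : Fin (n * p) := finProdFinEquiv (c, i)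

theorem val_unit (c : Fin n) (i : Fin p) : (unit c i : ℕ) = i + p * c := rfl

theorem unit_inj {c c' : Fin n} {i i' : Fin p} : unit c i = unit c' i' ↔ c = c' ∧ i = i' := by
  rw [unit, unit, finProdFinEquiv.injective.eq_iff, Prod.mk.injEq]

theorem exists_unit (t : Fin (n * p)) : ∃ c i, unit c i = t :=
  ⟨(finProdFinEquiv.symm t).1, (finProdFinEquiv.symm t).2, finProdFinEquiv.apply_symm_apply t⟩

theorem eq_of_val_unit_mem {c c' : Fin n} {i : Fin p} (h : p * (c' : ℕ) ≤ unit c i)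
    (h' : (unit c i : ℕ) < p * c' + p) : c = c' := by
  have hp := i.2
  rw [val_unit] at h h'
  have e1 : ((i : ℕ) + p * c) / p = c := by
    rw [Nat.add_mul_div_left _ _ (by omega), Nat.div_eq_of_lt hp, zero_add]
  have e2 : ((i : ℕ) + p * c) / p = c' :=
    Nat.div_eq_of_lt_le (by rw [mul_comm]; exact h)
      (by rw [Nat.succ_mul, mul_comm (c' : ℕ)]; exact h')
  exact Fin.ext (e1.symm.trans e2)

/-- The lines that remain when lines `1, …, k c` of each block `c` are removed. -/
def keep (k : Fin n → ℕ) : Finset (Fin (n * p)) :=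
  Finset.univ.filter fun t => ((finProdFinEquiv.symm t).2 : ℕ) = 0 ∨
    k (finProdFinEquiv.symm t).1 < (finProdFinEquiv.symm t).2

theorem unit_mem_keep {k : Fin n → ℕ} {c : Fin n} {i : Fin p} :
    unit c i ∈ keep k ↔ (i : ℕ) = 0 ∨ k c < i := by
  rw [keep, Finset.mem_filter, unit, Equiv.symm_apply_apply]
  simp only [Finset.mem_univ, true_and]

theorem not_between_of_mem_keep {k : Fin n → ℕ} {t : Fin (n * p)} (h : t ∈ keep k) (c : Fin n) :
    ¬ (p * c < (t : ℕ) ∧ (t : ℕ) ≤ p * c + k c ∧ (t : ℕ) < p * c + p) := by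
  rintro ⟨h1, h2, h3⟩
  obtain ⟨c', i, rfl⟩ := exists_unit t
  obtain rfl := eq_of_val_unit_mem h1.le h3
  rw [unit_mem_keep] at h
  rw [val_unit] at h1 h2
  omega

theorem keep_zero : keep (0 : Fin n → ℕ) = (Finset.univ : Finset (Fin (n * p))) := by
  ext t
  obtain ⟨c, i, rfl⟩ := exists_unit t
  rw [unit_mem_keep]
  simp only [Pi.zero_apply, Finset.mem_univ, iff_true]
  omega

theorem keep_update {k : Fin n → ℕ} {c : Fin n} {j : Fin p} (hj : (j : ℕ) = k c + 1) :
    keep (Function.update k c (k c + 1)) = (keep k).erase (unit c j) := by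
  ext t
  obtain ⟨c', i, rfl⟩ := exists_unit t
  rw [Finset.mem_erase, unit_mem_keep, unit_mem_keep, Ne, unit_inj]
  by_cases h : c' = c
  · subst h
    rw [Function.update_self, Fin.ext_iff]
    omega
  · rw [Function.update_of_ne h]
    tauto

theorem image_keep {k : Fin n → ℕ} {X : Equiv.Perm (Fin (n * p))} {σ : Equiv.Perm (Fin n)}
    (hX : ∀ c i, X (unit c i) = unit (σ c) i) :
    (keep k).image X = keep (fun c => k (σ⁻¹ c)) := by
  ext t
  obtain ⟨c, i, rfl⟩ := exists_unit t
  obtain ⟨c, rfl⟩ := σ.surjective c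
  rw [← hX, Finset.mem_image]
  simp only [X.injective.eq_iff, exists_eq_right]
  rw [hX, unit_mem_keep, unit_mem_keep, perm_inv_apply]

theorem finRotate_unit {c : Fin n} {i i' : Fin p} (h : (i : ℕ) + 1 = i') :
    finRotate (n * p) (unit c i) = unit c i' := by
  refine finRotate_of_succ ?_
  rw [val_unit, val_unit]
  omega

/-- The line after `unit c j` is a later line of the same block or line `0` of the next one, and
lines `0` are never removed. -/
theorem finRotate_unit_mem_keep {k : Fin n → ℕ} {c : Fin n} {j : Fin p} (h : k c ≤ j) :
    finRotate (n * p) (unit c j) ∈ keep k := by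
  by_cases hj : (j : ℕ) + 1 < p
  · rw [finRotate_unit (i' := ⟨j + 1, hj⟩) rfl, unit_mem_keep]
    right
    show k c < (j : ℕ) + 1
    omega
  · obtain ⟨c', i, hi⟩ := exists_unit (finRotate (n * p) (unit c j))
    rw [← hi, unit_mem_keep]
    left
    have hv := congrArg Fin.val hi
    rw [val_finRotate] at hv
    split_ifs at hv with h1
    · rw [val_unit] at hv
      omega
    · rw [val_unit, val_unit] at hv
      have e1 : (i : ℕ) + p * c' = p * (c + 1) := by rw [hv, mul_add]; omega
      have e2 := congrArg (· % p) e1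
      simp only [Nat.add_mul_mod_self_left, Nat.mul_mod_right, Nat.mod_eq_of_lt i.2] at e2
      exact e2

theorem finRotate_mem_colStrips_univ {M : ℕ} (hM : 2 ≤ M) (c : Fin M) :
    (c, finRotate M c) ∈ colStrips Finset.univ :=
  finRotate_mem_colStrips (a := ⟨0, by omega⟩) (b := ⟨1, by omega⟩) rfl c

theorem mem_colStrips_of_univ {M : ℕ} {T : Finset (Fin M)} {a b : Fin M}
    (h : (a, b) ∈ colStrips Finset.univ) (ha : a ∈ T) (hb : b ∈ T) : (a, b) ∈ colStrips T := by
  rw [mem_colStrips] at h ⊢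
  exact ⟨ha, hb, h.2.2.1, fun c _ => h.2.2.2 c (Finset.mem_univ _)⟩

theorem unit_mem_colStrips_right {k : Fin n → ℕ} {c : Fin n} {j : Fin p} (hM : 2 ≤ n * p)
    (hj : k c < j) : (unit c j, finRotate (n * p) (unit c j)) ∈ colStrips (keep k) :=
  mem_colStrips_of_univ (finRotate_mem_colStrips_univ hM _) (unit_mem_keep.2 (Or.inr hj))
    (finRotate_unit_mem_keep hj.le)

theorem unit_mem_colStrips_left {k : Fin n → ℕ} {c : Fin n} {i₀ j : Fin p} (h₀ : (i₀ : ℕ) = 0)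
    (hj : (j : ℕ) = k c + 1) : (unit c i₀, unit c j) ∈ colStrips (keep k) := by
  rw [mem_colStrips]
  refine ⟨unit_mem_keep.2 (Or.inl h₀), unit_mem_keep.2 (Or.inr (by omega)), ?_, ?_⟩
  · rw [Ne, unit_inj, Fin.ext_iff]
    omega
  · intro t ht hne
    have h := not_between_of_mem_keep ht c
    have h1 := Fin.val_ne_of_ne hne
    have h2 := val_unit c i₀
    have h3 := val_unit c j
    have := j.2
    rw [inArc_iff]
    simp only [Fin.lt_def, Fin.le_def]
    omega

theorem inArc_unit {c : Fin n} {i₀ j : Fin p} (h₀ : (i₀ : ℕ) = 0) (t : Fin (n * p)) :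
    InArc (unit c i₀) (unit c j) t ↔ ∃ i, i < j ∧ t = unit c i := by
  constructor
  · intro h
    obtain ⟨c', i, rfl⟩ := exists_unit t
    have h2 := val_unit c i₀
    have h3 := val_unit c j
    have hj := j.2
    rw [inArc_iff] at h
    simp only [Fin.lt_def, Fin.le_def] at h
    obtain rfl : c' = c := eq_of_val_unit_mem (i := i) (by omega) (by omega)
    have h4 := val_unit c' i
    exact ⟨i, by rw [Fin.lt_def]; omega, rfl⟩
  · rintro ⟨i, hi, rfl⟩
    rw [inArc_iff]
    simp only [Fin.lt_def, Fin.le_def, val_unit] at hi ⊢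
    omega

/-- Boxes with sides on lines of `keep k` contain all or none of lines `0, …, k c` of block `c`. -/
theorem arcInd_unit_eq {k : Fin n → ℕ} {a b : Fin (n * p)} (ha : a ∈ keep k) (hb : b ∈ keep k)
    {c : Fin n} {i i' : Fin p} (hi : (i : ℕ) ≤ k c) (hi' : (i' : ℕ) ≤ k c) :
    arcInd a b (unit c i) = arcInd a b (unit c i') := by
  have h1 := not_between_of_mem_keep ha c
  have h2 := not_between_of_mem_keep hb c
  have h3 := val_unit c i
  have h4 := val_unit c i'
  have h5 := i.2
  have h6 := i'.2
  simp only [arcInd, inArc_iff, Fin.lt_def, Fin.le_def]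
  split_ifs <;> omega

end Keep

end Grid

namespace Grid

/-! ### Merging the strands of a cable -/

section Cable

variable {n p : ℕ} {G : Grid n} {C : Grid (n * p)} {blk : Fin n → Equiv.Perm (Fin p)}

/-- `C` arises from `G` by replacing each `X` by a diagonal block and each `O` by the
block `blk`. -/
structure IsCableGrid (G : Grid n) (C : Grid (n * p)) (blk : Fin n → Equiv.Perm (Fin p)) :
    Prop where
  X_unit : ∀ c i, C.X (unit c i) = unit (G.X c) i
  O_unit : ∀ c i, C.O (unit c i) = unit (G.O c) (blk c i)

variable {R : Type*} [CommRing R]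

/-- A multiple of `x⁺ + x⁻` is a boundary in the complex with lines `T`. -/
def StageNull (C : Grid n) (T : Finset (Fin n)) (V : Fin n → R) (ζ : R) : Prop :=
  ∃ v ∈ Finsupp.supported R R (compat T C.X), diff T (C.gridWeights V) v = ζ • C.etaChain R

theorem mono_gridWeights_spots (G : Grid n) (V : Fin n → R) (m : Fin n → Fin n → ℕ) :
    mono (G.gridWeights V) m = (∏ t, 0 ^ m t (G.X t)) * ∏ t, V t ^ m t (G.O t) := by
  have h : G.gridWeights V = fun c r => spots Finset.univ id G.X (fun _ => 0) c r *
      spots Finset.univ id G.O V c r := by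
    funext c r
    exact gridWeights_eq_spots G V c r
  rw [h, mono_mul, mono_spots, mono_spots]
  rfl

/-- The weights of the squares without the `X` markings of the columns in `S`. -/
def weightsOff (C : Grid n) (S : Finset (Fin n)) (V : Fin n → R) (s r : Fin n) : R :=
  spots Sᶜ id C.X (fun _ => 0) s r * spots Finset.univ id C.O V s r

theorem mono_weightsOff (C : Grid n) (S : Finset (Fin n)) (V : Fin n → R)
    (m : Fin n → Fin n → ℕ) : mono (weightsOff C S V) m =
      (∏ t ∈ Sᶜ, 0 ^ m t (C.X t)) * ∏ t, V t ^ m t (C.O t) := by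
  unfold weightsOff
  rw [mono_mul, mono_spots, mono_spots]
  rfl

theorem mono_gridWeights_eq_mul (C : Grid n) (S : Finset (Fin n)) (V : Fin n → R)
    (m : Fin n → Fin n → ℕ) : mono (C.gridWeights V) m =
      (∏ t ∈ S, 0 ^ m t (C.X t)) * mono (weightsOff C S V) m := by
  rw [mono_weightsOff, mono_gridWeights_spots, ← mul_assoc, Finset.prod_mul_prod_compl]

theorem mono_weightsOff_of_eq_zero {C : Grid n} {S : Finset (Fin n)} {V : Fin n → R}
    {m : Fin n → Fin n → ℕ} (h : ∀ t, m t (C.X t) ≠ 0 → t ∈ S) :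
    mono (weightsOff C S V) m = ∏ t, V t ^ m t (C.O t) := by
  rw [mono_weightsOff, Finset.prod_eq_one, one_mul]
  intro t ht
  rw [not_not.1 (mt (h t) (Finset.mem_compl.1 ht)), pow_zero]

/-- Lines `0, …, j` of block `c`. -/
def firstUnits (c : Fin n) (j : Fin p) : Finset (Fin (n * p)) :=
  Finset.univ.filter fun t => ∃ i ≤ j, t = unit c i

theorem mem_firstUnits {c : Fin n} {j : Fin p} {t : Fin (n * p)} :
    t ∈ firstUnits c j ↔ ∃ i ≤ j, t = unit c i := by
  simp [firstUnits]

namespace IsCableGrid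

theorem image_X (hC : IsCableGrid G C blk) (k : Fin n → ℕ) : (keep k).image C.X = keep fun c => k
    (G.X⁻¹ c) :=
  image_keep hC.X_unit

/-- Inside a diagonal block the north-east corner of one `X` is the south-west corner of the next.
So `x⁺` and `x⁻` agree off the first lines of the blocks and live in all the merged complexes. -/
theorem statePlus_mem_compat (hC : IsCableGrid G C blk) (k : Fin n → ℕ) : C.statePlus ∈ compat
    (keep k) C.X := by
  intro t ht
  obtain ⟨c, i, rfl⟩ := exists_unit t
  rw [unit_mem_keep, not_or] at ht
  have hi : ((⟨i - 1, by omega⟩ : Fin p) : ℕ) + 1 = i := by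
    show (i : ℕ) - 1 + 1 = i
    omega
  rw [← finRotate_unit hi, statePlus_finRotate, hC.X_unit, finRotate_unit hi, finRotate_unit hi,
    hC.X_unit]

theorem etaChain_mem (hC : IsCableGrid G C blk) (k : Fin n → ℕ) :
    C.etaChain R ∈ Finsupp.supported R R (compat (keep k) C.X) :=
  add_mem (Finsupp.single_mem_supported _ _ (hC.statePlus_mem_compat k))
    (Finsupp.single_mem_supported _ _ fun _ _ => rfl)

variable {k : Fin n → ℕ} {c : Fin n} {i j : Fin p}

theorem mem_keep_of_compat (hC : IsCableGrid G C blk) {T : Finset (Fin (n * p))} (hT : T ⊆ keep k)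
    {x : State (n * p)}
    (hx : x ∈ compat T C.X) {a : Fin (n * p)} (ha : a ∈ T) : x a ∈ keep fun c => k (G.X⁻¹ c) := by
  rw [← hC.image_X]
  refine Finset.image_subset_image hT ?_
  rw [← image_compat hx]
  exact Finset.mem_image_of_mem _ ha

/-- A rectangle with corners on kept lines contains all or none of the diagonal squares of lines `0,
…, k c`, so their `X`s act as the one south-west of the new point. Taking the `X`s in `firstUnits c
j` out of the weights leaves no zeros in the adjoining strips, whose weights become products of
variables. -/
theorem diff_weightsOff (hC : IsCableGrid G C blk) (hi : (i : ℕ) = k c) (hj : (j : ℕ) = k c + 1)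
    {T : Finset (Fin (n * p))}
    (hT : T ⊆ keep k) (V : Fin (n * p) → R) {v : State (n * p) →₀ R}
    (hv : v ∈ Finsupp.supported R R (compat T C.X)) :
    diff T (cornerWeights (weightsOff C (firstUnits c j) V) (unit c i) (unit c j) (unit (G.X c) i)
      (unit (G.X c) j) 1 1) v = diff T (C.gridWeights V) v := by
  refine domOp_eq_of_supported (fun x hx a b => ?_) hv
  by_cases hab : (a, b) ∈ freeRects T x
  · rw [if_pos hab, if_pos hab, mono_cornerWeights,
      mono_gridWeights_eq_mul C (firstUnits c j), one_pow, one_pow, mul_one, mul_one]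
    have ha := (freeRects_ends hab).1
    have hb := (freeRects_ends hab).2
    set m := box a b (x a) (x b) with hm
    have hsame : ∀ i' : Fin p, (i' : ℕ) ≤ k c →
        m (unit c i') (C.X (unit c i')) = m (unit c i) (unit (G.X c) i) := by
      intro i' hi'
      rw [hm, hC.X_unit, box, box, arcInd_unit_eq (hT ha) (hT hb) hi' hi.le,
        arcInd_unit_eq (hC.mem_keep_of_compat hT hx ha) (hC.mem_keep_of_compat hT hx hb) (i' := i)]
      · rwa [perm_inv_apply]
      · rw [perm_inv_apply]; exact hi.le
    have key : (∏ t ∈ firstUnits c j, (0 : R) ^ m t (C.X t)) =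
        0 ^ m (unit c i) (unit (G.X c) i) * 0 ^ m (unit c j) (unit (G.X c) j) := by
      by_cases h0 : m (unit c i) (unit (G.X c) i) = 0
      · rw [h0, pow_zero, one_mul, Finset.prod_eq_single (unit c j), hC.X_unit]
        · intro t ht hne
          obtain ⟨i', hi', rfl⟩ := mem_firstUnits.1 ht
          have : (i' : ℕ) ≠ j := fun h => hne (by rw [Fin.ext h])
          rw [hsame i' (by rw [Fin.le_def] at hi'; omega), h0, pow_zero]
        · intro h
          exact absurd (mem_firstUnits.2 ⟨j, le_rfl, rfl⟩) h
      · rw [zero_pow h0, zero_mul]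
        refine Finset.prod_eq_zero (i := unit c i) (mem_firstUnits.2 ⟨i, ?_, rfl⟩) ?_
        · rw [Fin.le_def]; omega
        · rw [hC.X_unit, zero_pow h0]
    rw [key]
    ring
  · rw [if_neg hab, if_neg hab]

/-- Merging line `k c + 1` of block `c` with the previous ones. -/
theorem exists_merge_unit (hC : IsCableGrid G C blk) [CharP R 2] {i₀ : Fin p} (h₀ : (i₀ : ℕ) = 0)
    (hj : (j : ℕ) = k c + 1)
    {V : Fin (n * p) → R} {ζ : R} (h : C.StageNull (keep k) V ζ) :
    let D := diff (keep (Function.update k c (k c + 1))) (C.gridWeights V)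
    let S := Finsupp.supported R R (compat (keep (Function.update k c (k c + 1))) C.X)
    ∃ d ∈ S, ∃ e ∈ S, ∃ f ∈ S, ∃ g ∈ S, ∃ h ∈ S,
      D d + e + f = ζ • C.etaChain R ∧ D f = 0 ∧
      D g = (∏ t, V t ^ arcInd (unit c i₀) (unit c j) t) • f +
        (∏ t, V t ^ arcInd (unit (G.X c) i₀) (unit (G.X c) j) (C.O t)) • e ∧
      D h = V (unit c j) • e + V (C.O⁻¹ (unit (G.X c) j)) • f := by
  intro D S
  obtain ⟨v, hv, hvζ⟩ := h
  have hjp := j.2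
  have hM : 2 ≤ n * p := by
    have hn : 1 ≤ n := by have := c.2; omega
    calc 2 ≤ p := by omega
      _ = 1 * p := (one_mul p).symm
      _ ≤ n * p := Nat.mul_le_mul_right p hn
  obtain ⟨i, hi⟩ : ∃ i : Fin p, (i : ℕ) = k c := ⟨⟨k c, by omega⟩, rfl⟩
  have hZ : C.X (unit c j) = unit (G.X c) j := hC.X_unit c j
  have ha : (unit c i : ℕ) + 1 = unit c j := by rw [val_unit, val_unit]; omega
  have hs : (unit (G.X c) i : ℕ) + 1 = unit (G.X c) j := by rw [val_unit, val_unit]; omega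
  have ha₀ : unit c j ∈ keep k := unit_mem_keep.2 (Or.inr (by omega))
  have hL := unit_mem_colStrips_left (c := c) h₀ hj
  have hR := unit_mem_colStrips_right (c := c) (j := j) (k := k) hM (by omega)
  have hsL := unit_mem_colStrips_left (k := fun c => k (G.X⁻¹ c)) (c := G.X c) (j := j) h₀
    (by rwa [perm_inv_apply])
  have hsR := unit_mem_colStrips_right (k := fun c => k (G.X⁻¹ c)) (c := G.X c) (j := j) hM
    (by rw [perm_inv_apply]; omega)
  have hR1 := arcInd_univ (finRotate_mem_colStrips_univ hM (unit c j))
  have hsR1 := arcInd_univ (finRotate_mem_colStrips_univ hM (unit (G.X c) j))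
  rw [← hC.image_X] at hsL hsR
  have hk := keep_update (c := c) hj
  have hsub : (keep k).erase (unit c j) ⊆ keep k := Finset.erase_subset _ _
  have hη := Submodule.smul_mem _ ζ (hC.etaChain_mem (R := R) (Function.update k c (k c + 1)))
  simp only [D, S, hk] at hη ⊢
  obtain ⟨d, hd, e, he, f, hf, g, hg, h, hh, k1, k2, k3, k4⟩ :=
    -- North-west and south-east of the point are off-diagonal squares of an `X` block; they are
    -- unmarked, so `σ₁ = σ₂ = 1`.
    exists_merge ha hs ha₀ hZ hL hR hsL hsR 1 1 hv hη
      ((hC.diff_weightsOff hi hj subset_rfl V hv).trans hvζ)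
  rw [hC.diff_weightsOff hi hj hsub V hd, one_smul, one_smul] at k1
  rw [hC.diff_weightsOff hi hj hsub V hf] at k2
  rw [hC.diff_weightsOff hi hj hsub V hg, colMono, rowMono, mono_weightsOff_of_eq_zero,
    mono_weightsOff_of_eq_zero] at k3
  · rw [hC.diff_weightsOff hi hj hsub V hh, colMono, rowMono, mono_weightsOff_of_eq_zero,
      mono_weightsOff_of_eq_zero] at k4
    · refine ⟨d, hd, e, he, f, hf, g, hg, h, hh, k1, k2, k3, k4.trans ?_⟩
      congr 2
      · rw [Finset.prod_eq_single (unit c j)]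
        · rw [hR1, if_pos rfl, pow_one]
        · intro t _ ht
          rw [hR1, if_neg ht, pow_zero]
        · simp
      · rw [Finset.prod_eq_single (C.O⁻¹ (unit (G.X c) j))]
        · rw [hsR1, show C.O (C.O⁻¹ _) = _ from C.O.apply_symm_apply _, if_pos rfl, pow_one]
        · intro t _ ht
          rw [hsR1, if_neg, pow_zero]
          rw [← Equiv.Perm.eq_inv_iff_eq]
          exact ht
        · simp
    · intro t ht
      rw [hsR1] at ht
      refine mem_firstUnits.2 ⟨j, le_rfl, C.X.injective ?_⟩
      rw [hC.X_unit]
      by_contra h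
      exact ht (if_neg h)
    · intro t ht
      rw [hR1] at ht
      refine mem_firstUnits.2 ⟨j, le_rfl, ?_⟩
      by_contra h
      exact ht (if_neg h)
  · intro t ht
    rw [arcInd, ite_ne_right_iff, inArc_unit h₀] at ht
    obtain ⟨⟨i', hi', h⟩, -⟩ := ht
    exact mem_firstUnits.2 ⟨i', hi'.le, C.X.injective (h.trans (hC.X_unit c i').symm)⟩
  · intro t ht
    rw [arcInd, ite_ne_right_iff, inArc_unit h₀] at ht
    obtain ⟨⟨i', hi', h⟩, -⟩ := ht
    exact mem_firstUnits.2 ⟨i', hi'.le, h⟩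

end IsCableGrid

end Cable

end Grid

namespace Grid

/-! ### Homotopies between the variables along a component -/

section Homotopy

variable {M : ℕ} {R : Type*} [CommRing R]

theorem arcInd_ne_zero_iff {T : Finset (Fin M)} {a b t u : Fin M} (hab : (a, b) ∈ colStrips T)
    (htu : (t, u) ∈ colStrips T) (hu : ∀ s, InArc t u s ↔ s = t) : arcInd a b t = 1 ↔ a = t := by
  rw [mem_colStrips] at hab htu
  rw [arcInd, ite_eq_left_iff]
  constructor
  · intro h
    by_contra hne
    exact hab.2.2.2 t htu.1 (Ne.symm hne) (by_contra fun h' => absurd (h h') (by simp))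
  · rintro rfl h
    exact absurd (inArc_left hab.2.2.1) h

theorem sum_strips_eq {T : Finset (Fin M)} {t u : Fin M} (htu : (t, u) ∈ colStrips T)
    (hu : ∀ s, InArc t u s ↔ s = t) (g : Fin M → Fin M → R) :
    (∑ r ∈ colStrips T, if arcInd r.1 r.2 t = 1 then g r.1 r.2 else 0) = g t u := by
  rw [Finset.sum_eq_single (t, u)]
  · rw [if_pos ((arcInd_ne_zero_iff htu htu hu).2 rfl)]
  · rintro ⟨a, b⟩ hab hne
    rw [if_neg]
    intro h
    obtain rfl := (arcInd_ne_zero_iff hab htu hu).1 h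
    exact hne (by rw [colStrips_right_unique hab htu])
  · exact fun h => absurd htu h

/-- The variables of the column and of the row of an `X` marking differ by a boundary on cycles. -/
theorem exists_diff_eq_add [CharP R 2] (C : Grid M) (V : Fin M → R) {T : Finset (Fin M)} {t u v :
    Fin M}
    (hu : (t, u) ∈ colStrips T) (hu' : ∀ s, InArc t u s ↔ s = t)
    (hv : (C.X t, v) ∈ colStrips (T.image C.X)) (hv' : ∀ s, InArc (C.X t) v s ↔ s = C.X t)
    {f : State M →₀ R} (hf : f ∈ Finsupp.supported R R (compat T C.X))
    (h : diff T (C.gridWeights V) f = 0) :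
    ∃ f' ∈ Finsupp.supported R R (compat T C.X),
      diff T (C.gridWeights V) f' = (V t + V (C.O⁻¹ (C.X t))) • f := by
  set ω := weightsOff C {t} V with hω
  -- The homotopy counts the rectangles through this `X` of multiplicity one, ignoring its weight
  -- zero.
  set θ : (Fin M → Fin M → ℕ) → R := fun m => if m t (C.X t) = 1 then mono ω m else 0 with hθ
  have hg : ∀ m, mono (C.gridWeights V) m = 0 ^ m t (C.X t) * mono ω m := fun m => by
    rw [mono_gridWeights_eq_mul C {t}, Finset.prod_singleton]
  have hΘ : ∀ m m', mono (C.gridWeights V) m * θ m' + θ m * mono (C.gridWeights V) m' =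
      θ (m + m') := by
    intro m m'
    simp only [hθ, hg, mono_add, Pi.add_apply]
    generalize m t (C.X t) = p
    generalize m' t (C.X t) = q
    rcases p with _ | _ | p <;> rcases q with _ | _ | q <;> simp [show ∀ a b : ℕ,
      a + 1 + 1 + (b + 1) ≠ 1 by intros; omega]
  refine ⟨domOp T θ f, domOp_mem_supported (fun x hx a b hab => Or.inr (compat_swap hx
    (freeRects_ends hab).1 (freeRects_ends hab).2)) hf, ?_⟩
  have key : (diff T (C.gridWeights V) ∘ₗ domOp T θ + domOp T θ ∘ₗ diff T (C.gridWeights V)) f =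
      ((V t + V (C.O⁻¹ (C.X t))) • (LinearMap.id : (State M →₀ R) →ₗ[R] (State M →₀ R))) f := by
    refine linearMap_eq_of_supported (fun x hx => ?_) hf
    simp only [LinearMap.add_apply, LinearMap.comp_apply, LinearMap.smul_apply, LinearMap.id_apply]
    rw [add_comm]
    refine (domOp_domOp_add_two T hΘ x).trans ?_
    rw [image_compat hx]
    congr 1
    refine congrArg₂ (· + ·) ?_ ?_
    · refine (sum_strips_eq hu hu' (fun a b => mono ω fun c _ => arcInd a b c)).trans ?_
      have hi : ∀ s, arcInd t u s = if s = t then 1 else 0 := fun s => if_congr (hu' s) rfl rfl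
      rw [hω, mono_weightsOff_of_eq_zero]
      · rw [Finset.prod_eq_single t]
        · rw [hi, if_pos rfl, pow_one]
        · intro s _ hs
          rw [hi, if_neg hs, pow_zero]
        · simp
      · intro s hs
        rw [Finset.mem_singleton]
        by_contra hne
        exact hs (by rw [hi, if_neg hne])
    · refine (sum_strips_eq hv hv' (fun a b => mono ω fun _ r => arcInd a b r)).trans ?_
      have hi : ∀ s, arcInd (C.X t) v s = if s = C.X t then 1 else 0 :=
        fun s => if_congr (hv' s) rfl rfl
      rw [hω, mono_weightsOff_of_eq_zero]
      · rw [Finset.prod_eq_single (C.O⁻¹ (C.X t))]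
        · rw [hi, show C.O (C.O⁻¹ _) = _ from C.O.apply_symm_apply _, if_pos rfl, pow_one]
        · intro s _ hs
          rw [hi, if_neg, pow_zero]
          rwa [← Equiv.Perm.eq_inv_iff_eq]
        · simp
      · intro s hs
        rw [Finset.mem_singleton]
        by_contra hne
        exact hs (by rw [hi, if_neg (C.X.injective.ne hne)])
  simpa [h] using key

end Homotopy

section Cable

variable {n p : ℕ} {G : Grid n} {C : Grid (n * p)} {blk : Fin n → Equiv.Perm (Fin p)}
  {R : Type*} [CommRing R] [CharP R 2]

namespace IsCableGrid

theorem O_inv_unit (hC : IsCableGrid G C blk) (c : Fin n) (i : Fin p) :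
    ∃ i', C.O⁻¹ (unit c i) = unit (G.O⁻¹ c) i' := by
  refine ⟨(blk (G.O⁻¹ c))⁻¹ i, ?_⟩
  rw [Equiv.Perm.inv_eq_iff_eq, hC.O_unit]
  congr 1
  · exact (G.O.apply_symm_apply c).symm
  · exact ((blk _).apply_symm_apply i).symm

variable {k : Fin n → ℕ} {V : Fin (n * p) → R} {f : State (n * p) →₀ R}

/-- As nothing is merged in block `c`, the strip after each of its lines is a single column, and
likewise for the rows of its `X`s. So the homotopy relates just one variable to one other. -/
theorem exists_diff_unit (hC : IsCableGrid G C blk) (hp : 2 ≤ p) {c : Fin n} (hc : k c = 0)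
    (i : Fin p) (hf : f ∈ Finsupp.supported R R (compat (keep k) C.X))
    (h : diff (keep k) (C.gridWeights V) f = 0) :
    ∃ f' ∈ Finsupp.supported R R (compat (keep k) C.X), diff (keep k) (C.gridWeights V) f' =
      (V (unit c i) + V (C.O⁻¹ (unit (G.X c) i))) • f := by
  have hM : 2 ≤ n * p := by
    have hn : 1 ≤ n := by have := c.2; omega
    calc 2 ≤ p := hp
      _ = 1 * p := (one_mul p).symm
      _ ≤ n * p := Nat.mul_le_mul_right p hn
  have hs := finRotate_mem_colStrips_univ hM (unit c i)
  have hs' := finRotate_mem_colStrips_univ hM (unit (G.X c) i)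
  rw [← hC.X_unit] at hs' ⊢
  refine exists_diff_eq_add C V (u := finRotate _ (unit c i)) (v := finRotate _ (C.X (unit c i)))
    (mem_colStrips_of_univ hs (unit_mem_keep.2 (by omega))
      (finRotate_unit_mem_keep (by omega))) (mem_colStrips_univ.1 hs).2
    (mem_colStrips_of_univ hs' ?_ ?_) (mem_colStrips_univ.1 hs').2 hf h
  · rw [hC.image_X, hC.X_unit, unit_mem_keep, perm_inv_apply]
    omega
  · rw [hC.image_X, hC.X_unit]
    refine finRotate_unit_mem_keep ?_
    rw [perm_inv_apply]
    omega

/-- If the other blocks of the component of block `b` are unmerged and the variables of block `b`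
coincide, then the variables of all blocks of the component act in the same way on homology. -/
theorem exists_diff_sameCycle (hC : IsCableGrid G C blk) (hp : 2 ≤ p) {b : Fin n} {U : R}
    (hV : ∀ i, V (unit b i) = U)
    (hk : ∀ c, (G.X⁻¹ * G.O).SameCycle c b → c ≠ b → k c = 0)
    (hf : f ∈ Finsupp.supported R R (compat (keep k) C.X))
    (h : diff (keep k) (C.gridWeights V) f = 0) (m : ℕ) {c : Fin n}
    (hc : ((G.X⁻¹ * G.O) ^ m) b = c) (i : Fin p) :
    ∃ f' ∈ Finsupp.supported R R (compat (keep k) C.X), diff (keep k) (C.gridWeights V) f' =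
      (V (unit c i) + U) • f := by
  induction m generalizing c i with
  | zero =>
    rw [pow_zero, Equiv.Perm.one_apply] at hc
    subst hc
    exact ⟨0, Submodule.zero_mem _, by rw [hV, CharTwo.add_self_eq_zero, zero_smul, map_zero]⟩
  | succ m ih =>
    by_cases hcb : c = b
    · subst hcb
      exact ⟨0, Submodule.zero_mem _, by rw [hV, CharTwo.add_self_eq_zero, zero_smul, map_zero]⟩
    -- The row of the `X` holds an `O` of the preceding block, to which the induction hypothesis
    -- applies.
    obtain ⟨i', hi'⟩ := hC.O_inv_unit (G.X c) i
    rw [pow_succ', Equiv.Perm.mul_apply] at hc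
    have hc' : ((G.X⁻¹ * G.O) ^ m) b = G.O⁻¹ (G.X c) := by
      rw [Equiv.Perm.eq_inv_iff_eq, ← hc, Equiv.Perm.mul_apply]
      exact (G.X.apply_symm_apply _).symm
    obtain ⟨f₁, hf₁, h₁⟩ := ih hc' i'
    have hs : (G.X⁻¹ * G.O).SameCycle c b := by
      refine Equiv.Perm.SameCycle.symm ⟨(m + 1 : ℕ), ?_⟩
      rw [zpow_natCast, pow_succ', Equiv.Perm.mul_apply, hc]
    obtain ⟨f₂, hf₂, h₂⟩ := hC.exists_diff_unit hp (hk c hs hcb) i hf h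
    refine ⟨f₁ + f₂, add_mem hf₁ hf₂, ?_⟩
    rw [map_add, h₁, h₂, hi', ← add_smul]
    congr 1
    linear_combination CharTwo.add_self_eq_zero (V (unit (G.O⁻¹ (G.X c)) i'))

/-- Multiplying the merge relation by `U` and adding `h` removes `e`. What is left is `f` times the
sum of `U` and a variable of the preceding block. These act alike on the cycle `f`, because the walk
from `c` around its component to that block meets only unmerged blocks. -/
theorem stageNull_base (hC : IsCableGrid G C blk) {c : Fin n} {j : Fin p} (hj : (j : ℕ) = k c + 1)
    {U ζ : R} (hV : ∀ i, V (unit c i) = U)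
    (hk : ∀ c', (G.X⁻¹ * G.O).SameCycle c' c → c' ≠ c → k c' = 0)
    (h : C.StageNull (keep k) V ζ) :
    C.StageNull (keep (Function.update k c (k c + 1))) V (U * ζ) := by
  have hjp := j.2
  obtain ⟨d, hd, e, he, f, hf, -, -, h, hh, k1, k2, -, k4⟩ :=
    hC.exists_merge_unit (i₀ := ⟨0, by omega⟩) rfl hj h
  obtain ⟨i', hi'⟩ := hC.O_inv_unit (G.X c) j
  have hs : (G.X⁻¹ * G.O).SameCycle c (G.O⁻¹ (G.X c)) := by
    refine ⟨-1, ?_⟩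
    rw [zpow_neg_one, mul_inv_rev, inv_inv, Equiv.Perm.mul_apply]
  obtain ⟨m, -, hm⟩ := hs.exists_pow_eq'
  obtain ⟨f', hf', hf''⟩ := hC.exists_diff_sameCycle (by omega) hV (k := Function.update k c (k c +
    1))
    (fun c' hs hne => by rw [Function.update_of_ne hne]; exact hk c' hs hne) hf k2 m
    hm i'
  refine ⟨U • d + h + f', add_mem (add_mem (Submodule.smul_mem _ _ hd) hh) hf', ?_⟩
  rw [map_add, map_add, map_smul, k4, hf'', hi', hV, mul_smul, ← k1]
  have key := chain_add_self (V (unit (G.O⁻¹ (G.X c)) i') • f)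
  refine Eq.trans ?_ ((congrArg (U • (diff (keep (Function.update k c (k c + 1)))
    (C.gridWeights V) d + e + f) + ·) key).trans (add_zero _))
  module

end IsCableGrid

end Cable

end Grid

namespace Grid

/-! ### Semilinear maps on coefficients, and quadratic extensions -/

section Transfer

variable {M : ℕ} {R S : Type*} [CommRing R] [CommRing S]

theorem diff_mapRange_of_semilinear (f : R →+* S) (β : S →+ R) (h : ∀ r s, β (f r * s) = r * β s)
    (T : Finset (Fin M)) (ω : Fin M → Fin M → R) (v : State M →₀ S) :
    diff T ω (Finsupp.mapRange.addMonoidHom β v) =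
      Finsupp.mapRange.addMonoidHom β (diff T (fun c r => f (ω c r)) v) := by
  induction v using Finsupp.induction_linear with
  | zero => simp
  | add u v hu hv => rw [map_add, map_add, hu, hv, map_add, map_add]
  | single x k =>
    rw [diff_single, map_sum]
    simp only [Finsupp.mapRange.addMonoidHom_apply, Finsupp.mapRange_single]
    rw [diff_single]
    refine Finset.sum_congr rfl fun r _ => ?_
    rw [mono_map, mul_comm k, h, mul_comm]

/-- `β` need not be multiplicative. It commutes with the differential because the weights come from
`R`, and it only changes the multiple, since the coefficients of `x⁺ + x⁻` are `1`. -/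
theorem StageNull.of_semilinear {C : Grid M} {T : Finset (Fin M)} {V : Fin M → R} {ζ : S}
    (f : R →+* S) (β : S →+ R) (h : ∀ r s, β (f r * s) = r * β s)
    (hV : C.StageNull T (fun t => f (V t)) ζ) : C.StageNull T V (β ζ) := by
  obtain ⟨v, hv, hζ⟩ := hV
  refine ⟨Finsupp.mapRange.addMonoidHom β v, ?_, ?_⟩
  · rw [Finsupp.mem_supported] at hv ⊢
    exact (Finset.coe_subset.2 (Finsupp.support_mapRange (hf := map_zero β))).trans hv
  · have hw : C.gridWeights (fun t => f (V t)) = fun c r => f (C.gridWeights V c r) := by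
      funext c r
      simp only [gridWeights]
      split_ifs <;> simp
    rw [hw] at hζ
    rw [diff_mapRange_of_semilinear f β h, hζ]
    simp only [etaChain, smul_add, map_add, Finsupp.smul_single, smul_eq_mul, mul_one,
      Finsupp.mapRange.addMonoidHom_apply, Finsupp.mapRange_single]

end Transfer

section QuadraticAlgebra

variable {R : Type*} [CommRing R] (a b : R)

/-- The root and its conjugate have product `a` and sum `b`; signs do not matter in characteristic
two. -/
theorem quadraticAlgebra_root [CharP R 2] : (⟨0, 1⟩ : QuadraticAlgebra R a b) *
    (⟨0, 1⟩ + algebraMap R _ b) = algebraMap R _ a := by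
  ext <;> simp [QuadraticAlgebra.algebraMap_eq, CharTwo.add_self_eq_zero]

/-- The coordinate of the root is a functional with value `1` on `root + r` for every scalar `r`. -/
theorem im_root_add_mul (r s : R) : QuadraticAlgebra.imₗ a b
    ((⟨0, 1⟩ + algebraMap R (QuadraticAlgebra R a b) r) * algebraMap R _ s) = s := by
  simp [QuadraticAlgebra.algebraMap_eq, QuadraticAlgebra.imₗ]

theorem im_algebraMap_mul (r : R) (s : QuadraticAlgebra R a b) : QuadraticAlgebra.imₗ a b
    (algebraMap R _ r * s) = r * QuadraticAlgebra.imₗ a b s := by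
  simp [QuadraticAlgebra.algebraMap_eq, QuadraticAlgebra.imₗ]

end QuadraticAlgebra

section Cable

variable {n p : ℕ} {G : Grid n} {C : Grid (n * p)} {blk : Fin n → Equiv.Perm (Fin p)}

namespace IsCableGrid

/-- When the strands of block `c` and of the next block are merged, only the product of the
variables of block `c` matters. -/
theorem diff_congr_of_mul_eq {R : Type*} [CommRing R] (hC : IsCableGrid G C blk) {k : Fin n → ℕ}
    {c : Fin n} {i j : Fin p} (hij : i ≠ j) (hi : (i : ℕ) ≤ k c) (hj : (j : ℕ) ≤ k c)
    (hk : p ≤ k (G.X⁻¹ (G.O c)) + 1) {V V' : Fin (n * p) → R}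
    (hV : ∀ t, t ≠ unit c i → t ≠ unit c j → V t = V' t)
    (hmul : V (unit c i) * V (unit c j) = V' (unit c i) * V' (unit c j))
    {v : State (n * p) →₀ R} (hv : v ∈ Finsupp.supported R R (compat (keep k) C.X)) :
    diff (keep k) (C.gridWeights V) v = diff (keep k) (C.gridWeights V') v := by
  refine domOp_eq_of_supported (fun x hx a b => ?_) hv
  by_cases hab : (a, b) ∈ freeRects (keep k) x
  · rw [if_pos hab, if_pos hab, mono_gridWeights_spots, mono_gridWeights_spots]
    congr 1
    have ha := (freeRects_ends hab).1
    have hb := (freeRects_ends hab).2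
    set m := box a b (x a) (x b) with hm
    have hsame : m (unit c i) (C.O (unit c i)) = m (unit c j) (C.O (unit c j)) := by
      have h1 := (blk c i).2
      have h2 := (blk c j).2
      rw [hm, hC.O_unit, hC.O_unit, box, box, arcInd_unit_eq ha hb hi hj,
        arcInd_unit_eq (hC.mem_keep_of_compat subset_rfl hx ha)
          (hC.mem_keep_of_compat subset_rfl hx hb)] <;> omega
    have hu : unit c i ≠ unit c j := by
      rw [Ne, unit_inj]
      tauto
    rw [← Finset.mul_prod_erase _ _ (Finset.mem_univ (unit c i)),
      ← Finset.mul_prod_erase _ _ (Finset.mem_univ (unit c i)),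
      ← Finset.mul_prod_erase (Finset.univ.erase _) _ (Finset.mem_erase.2
        ⟨hu.symm, Finset.mem_univ (unit c j)⟩),
      ← Finset.mul_prod_erase (Finset.univ.erase _) _ (Finset.mem_erase.2
        ⟨hu.symm, Finset.mem_univ (unit c j)⟩), ← mul_assoc, ← mul_assoc, hsame, ← mul_pow,
      ← mul_pow, hmul]
    congr 1
    refine Finset.prod_congr rfl fun t ht => ?_
    rw [Finset.mem_erase, Finset.mem_erase] at ht
    rw [hV t ht.2.1 ht.1]
  · rw [if_neg hab, if_neg hab]

universe u

variable {R : Type u} [CommRing R] [CharP R 2]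

/-- The merge is balanced if the first and the last merged variable have sum `ρ + ρ'`, the weights
contributed by the rows. Once the rows of the next block are merged only the product of the two
matters, so over a quadratic extension they can be replaced by factors with this sum. -/
theorem stageNull_step (hC : IsCableGrid G C blk) {k : Fin n → ℕ} {c : Fin n} {j : Fin p}
    (hj : (j : ℕ) = k c + 1) (hk : p ≤ k (G.X⁻¹ (G.O c)) + 1) {V : Fin (n * p) → R} {ζ : R}
    (hV : ∀ i : Fin p, 1 ≤ (i : ℕ) → (i : ℕ) ≤ k c + 1 → V (unit c i) = 1)
    (h : ∀ (S : Type u) [CommRing S] [CharP S 2] [Algebra R S] (V' : Fin (n * p) → S),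
      (∀ c' i, c' ≠ c → V' (unit c' i) = algebraMap R S (V (unit c' i))) →
      (∀ i : Fin p, 1 ≤ (i : ℕ) → (i : ℕ) ≤ k c → V' (unit c i) = 1) →
      C.StageNull (keep k) V' (algebraMap R S ζ)) :
    C.StageNull (keep (Function.update k c (k c + 1))) V ζ := by
  have hjp := j.2
  set i₀ : Fin p := ⟨0, by omega⟩ with hi₀
  have hi₀' : (i₀ : ℕ) = 0 := rfl
  have hij : i₀ ≠ j := fun h => by rw [← h] at hj; simp [hi₀] at hj
  set ρ := ∏ t, V t ^ arcInd (unit (G.X c) i₀) (unit (G.X c) j) (C.O t) with hρ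
  set ρ' := V (C.O⁻¹ (unit (G.X c) j)) with hρ'
  -- In `S` the value of the first variable factors as `v * v'` with `v + v' = ρ + ρ'`.
  let S := QuadraticAlgebra R (V (unit c i₀)) (ρ + ρ')
  have : CharP S 2 := charP_of_injective_algebraMap QuadraticAlgebra.algebraMap_injective 2
  set v : S := ⟨0, 1⟩ with hv
  set v' : S := v + algebraMap R S (ρ + ρ') with hv'
  have hu : unit c i₀ ≠ unit c j := by
    rw [Ne, unit_inj]
    tauto
  set V' : Fin (n * p) → S := fun t =>
    if t = unit c i₀ then v else if t = unit c j then v' else algebraMap R S (V t) with hV'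
  have e₀ : V' (unit c i₀) = v := if_pos rfl
  have e₁ : V' (unit c j) = v' := by rw [hV']; exact (if_neg hu.symm).trans (if_pos rfl)
  have e₂ : ∀ t, t ≠ unit c i₀ → t ≠ unit c j → V' t = algebraMap R S (V t) := fun t h1 h2 =>
    (if_neg h1).trans (if_neg h2)
  have e₃ : ∀ c' i, c' ≠ c → V' (unit c' i) = algebraMap R S (V (unit c' i)) := fun c' i hc =>
    e₂ _ (by rw [Ne, unit_inj]; tauto) (by rw [Ne, unit_inj]; tauto)
  have e₄ : ∀ i : Fin p, 1 ≤ (i : ℕ) → (i : ℕ) ≤ k c → V' (unit c i) = 1 := by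
    intro i h1 h2
    rw [e₂, hV i h1 (by omega), map_one]
    · rw [Ne, unit_inj, Fin.ext_iff]
      omega
    · rw [Ne, unit_inj, Fin.ext_iff]
      omega
  have hXO : G.O⁻¹ (G.X c) ≠ c := by
    rw [Ne, Equiv.Perm.inv_eq_iff_eq]
    exact G.disjoint c
  obtain ⟨d, hd, e, he, f, hf, g, hg, l, hl, k1, k2, k3, k4⟩ :=
    hC.exists_merge_unit (i₀ := i₀) rfl hj (h S V' e₃ e₄)
  have hγ : ∏ t, V' t ^ arcInd (unit c i₀) (unit c j) t = v := by
    rw [Finset.prod_eq_single (unit c i₀), e₀, arcInd, if_pos (inArc_left hu), pow_one]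
    · intro t _ ht
      rw [arcInd]
      split_ifs with h1
      · obtain ⟨i, hi, rfl⟩ := (inArc_unit rfl _).1 h1
        have h2 : (i : ℕ) ≠ 0 := fun h => ht (by rw [show i = i₀ from Fin.ext h])
        rw [Fin.lt_def] at hi
        rw [e₄ i (by omega) (by omega), one_pow]
      · rw [pow_zero]
    · simp
  have hρS : ∏ t, V' t ^ arcInd (unit (G.X c) i₀) (unit (G.X c) j) (C.O t) = algebraMap R S ρ := by
    refine Eq.trans ?_ (map_prod (algebraMap R S) _ _).symm
    refine Finset.prod_congr rfl fun t _ => ?_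
    rw [map_pow, arcInd]
    split_ifs with h1
    · obtain ⟨i, hi, h2⟩ := (inArc_unit rfl _).1 h1
      obtain ⟨i', hi'⟩ := hC.O_inv_unit (G.X c) i
      rw [← Equiv.Perm.eq_inv_iff_eq, hi'] at h2
      rw [h2, e₃ _ _ hXO]
    · rw [pow_zero, pow_zero]
  have hρS' : V' (C.O⁻¹ (unit (G.X c) j)) = algebraMap R S ρ' := by
    obtain ⟨i', hi'⟩ := hC.O_inv_unit (G.X c) j
    refine e₂ _ ?_ ?_ <;> rw [hi', Ne, unit_inj] <;> tauto
  rw [hγ, hρS] at k3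
  rw [e₁, hρS'] at k4
  have h2 : (2 : S) = 0 := CharTwo.two_eq_zero
  -- In the boundary of `(v + ρ') d + g + l` the terms in `f` cancel, and so do those in `e`,
  -- because `v' + ρ = v + ρ'`.
  have key : C.StageNull (keep (Function.update k c (k c + 1))) V'
      ((v + algebraMap R S ρ') * algebraMap R S ζ) := by
    refine ⟨(v + algebraMap R S ρ') • d + g + l, add_mem (add_mem (Submodule.smul_mem _ _ hd) hg)
      hl, ?_⟩
    rw [map_add, map_add, map_smul, k3, k4, mul_smul, ← k1]
    have : v' + algebraMap R S ρ = v + algebraMap R S ρ' := by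
      rw [hv', map_add]
      linear_combination algebraMap R S ρ * h2
    have hk := congrArg (· • e) this
    simp only [add_smul] at hk ⊢
    linear_combination (norm := module) hk
  -- Line `j` is now merged too, so the values `v, v'` may be exchanged for `V (unit c i₀), 1`,
  -- which have the same product.
  have key' : C.StageNull (keep (Function.update k c (k c + 1))) (fun t => algebraMap R S (V t))
      ((v + algebraMap R S ρ') * algebraMap R S ζ) := by
    obtain ⟨q, hq, hqζ⟩ := key
    refine ⟨q, hq, ?_⟩
    rw [← hqζ]
    refine hC.diff_congr_of_mul_eq (c := c) hij ?_ ?_ ?_ (fun t h1 h2 => (e₂ t h1 h2).symm) ?_ hq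
    · rw [Function.update_self]; simp [hi₀]
    · rw [Function.update_self]; omega
    · rw [Function.update_of_ne]
      · exact hk
      · rw [Ne, Equiv.Perm.inv_eq_iff_eq]
        exact (G.disjoint c).symm
    · rw [e₀, e₁, hV j (by omega) (by omega), map_one, mul_one, hv']
      exact (quadraticAlgebra_root _ _).symm
  -- The coordinate of `v` sends the multiple `(v + ρ') ζ` back to `ζ`.
  have := StageNull.of_semilinear (algebraMap R S)
    (QuadraticAlgebra.imₗ (R := R) (V (unit c i₀)) (ρ + ρ')).toAddMonoidHom ?_ key'
  · rwa [show (QuadraticAlgebra.imₗ (R := R) (V (unit c i₀)) (ρ + ρ')).toAddMonoidHom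
      ((v + algebraMap R S ρ') * algebraMap R S ζ) = ζ from im_root_add_mul _ _ _ _] at this
  · exact fun r s => im_algebraMap_mul _ _ r s

end IsCableGrid

end Cable

end Grid

namespace Grid

/-! ### The completely merged complex -/

section Cable

variable {n p : ℕ}

theorem unit_zero_le {a c : Fin n} {i₀ i : Fin p} (h₀ : (i₀ : ℕ) = 0) :
    unit a i₀ ≤ unit c i ↔ a ≤ c := by
  rw [Fin.le_def, Fin.le_def, val_unit, val_unit, h₀, zero_add]
  constructor
  · intro h
    by_contra hca
    have h1 : (c : ℕ) + 1 ≤ a := by omega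
    have h2 := Nat.mul_le_mul_left p h1
    rw [mul_add] at h2
    have := i.2
    omega
  · intro h
    have := Nat.mul_le_mul_left p h
    omega

theorem unit_lt_zero {a c : Fin n} {i₀ i : Fin p} (h₀ : (i₀ : ℕ) = 0) :
    unit c i < unit a i₀ ↔ c < a := by
  rw [← not_le, ← not_le, unit_zero_le h₀]

theorem inArc_unit_zero {i₀ : Fin p} (h₀ : (i₀ : ℕ) = 0) (a b : Fin n) (t : Fin (n * p)) :
    InArc (unit a i₀) (unit b i₀) t ↔ InArc a b (finProdFinEquiv.symm t).1 := by
  obtain ⟨c, i, rfl⟩ := exists_unit t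
  rw [show finProdFinEquiv.symm (unit c i) = (c, i) from finProdFinEquiv.symm_apply_apply _]
  rw [inArc_iff, inArc_iff, unit_zero_le h₀, unit_lt_zero h₀, unit_lt_zero h₀]

variable {G : Grid n} {C : Grid (n * p)} {blk : Fin n → Equiv.Perm (Fin p)}

namespace IsCableGrid

/-- The embedding of the lines of a diagram into those of its cable. -/
def lineEmbedding (hC : IsCableGrid G C blk) (i₀ : Fin p) (h₀ : (i₀ : ℕ) = 0) :
    LineEmbedding n (n * p) where
  col := ⟨fun c => unit c i₀, fun _ _ h => (unit_inj.1 h).1⟩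
  row := ⟨fun c => unit c i₀, fun _ _ h => (unit_inj.1 h).1⟩
  colCell t := (finProdFinEquiv.symm t).1
  rowCell t := (finProdFinEquiv.symm t).1
  colCell_col c := congrArg Prod.fst (finProdFinEquiv.symm_apply_apply (c, i₀))
  rowCell_row c := congrArg Prod.fst (finProdFinEquiv.symm_apply_apply (c, i₀))
  inArc_col := inArc_unit_zero h₀
  inArc_row := inArc_unit_zero h₀
  Z := C.X
  z := G.X
  Z_col c := hC.X_unit c i₀

/-- With only the first line of each block kept, a block behaves as one square of `G`. Its `X`s give
weight `0 ^ p = 0`, and the variables of its `O`s multiply. -/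
theorem stageNull_iff {R : Type*} [CommRing R] (hC : IsCableGrid G C blk) (hp : 0 < p)
    (V : Fin (n * p) → R) (ζ : R) :
    C.StageNull (keep fun _ => p - 1) V ζ ↔
      G.StageNull Finset.univ (fun c => ∏ i, V (unit c i)) ζ := by
  set i₀ : Fin p := ⟨0, hp⟩
  set L := hC.lineEmbedding i₀ rfl with hL
  have hlines : L.lines = keep fun _ => p - 1 := by
    ext t
    obtain ⟨c, i, rfl⟩ := exists_unit t
    rw [L.mem_lines, unit_mem_keep]
    constructor
    · rintro ⟨c', h⟩
      exact Or.inl (congrArg Fin.val (unit_inj.1 h).2.symm)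
    · intro h
      have hi := i.2
      exact ⟨c, unit_inj.2 ⟨rfl, Fin.ext (show 0 = (i : ℕ) by omega)⟩⟩
  have hX : L.state G.stateMinus = C.stateMinus :=
    (L.eq_state_iff.2 ⟨fun _ _ => rfl, fun c => hC.X_unit c i₀⟩).symm
  have hplus : L.state G.statePlus = C.statePlus := by
    refine (L.eq_state_iff.2 ⟨hlines ▸ hC.statePlus_mem_compat _, fun c => ?_⟩).symm
    obtain ⟨c, rfl⟩ := (finRotate n).surjective c
    obtain ⟨i₁, hi₁⟩ : ∃ i : Fin p, (i : ℕ) + 1 = p := ⟨⟨p - 1, by omega⟩, by simp; omega⟩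
    have hrot : ∀ c, finRotate (n * p) (unit c i₁) = unit (finRotate n c) i₀ := by
      intro c
      ext
      rw [val_finRotate, val_unit, val_unit, val_finRotate]
      have hc := c.2
      have e1 : (i₁ : ℕ) + p * c + 1 = p * (c + 1) := by rw [mul_add]; omega
      rw [e1, show (i₀ : ℕ) = 0 from rfl, mul_comm n p]
      by_cases h : (c : ℕ) + 1 = n
      · rw [if_pos (by rw [h]), if_pos h, mul_zero, zero_add]
      · rw [if_neg, if_neg h, zero_add]
        intro h'
        exact h (Nat.eq_of_mul_eq_mul_left hp h')
    show C.statePlus (unit (finRotate n c) i₀) = unit (G.statePlus (finRotate n c)) i₀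
    rw [← hrot, statePlus_finRotate, hC.X_unit, hrot, statePlus_finRotate]
  have hw : L.weights (C.gridWeights V) = G.gridWeights fun c => ∏ i, V (unit c i) := by
    have h : C.gridWeights V = fun c r => spots Finset.univ id C.X (fun _ => 0) c r *
        spots Finset.univ id C.O V c r := by
      funext c r
      exact gridWeights_eq_spots C V c r
    have hcell : ∀ c i, L.colCell (unit c i) = c := fun c i =>
      congrArg Prod.fst (finProdFinEquiv.symm_apply_apply (c, i))
    have hcell' : ∀ c i, L.rowCell (unit c i) = c := hcell
    funext c r
    rw [h, L.weights_mul, L.weights_spots, L.weights_spots, gridWeights_eq_spots]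
    congr 1
    · rw [spots, spots, ← finProdFinEquiv.prod_comp, Fintype.prod_prod_type]
      refine Finset.prod_congr rfl fun c' _ => ?_
      change ∏ i, spot (L.colCell (unit c' i)) (L.rowCell (C.X (unit c' i))) (0 : R) c r = _
      simp only [hC.X_unit, hcell, hcell', Finset.prod_const, Finset.card_univ, Fintype.card_fin,
        id]
      rw [spot]
      split_ifs
      · exact zero_pow hp.ne'
      · exact one_pow p
    · rw [spots, spots, ← finProdFinEquiv.prod_comp, Fintype.prod_prod_type]
      refine Finset.prod_congr rfl fun c' _ => ?_
      change ∏ i, spot (L.colCell (unit c' i)) (L.rowCell (C.O (unit c' i))) (V (unit c' i)) c r = _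
      simp only [hC.O_unit, hcell, hcell', id, spot]
      split_ifs
      · rfl
      · exact Finset.prod_const_one
  have h := L.exists_diff_iff (C.gridWeights V) (ζ • G.etaChain R)
  have hη : Finsupp.lmapDomain R R L.state (G.etaChain R) = C.etaChain R := by
    rw [etaChain, map_add]
    simp only [Finsupp.lmapDomain_apply, Finsupp.mapDomain_single, hplus, hX, etaChain]
  rw [hw, hlines, map_smul, hη] at h
  refine h.symm.trans ?_
  simp [StageNull, compat]

variable {R : Type*} [CommRing R] {k : Fin n → ℕ} {V : Fin (n * p) → R} {ζ : R}

/-- Undoing a merge costs nothing, since the merged states form a subcomplex. -/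
theorem stageNull_of_update (hC : IsCableGrid G C blk) {c : Fin n} (hc : k c + 1 < p)
    (h : C.StageNull (keep (Function.update k c (k c + 1))) V ζ) : C.StageNull (keep k) V ζ := by
  obtain ⟨v, hv, hζ⟩ := h
  obtain ⟨j, hj⟩ : ∃ j : Fin p, (j : ℕ) = k c + 1 := ⟨⟨k c + 1, hc⟩, rfl⟩
  obtain ⟨i, hi⟩ : ∃ i : Fin p, (i : ℕ) = k c := ⟨⟨k c, by omega⟩, rfl⟩
  have ha : (unit c i : ℕ) + 1 = unit c j := by rw [val_unit, val_unit]; omega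
  have hs : (unit (G.X c) i : ℕ) + 1 = unit (G.X c) j := by rw [val_unit, val_unit]; omega
  have ha₀ : unit c j ∈ keep k := unit_mem_keep.2 (Or.inr (by omega))
  rw [keep_update hj] at hv hζ
  have hv' : v ∈ Finsupp.supported R R (compat (keep k) C.X) :=
    Finsupp.supported_mono (fun x hx => ((mem_compat_erase ha₀).1 hx).1) hv
  refine ⟨v, hv', ?_⟩
  rw [← hζ, ← hC.diff_weightsOff hi hj subset_rfl V hv',
    ← hC.diff_weightsOff hi hj (Finset.erase_subset _ _) V hv,
    diff_erase ha hs ha₀ (hC.X_unit c j) _ _ hv]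

theorem stageNull_univ (hC : IsCableGrid G C blk) (hk : ∀ c, k c < p)
    (h : C.StageNull (keep k) V ζ) : C.StageNull Finset.univ V ζ := by
  induction hs : ∑ c, k c generalizing k with
  | zero =>
    rwa [show k = 0 from funext fun c => Finset.sum_eq_zero_iff.1 hs c (Finset.mem_univ c),
      keep_zero] at h
  | succ s ih =>
    obtain ⟨c, -, hc⟩ := Finset.exists_ne_zero_of_sum_ne_zero (show ∑ c, k c ≠ 0 by omega)
    have e1 : Function.update (Function.update k c (k c - 1)) c
        (Function.update k c (k c - 1) c + 1) = k := by
      rw [Function.update_idem, Function.update_self, Nat.sub_add_cancel (by omega),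
        Function.update_eq_self]
    refine ih (k := Function.update k c (k c - 1)) (fun c' => ?_) ?_ ?_
    · by_cases h : c' = c
      · rw [h, Function.update_self]
        have := hk c
        omega
      · rw [Function.update_of_ne h]
        exact hk c'
    · refine hC.stageNull_of_update (c := c) ?_ (by rwa [e1])
      rw [Function.update_self]
      have := hk c
      omega
    · rw [Finset.sum_update_of_mem (Finset.mem_univ c)]
      rw [← Finset.add_sum_erase _ _ (Finset.mem_univ c)] at hs
      rw [← Finset.erase_eq]
      omega

end IsCableGrid

end Cable

end Grid

namespace Grid

/-! ### Extraction of a coefficient -/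

section Functional

variable {σ : Type*} {R : Type*} [CommRing R]

/-- Over the subring generated by the powers `X c ^ w c`, the polynomial ring is free on the
monomials with exponents below `w`. `β` is the coordinate at the monomial of exponent `o`, with `X c
^ w c` renamed to `X c`. -/
theorem exists_semilinear [Finite σ] (w o : σ → ℕ) (h : ∀ c, o c < w c) :
    ∃ β : MvPolynomial σ R →+ MvPolynomial σ R,
      (∀ r s, β (MvPolynomial.aeval (fun c => MvPolynomial.X c ^ w c) r * s) = r * β s) ∧
      β (MvPolynomial.monomial (Finsupp.equivFunOnFinite.symm o) 1) = 1 := by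
  classical
  set e : (σ →₀ ℕ) → (σ →₀ ℕ) := fun m => Finsupp.equivFunOnFinite.symm fun c => w c * m c + o c
    with he
  have he' : ∀ m c, e m c = w c * m c + o c := fun m c => rfl
  have hinj : Function.Injective e := by
    intro m m' hm
    ext c
    have := DFunLike.congr_fun hm c
    rw [he', he'] at this
    exact Nat.eq_of_mul_eq_mul_left (by have := h c; omega) (Nat.add_right_cancel this)
  set β := (MvPolynomial.basisMonomials σ R).constr R fun m =>
    if hm : ∃ m', e m' = m then MvPolynomial.monomial hm.choose (1 : R) else 0 with hβ
  have hb : ∀ m, MvPolynomial.monomial m 1 = MvPolynomial.basisMonomials σ R m := fun m =>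
    (congrFun (MvPolynomial.coe_basisMonomials σ R) m).symm
  have hβ₀ : ∀ m, (¬ ∃ m', e m' = m) → β (MvPolynomial.monomial m 1) = 0 := by
    intro m hm
    rw [hb, hβ, Module.Basis.constr_basis, dif_neg hm]
  have hβ₁ : ∀ m, β (MvPolynomial.monomial (e m) 1) = MvPolynomial.monomial m 1 := by
    intro m
    have hm : ∃ m', e m' = e m := ⟨m, rfl⟩
    rw [hb, hβ, Module.Basis.constr_basis, dif_pos hm,
      hinj hm.choose_spec]
  have hX : ∀ c s, β (MvPolynomial.X c ^ w c * s) = MvPolynomial.X c * β s := by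
    intro c s
    have key : β ∘ₗ LinearMap.mulLeft R (MvPolynomial.X c ^ w c) =
        LinearMap.mulLeft R (MvPolynomial.X c) ∘ₗ β := by
      refine (MvPolynomial.basisMonomials σ R).ext fun m => ?_
      rw [MvPolynomial.coe_basisMonomials, LinearMap.comp_apply, LinearMap.comp_apply,
        LinearMap.mulLeft_apply, LinearMap.mulLeft_apply, MvPolynomial.X_pow_eq_monomial,
        MvPolynomial.monomial_mul, one_mul]
      by_cases hm : ∃ m', e m' = m
      · obtain ⟨m', rfl⟩ := hm
        have : Finsupp.single c (w c) + e m' = e (Finsupp.single c 1 + m') := by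
          ext d
          rw [Finsupp.add_apply, he', he', Finsupp.add_apply]
          by_cases hd : c = d
          · subst hd
            rw [Finsupp.single_eq_same, Finsupp.single_eq_same]
            ring
          · rw [Finsupp.single_eq_of_ne' hd, Finsupp.single_eq_of_ne' hd, zero_add, zero_add]
        rw [this, hβ₁, hβ₁, MvPolynomial.X, MvPolynomial.monomial_mul, one_mul]
      · rw [hβ₀ m hm, mul_zero, hβ₀]
        rintro ⟨m', hm'⟩
        refine hm ⟨m' - Finsupp.single c 1, ?_⟩
        ext d
        have hd := DFunLike.congr_fun hm' d
        rw [he', Finsupp.add_apply] at hd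
        rw [he', Finsupp.tsub_apply]
        by_cases hcd : c = d
        · subst hcd
          rw [Finsupp.single_eq_same] at hd ⊢
          have h1 := h c
          rcases hq : m' c with _ | q
          -- Here `o c = w c + m c`, against `o c < w c`.
          · rw [hq] at hd
            omega
          · rw [hq, mul_add] at hd
            simp only [Nat.add_sub_cancel]
            omega
        · rw [Finsupp.single_eq_of_ne' hcd] at hd ⊢
          rw [Nat.sub_zero]
          omega
    exact LinearMap.congr_fun key s
  refine ⟨β.toAddMonoidHom, fun r => ?_, ?_⟩
  · change ∀ s, β (MvPolynomial.aeval (fun c => MvPolynomial.X c ^ w c) r * s) = r * β s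
    induction r using MvPolynomial.induction_on with
    | C a =>
      intro s
      rw [MvPolynomial.aeval_C, MvPolynomial.algebraMap_eq, MvPolynomial.C_mul',
        MvPolynomial.C_mul', map_smul]
    | add p q hp hq =>
      intro s
      rw [map_add, add_mul, map_add, hp, hq, add_mul]
    | mul_X p c hp =>
      intro s
      rw [map_mul (MvPolynomial.aeval _), MvPolynomial.aeval_X, mul_assoc, hp, hX, mul_assoc]
  · have : e 0 = Finsupp.equivFunOnFinite.symm o := by
      ext c
      simp [he']
    change β _ = 1
    rw [← this, hβ₁]
    rfl

end Functional

/-! ### The order in which strands are merged -/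

section Cable

variable {n p : ℕ} {G : Grid n} {C : Grid (n * p)} {blk : Fin n → Equiv.Perm (Fin p)}
  {B : Finset (Fin n)} {k : Fin n → ℕ}

/-- A power of the variables of the blocks in `B` times `x⁺ + x⁻` is a boundary in the complex with
lines `keep k`, whenever the variables of each block in `B` coincide and the variables of the merged
strands of the other blocks are `1`, except for the first one. -/
def StagesNull (C : Grid (n * p)) (B : Finset (Fin n)) (k : Fin n → ℕ) : Prop :=
  ∀ (R : Type) [CommRing R] [CharP R 2] (V : Fin (n * p) → R) (U : Fin n → R),
    (∀ b ∈ B, ∀ i, V (unit b i) = U b) →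
    (∀ c, c ∉ B → ∀ i : Fin p, 1 ≤ (i : ℕ) → (i : ℕ) ≤ k c → V (unit c i) = 1) →
    C.StageNull (keep k) V (∏ b ∈ B, U b ^ k b)

theorem Null.stagesNull (h : C.Null) (B : Finset (Fin n)) : StagesNull C B 0 := by
  intro R _ _ V U _ _
  obtain ⟨v, hv⟩ := h.nullOver V
  rw [keep_zero]
  exact ⟨v, by simp [compat], by simp [hv]⟩

namespace IsCableGrid

/-- The base blocks are merged while all others are untouched, as the walk around the component
requires. Each merge raises one exponent by one. -/
theorem stagesNull_base (hC : IsCableGrid G C blk)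
    (hB : ∀ b ∈ B, ∀ c ∈ B, (G.X⁻¹ * G.O).SameCycle c b → c = b) (hk : ∀ c, c ∉ B → k c = 0)
    {b : Fin n} (hb : b ∈ B) (hkb : k b + 1 < p) (h : StagesNull C B k) :
    StagesNull C B (Function.update k b (k b + 1)) := by
  intro R _ _ V U hU hV
  have h1 := hC.stageNull_base (j := ⟨k b + 1, hkb⟩) (c := b) rfl (hU b hb)
    (fun c hc hne => hk c fun hcB => hne (hB b hb c hcB hc))
    (h R V U hU fun c hc i hi hi' => by rw [hk c hc] at hi'; omega)
  rwa [← Finset.mul_prod_erase _ _ hb, ← mul_assoc, ← pow_succ',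
    show U b ^ (k b + 1) * ∏ c ∈ B.erase b, U c ^ k c =
      ∏ c ∈ B, U c ^ Function.update k b (k b + 1) c by
    rw [← Finset.mul_prod_erase _ _ hb, Function.update_self]
    congr 1
    refine Finset.prod_congr rfl fun c hc => ?_
    rw [Function.update_of_ne (Finset.ne_of_mem_erase hc)]] at h1

/-- Since `StagesNull` ranges over all rings of characteristic two, the hypothesis is available over
the quadratic extension. -/
theorem stagesNull_step (hC : IsCableGrid G C blk) {c : Fin n} (hc : c ∉ B) (hkc : k c + 1 < p)
    (hk : p ≤ k (G.X⁻¹ (G.O c)) + 1) (h : StagesNull C B k) :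
    StagesNull C B (Function.update k c (k c + 1)) := by
  intro R _ _ V U hU hV
  have h1 : ∏ b ∈ B, U b ^ Function.update k c (k c + 1) b = ∏ b ∈ B, U b ^ k b :=
    Finset.prod_congr rfl fun b hb => by
      rw [Function.update_of_ne (by rintro rfl; exact hc hb)]
  rw [h1]
  refine hC.stageNull_step (j := ⟨k c + 1, hkc⟩) rfl hk (fun i hi hi' => hV c hc i hi ?_) ?_
  · rwa [Function.update_self]
  · intro S _ _ _ V' h2 h3
    have h4 := h S V' (fun b => algebraMap R S (U b)) (fun b hb i => ?_) fun c' hc' i hi hi' => ?_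
    · simp only [← map_pow] at h4
      rwa [← map_prod] at h4
    · rw [h2 b i (by rintro rfl; exact hc hb), hU b hb]
    · by_cases hcc : c' = c
      · subst hcc
        exact h3 i hi hi'
      · rw [h2 c' i hcc, hV c' hc' i hi (by rwa [Function.update_of_ne hcc]), map_one]

theorem update_update_pred {c : Fin n} (hc : k c ≠ 0) :
    Function.update (Function.update k c (k c - 1)) c
      (Function.update k c (k c - 1) c + 1) = k := by
  rw [Function.update_idem, Function.update_self, Nat.sub_add_cancel (by omega),
    Function.update_eq_self]

theorem sum_update_pred {c : Fin n} (hc : k c ≠ 0) {s : ℕ} (hs : ∑ c, k c = s + 1) :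
    ∑ c', Function.update k c (k c - 1) c' = s := by
  rw [Finset.sum_update_of_mem (Finset.mem_univ c), ← Finset.erase_eq]
  rw [← Finset.add_sum_erase _ _ (Finset.mem_univ c)] at hs
  omega

theorem stagesNull_of_base (hC : IsCableGrid G C blk)
    (hB : ∀ b ∈ B, ∀ c ∈ B, (G.X⁻¹ * G.O).SameCycle c b → c = b) (hk : ∀ c, c ∉ B → k c = 0)
    (hkp : ∀ c, k c < p) (h : C.Null) : StagesNull C B k := by
  induction hs : ∑ c, k c generalizing k with
  | zero =>
    rw [show k = 0 from funext fun c => Finset.sum_eq_zero_iff.1 hs c (Finset.mem_univ c)]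
    exact h.stagesNull B
  | succ s ih =>
    obtain ⟨c, -, hc⟩ := Finset.exists_ne_zero_of_sum_ne_zero (show ∑ c, k c ≠ 0 by omega)
    have hcB : c ∈ B := by
      by_contra h
      exact hc (hk c h)
    have hcp := hkp c
    rw [← update_update_pred hc]
    refine hC.stagesNull_base hB (fun c' hc' => ?_) hcB ?_ (ih (fun c' hc' => ?_) (fun c' => ?_)
      (sum_update_pred hc hs))
    · rw [Function.update_of_ne (by rintro rfl; exact hc' hcB), hk c' hc']
    · rw [Function.update_self]
      omega
    · rw [Function.update_of_ne (by rintro rfl; exact hc' hcB), hk c' hc']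
    · by_cases h : c' = c
      · rw [h, Function.update_self]
        omega
      · rw [Function.update_of_ne h]
        exact hkp c'

/-- The base blocks are completed first; the other blocks follow backwards along each component,
each after its successor has been completed. The induction undoes the last merge. -/
theorem stagesNull (hC : IsCableGrid G C blk)
    (hB : ∀ b ∈ B, ∀ c ∈ B, (G.X⁻¹ * G.O).SameCycle c b → c = b)
    (hB' : ∀ c, ∃ b ∈ B, (G.X⁻¹ * G.O).SameCycle c b) (hkp : ∀ c, k c < p)
    (hkB : ∀ b ∈ B, k b + 1 = p) (hk : ∀ c, c ∉ B → k c ≠ 0 → k (G.X⁻¹ (G.O c)) + 1 = p)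
    (h : C.Null) : StagesNull C B k := by
  induction hs : ∑ c ∈ Bᶜ, k c generalizing k with
  | zero =>
    refine hC.stagesNull_of_base hB (fun c hc => ?_) hkp h
    exact Finset.sum_eq_zero_iff.1 hs c (Finset.mem_compl.2 hc)
  | succ s ih =>
    obtain ⟨c₀, hc₀, hk₀⟩ := Finset.exists_ne_zero_of_sum_ne_zero (show ∑ c ∈ Bᶜ, k c ≠ 0 by omega)
    -- A merge may be undone in a block that is the successor of no merged block off `B`. If there
    -- were none, walking back from `c₀` would never meet `B`, although `B` contains a block of that
    -- cycle.
    obtain ⟨c, hcB, hc, hpred⟩ : ∃ c, c ∉ B ∧ k c ≠ 0 ∧ ∀ c', c' ∉ B → k c' ≠ 0 →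
        G.X⁻¹ (G.O c') ≠ c := by
      by_contra hcon
      push Not at hcon
      obtain ⟨b, hb, hcb⟩ := hB' c₀
      have key : ∀ m : ℕ, ∃ c, c ∉ B ∧ k c ≠ 0 ∧ ((G.X⁻¹ * G.O) ^ m) c = c₀ := by
        intro m
        induction m with
        | zero => exact ⟨c₀, Finset.mem_compl.1 hc₀, hk₀, rfl⟩
        | succ m ih =>
          obtain ⟨c, h1, h2, h3⟩ := ih
          obtain ⟨c', h4, h5, h6⟩ := hcon c h1 h2
          refine ⟨c', h4, h5, ?_⟩
          rw [pow_succ, Equiv.Perm.mul_apply, Equiv.Perm.mul_apply, h6, h3]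
      obtain ⟨m, -, hm⟩ := hcb.symm.exists_pow_eq'
      obtain ⟨c, h1, -, h3⟩ := key m
      rw [← hm] at h3
      exact h1 (((G.X⁻¹ * G.O) ^ m).injective h3 ▸ hb)
    have hcp := hkp c
    have hself : G.X⁻¹ (G.O c) ≠ c := by
      rw [Ne, Equiv.Perm.inv_eq_iff_eq]
      exact (G.disjoint c).symm
    rw [← update_update_pred hc]
    refine hC.stagesNull_step hcB ?_ ?_ (ih (fun c' => ?_) (fun b hb => ?_)
      (fun c' hc' hk' => ?_) ?_)
    · rw [Function.update_self]
      omega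
    · rw [Function.update_of_ne hself, hk c hcB hc]
    · by_cases h : c' = c
      · rw [h, Function.update_self]
        omega
      · rw [Function.update_of_ne h]
        exact hkp c'
    · rw [Function.update_of_ne (by rintro rfl; exact hcB hb), hkB b hb]
    · have hk'' : k c' ≠ 0 := by
        by_cases h : c' = c
        · rwa [h]
        · rwa [Function.update_of_ne h] at hk'
      rw [Function.update_of_ne (hpred c' hc' hk''), hk c' hc' hk'']
    · rw [Finset.sum_update_of_mem (Finset.mem_compl.2 hcB), ← Finset.erase_eq]
      rw [← Finset.add_sum_erase _ _ (Finset.mem_compl.2 hcB)] at hs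
      omega

end IsCableGrid

end Cable

end Grid

namespace Grid

variable {n p : ℕ} {G : Grid n}

/-! ### Comparison of a grid and its cable -/

theorem exists_cycle_representatives (π : Equiv.Perm (Fin n)) : ∃ B : Finset (Fin n),
    (∀ b ∈ B, ∀ c ∈ B, π.SameCycle c b → c = b) ∧ ∀ c, ∃ b ∈ B, π.SameCycle c b := by
  set s := Equiv.Perm.SameCycle.setoid π
  refine ⟨Finset.univ.image fun c => (Quotient.mk s c).out, ?_, fun c => ⟨_,
    Finset.mem_image_of_mem _ (Finset.mem_univ c), ?_⟩⟩
  · simp only [Finset.mem_image, Finset.mem_univ, true_and]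
    rintro _ ⟨b, rfl⟩ _ ⟨c, rfl⟩ h
    have h' := Quotient.sound (s := s) h
    rw [Quotient.out_eq, Quotient.out_eq] at h'
    rw [h']
  · exact Equiv.Perm.SameCycle.symm (Quotient.exact (s := s) (Quotient.out_eq _))

theorem StageNull.null {V : Fin n → Coeff n} (hV : V = MvPolynomial.X)
    (h : G.StageNull Finset.univ V 1) : G.Null := by
  obtain ⟨v, -, hv⟩ := h
  rw [one_smul, hV] at hv
  exact ⟨v, hv⟩

theorem IsCableGrid.null_iff {C : Grid (n * p)} {blk : Fin n → Equiv.Perm (Fin p)}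
    (hC : IsCableGrid G C blk) (hp : 0 < p) : C.Null ↔ G.Null := by
  constructor
  · intro h
    obtain ⟨B, hB, hB'⟩ := exists_cycle_representatives (G.X⁻¹ * G.O)
    have h1 := hC.stagesNull (k := fun _ => p - 1) hB hB' (fun _ => by omega)
      (fun _ _ => by omega) (fun _ _ _ => by omega) h
    set i₀ : Fin p := ⟨0, hp⟩
    -- In a base block all strands get the same variable; elsewhere the first strand keeps a
    -- variable and the others get `1`. After complete merging the variables of `G` become `X c ^ p`
    -- and `X c` respectively, and the multiple is the product of the `X b ^ (p - 1)`.
    set V : Fin (n * p) → Coeff n := fun t =>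
      if (finProdFinEquiv.symm t).1 ∈ B ∨ (finProdFinEquiv.symm t).2 = i₀ then
        MvPolynomial.X (finProdFinEquiv.symm t).1 else 1 with hV
    have hVu : ∀ c i, V (unit c i) = if c ∈ B ∨ i = i₀ then MvPolynomial.X c else 1 := by
      intro c i
      rw [hV]
      simp only [show finProdFinEquiv.symm (unit c i) = (c, i) from
        finProdFinEquiv.symm_apply_apply _]
    have h2 := h1 (Coeff n) V MvPolynomial.X (fun b hb i => by rw [hVu, if_pos (Or.inl hb)])
      (fun c hc i hi _ => by
        rw [hVu, if_neg]
        rintro (h | rfl)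
        · exact hc h
        · simp [i₀] at hi)
    rw [hC.stageNull_iff hp] at h2
    set w : Fin n → ℕ := fun c => if c ∈ B then p else 1 with hw
    set o : Fin n → ℕ := fun c => if c ∈ B then p - 1 else 0 with ho
    -- The functional exists because in each base block fewer powers were lost than the merged
    -- variable contains, `p - 1 < p`.
    obtain ⟨β, hβ, hβ₁⟩ := exists_semilinear (R := ZMod 2) w o fun c => by
      simp only [hw, ho]
      split_ifs <;> omega
    have hW : (fun c => ∏ i, V (unit c i)) = fun c =>
        (MvPolynomial.aeval (R := ZMod 2) fun c => (MvPolynomial.X c : Coeff n) ^ w c).toRingHom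
          (MvPolynomial.X c : Coeff n) := by
      funext c
      simp only [AlgHom.toRingHom_eq_coe, RingHom.coe_coe, MvPolynomial.aeval_X, hVu, hw]
      by_cases hc : c ∈ B
      · simp [hc]
      · simp [hc]
    have hζ : ∏ b ∈ B, (MvPolynomial.X b : Coeff n) ^ (p - 1) =
        MvPolynomial.monomial (Finsupp.equivFunOnFinite.symm o) 1 := by
      rw [MvPolynomial.monomial_eq, MvPolynomial.C_1, one_mul, Finsupp.prod_fintype _ _ (by simp)]
      simp [ho, pow_ite, Finset.prod_ite_mem]
    rw [hW, hζ] at h2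
    have h3 := StageNull.of_semilinear (V := MvPolynomial.X) _ β hβ h2
    rw [hβ₁] at h3
    exact h3.null rfl
  · intro h
    -- Sending each variable of `G` to the product of its strand variables gives the completely
    -- merged complex, a subcomplex of the complex of the cable.
    obtain ⟨v, hv⟩ := h.nullOver fun c => ∏ i, (MvPolynomial.X (unit c i) : Coeff (n * p))
    refine StageNull.null rfl (hC.stageNull_univ (k := fun _ => p - 1) (fun _ => by omega)
      ((hC.stageNull_iff hp _ _).2 ⟨v, by simp [compat], by rw [one_smul, hv]⟩))

theorem isCableGrid_cable (G : Grid n) (p : ℕ) (B : Finset (Fin n)) (s : ℤˣ) :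
    IsCableGrid G (G.cable p B s) (G.blockO p B s) where
  X_unit c i := by simp [cable, unit, Equiv.permCongr_apply]
  O_unit c i := by simp [cable, unit, Equiv.permCongr_apply]

end Grid

theorem theorem1p2 (K K' : LegendrianLink) (hK : K.IsKnot) (p : ℕ) (hp : 2 ≤ p)
    (r ε : ℤ) (hε : ε = 1 ∨ ε = -1) (hK' : K.IsCable p (-(p * r) + ε) K')
    (n n' : ℕ) (D : Grid n) (D' : Grid n')
    (hD : D.toLegendrian = K) (hD' : D'.toLegendrian = K') :
    (D'.lambdaPlus = D'.lambdaMinus ↔ D.lambdaPlus = D.lambdaMinus) ∧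
      (D'.eta = 0 ↔ D.eta = 0) := by
  obtain ⟨m, G, B, s, hG, -, -, hC⟩ := hK'
  have h : D'.Null ↔ D.Null := by
    rw [Grid.null_iff_of_toLegendrian_eq (hD'.trans hC.symm),
      (Grid.isCableGrid_cable G p B s).null_iff (by omega),
      Grid.null_iff_of_toLegendrian_eq (hG.trans hD.symm)]
  rw [Grid.lambda_eq_iff, Grid.lambda_eq_iff, Grid.eta_eq_zero_iff, Grid.eta_eq_zero_iff]
  exact ⟨h, h⟩
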